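/- **Setting.** All vector spaces, algebras and unadorned tensor products are over $\mathbb{C}$, and algebras are unital. *Quantum group.* Let $G$ be the dense $*$-Hopf algebra of a compact matrix quantum group: $G$ is a Hopf algebra (coproduct $\phi$, counit $\epsilon$, antipode $\kappa$) with a $*$-operation for which $\phi$ is a $*$-map, it is spanned by the matrix coefficients of its irreducible finite-dimensional unitary corepresentations, and it is generated as a $*$-algebra by the coefficients of one finite-dimensional unitary corepresentation. *Calculus on the group.* Let $(\Gamma,d)$ be a bicovariant first-order differential $*$-calculus on $G$, and let $\Gamma^\wedge=\otimes_G^\bullet\Gamma/\mathcal{Q}$ be its universal differential envelope, where $\mathcal{Q}$ is the two-sided ideal generated by the elements $\sum_i dg_i\otimes_G dh_i$ with $\sum_i g_i\,dh_i=0$. Then $d$ extends to $\Gamma^\wedge$, and $\Gamma^\wedge$ is a graded differential Hopf algebra: $\phi:\Gamma^\wedge\to\Gamma^\wedge\otimes\Gamma^\wedge$ is the morphism of graded differential algebras (into the graded tensor product) that extends the coproduct of $G$, $\epsilon$ vanishes in positive degrees, and $\kappa$ is the graded antimultiplicative extension of the antipode that commutes with $d$. Write $(\phi\otimes\mathrm{id})\phi(\vartheta)=\vartheta^{(1)}\otimes\vartheta^{(2)}\otimes\vartheta^{(3)}$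 and let $$\mathrm{Ad}(\vartheta)=(-1)^{\partial\vartheta^{(1)}\partial\vartheta^{(2)}}\,\vartheta^{(2)}\otimes\kappa(\vartheta^{(1)})\vartheta^{(3)},$$ where $\partial$ denotes the degree. *Bundle.* Let $GM$ be a $*$-algebra with a coaction $\Phi:GM\to GM\otimes G$ that is a $*$-homomorphism, such that $x\otimes y\mapsto (x\otimes 1)\Phi(y)$ maps $GM\otimes GM$ onto $GM\otimes G$. The base is $M=\{x\in GM:\Phi(x)=x\otimes 1\}$. Assume that for each irreducible unitary corepresentation $\alpha$ of $G$ on $\mathbb{C}^{n}$, with standard basis $e_1,\dots,e_n$, there are finitely many intertwiners $T_1,\dots,T_m$ from $\alpha$ to $\Phi$ such that $x_{ki}=T_k(e_i)$ satisfy $\sum_k x_{ki}^{*}x_{kj}=\delta_{ij}\mathbb{1}$ for all $i,j$. *Calculus on the bundle.* Let $\Omega(GM)$ be a graded differential $*$-algebra with $\Omega^0(GM)=GM$ that is generated, as a graded differential algebra, by $GM$. Assume that $\Phi$ extends to a morphism of graded differential algebras $\Psi:\Omega(GM)\to\Omega(GM)\otimes\Gamma^\wedge$ into the graded tensor product. Put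 $\Omega(M)=\{\mu\in\Omega(GM):\Psi(\mu)=\mu\otimes\mathbb{1}\}$, and let $m$ denote multiplication in $\Omega(GM)$. *The two sets of maps.* - Let $\mathcal{A}$ be the group of all graded (degree-preserving) left $\Omega(M)$-module automorphisms $\mathfrak{F}$ of $\Omega(GM)$ with $\mathfrak{F}(\mathbb{1})=\mathbb{1}$ and $(\mathfrak{F}\otimes\mathrm{id})\circ\Psi=\Psi\circ\mathfrak{F}$, with the product $(\mathfrak{F}_1\circ\mathfrak{F}_2)(w)=\mathfrak{F}_2(\mathfrak{F}_1(w))$. - For linear maps $\mathfrak{f}_1,\mathfrak{f}_2:\Gamma^\wedge\to\Omega(GM)$ put $\mathfrak{f}_1*\mathfrak{f}_2=m\circ(\mathfrak{f}_1\otimes\mathfrak{f}_2)\circ\phi$. Let $\mathcal{C}$ be the set of all graded linear maps $\mathfrak{f}:\Gamma^\wedge\to\Omega(GM)$ with $\mathfrak{f}(\mathbb{1})=\mathbb{1}$ and $(\mathfrak{f}\otimes\mathrm{id})\circ\mathrm{Ad}=\Psi\circ\mathfrak{f}$ for which there is a graded linear map $\mathfrak{f}^{-1}:\Gamma^\wedge\to\Omega(GM)$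 with $\mathfrak{f}*\mathfrak{f}^{-1}=\mathfrak{f}^{-1}*\mathfrak{f}=\mathbb{1}\epsilon$. **Proposition.** 1. The map $\widetilde\beta:\Omega(GM)\otimes_{\Omega(M)}\Omega(GM)\to\Omega(GM)\otimes\Gamma^\wedge$, $\widetilde\beta(w\otimes z)=(w\otimes\mathbb{1})\Psi(z)$, is bijective. Hence the quantum translation map $\mathrm{qtrs}:\Gamma^\wedge\to\Omega(GM)\otimes_{\Omega(M)}\Omega(GM)$, $\mathrm{qtrs}(\vartheta)=\widetilde\beta^{-1}(\mathbb{1}\otimes\vartheta)$, is defined. 2. $\mathcal{C}$ is a group under $*$, with unit $\mathbb{1}\epsilon$. 3. The map $$\mathcal{A}\to\mathcal{C},\qquad \mathfrak{F}\mapsto \mathfrak{f}_{\mathfrak{F}}=m\circ(\mathrm{id}\otimes_{\Omega(M)}\mathfrak{F})\circ\mathrm{qtrs},$$ is an isomorphism of groups, and its inverse is $$\mathcal{C}\to\mathcal{A},\qquad \mathfrak{f}\mapsto \mathfrak{F}_{\mathfrak{f}}=m\circ(\mathrm{id}\otimes\mathfrak{f})\circ\Psi.$$ -/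

import Mathlib

open scoped TensorProduct DirectSum
open MulOpposite (op)

noncomputable section

set_option linter.unusedSectionVars false

namespace QGauge

section Calculus

variable {G Γ : Type*} [Ring G] [Algebra ℂ G]
  [AddCommGroup Γ] [Module ℂ Γ] [Module G Γ] [Module Gᵐᵒᵖ Γ]
  [IsScalarTower ℂ G Γ] [IsScalarTower ℂ Gᵐᵒᵖ Γ] [SMulCommClass G Gᵐᵒᵖ Γ]

variable (G Γ) in
/-- A first-order differential calculus on the algebra `G` with values in the `G`-bimodule `Γ`
(the right action of `a` is the action of `op a`). -/
structure FODC where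
  d : G →ₗ[ℂ] Γ
  leibniz : ∀ a b : G, d (a * b) = op b • d a + a • d b
  span_range : Submodule.span G (Set.range d) = ⊤

namespace FODC

variable (c : FODC G Γ)

/-- The map `G ⊗ G → Γ`, `a ⊗ b ↦ a · db`. -/
def form : G ⊗[ℂ] G →ₗ[ℂ] Γ :=
  TensorProduct.lift ((Algebra.lsmul ℂ ℂ Γ).toLinearMap.compl₂ c.d)

@[simp] theorem form_tmul (a b : G) : c.form (a ⊗ₜ b) = a • c.d b := rfl

theorem d_one : c.d 1 = 0 := by
  have h := c.leibniz 1 1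
  simp at h
  exact h

theorem form_surjective : Function.Surjective c.form := by
  intro ξ
  have h : ξ ∈ Submodule.span G (Set.range c.d) := c.span_range ▸ Submodule.mem_top
  induction h using Submodule.span_induction with
  | mem x hx => obtain ⟨g, rfl⟩ := hx; exact ⟨1 ⊗ₜ g, by simp⟩
  | zero => exact ⟨0, map_zero _⟩
  | add x y _ _ hx hy =>
    obtain ⟨u, rfl⟩ := hx; obtain ⟨v, rfl⟩ := hy; exact ⟨u + v, map_add _ _ _⟩
  | smul a x _ hx =>
    obtain ⟨u, rfl⟩ := hx
    refine ⟨(LinearMap.mulLeft ℂ a).rTensor G u, ?_⟩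
    rename_i hu
    clear hu
    induction u using TensorProduct.induction_on with
    | zero => simp
    | tmul x y => simp [mul_smul]
    | add x y hx hy => simp only [map_add, smul_add, hx, hy]

/-- A linear map on `G ⊗ G` that kills the kernel of `form` descends to `Γ`. -/
def desc {N : Type*} [AddCommGroup N] [Module ℂ N] (T : G ⊗[ℂ] G →ₗ[ℂ] N)
    (h : ∀ x, c.form x = 0 → T x = 0) : Γ →ₗ[ℂ] N :=
  (LinearMap.ker c.form).liftQ T (fun x hx => h x hx) ∘ₗ
    (c.form.quotKerEquivOfSurjective c.form_surjective).symm.toLinearMap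

theorem desc_form {N : Type*} [AddCommGroup N] [Module ℂ N] (T : G ⊗[ℂ] G →ₗ[ℂ] N)
    (h : ∀ x, c.form x = 0 → T x = 0) (x : G ⊗[ℂ] G) : c.desc T h (c.form x) = T x := by
  have : (c.form.quotKerEquivOfSurjective c.form_surjective).symm (c.form x) =
      Submodule.Quotient.mk x := by
    rw [LinearEquiv.symm_apply_eq]; rfl
  rw [desc, LinearMap.comp_apply, LinearEquiv.coe_coe, this]
  exact Submodule.liftQ_apply _ _ _

/-- The defining relations of the universal differential envelope: the free algebra on the vector
space `G × Γ` is divided by the multiplication of `G` and the bimodule structure of `Γ` (this gives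
the tensor algebra of the `G`-bimodule `Γ`), and by `∑ dgᵢ ⊗ dhᵢ` whenever `∑ gᵢ dhᵢ = 0`. -/
inductive EnvRel : TensorAlgebra ℂ (G × Γ) → TensorAlgebra ℂ (G × Γ) → Prop
  | one : EnvRel (TensorAlgebra.ι ℂ (1, 0)) 1
  | mul (a b : G) : EnvRel (TensorAlgebra.ι ℂ (a, 0) * TensorAlgebra.ι ℂ (b, 0))
      (TensorAlgebra.ι ℂ (a * b, 0))
  | left (a : G) (ξ : Γ) : EnvRel (TensorAlgebra.ι ℂ (a, 0) * TensorAlgebra.ι ℂ (0, ξ))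
      (TensorAlgebra.ι ℂ (0, a • ξ))
  | right (ξ : Γ) (a : G) : EnvRel (TensorAlgebra.ι ℂ (0, ξ) * TensorAlgebra.ι ℂ (a, 0))
      (TensorAlgebra.ι ℂ (0, op a • ξ))
  | quad (x : G ⊗[ℂ] G) (hx : c.form x = 0) :
      EnvRel (LinearMap.mul' ℂ _ (TensorProduct.map
        (TensorAlgebra.ι ℂ ∘ₗ LinearMap.inr ℂ G Γ ∘ₗ c.d)
        (TensorAlgebra.ι ℂ ∘ₗ LinearMap.inr ℂ G Γ ∘ₗ c.d) x)) 0

/-- The universal differential envelope `Γ^∧` of a first-order differential calculus. -/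
def Env : Type _ := RingQuot c.EnvRel

namespace Env

instance : Ring c.Env := inferInstanceAs (Ring (RingQuot c.EnvRel))
instance : Algebra ℂ c.Env := inferInstanceAs (Algebra ℂ (RingQuot c.EnvRel))

/-- The quotient map. -/
def mk : TensorAlgebra ℂ (G × Γ) →ₐ[ℂ] c.Env := RingQuot.mkAlgHom ℂ c.EnvRel

theorem mk_rel {x y : TensorAlgebra ℂ (G × Γ)} (h : c.EnvRel x y) : mk c x = mk c y :=
  RingQuot.mkAlgHom_rel ℂ h

/-- The canonical map `Γ → Γ^∧` onto the elements of degree one. -/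
def of1 : Γ →ₗ[ℂ] c.Env := (mk c).toLinearMap ∘ₗ TensorAlgebra.ι ℂ ∘ₗ LinearMap.inr ℂ G Γ

/-- The canonical map `G → Γ^∧` onto the elements of degree zero. -/
def of0 : G →ₐ[ℂ] c.Env :=
  AlgHom.ofLinearMap ((mk c).toLinearMap ∘ₗ TensorAlgebra.ι ℂ ∘ₗ LinearMap.inl ℂ G Γ)
    (by simpa using mk_rel c EnvRel.one)
    (fun a b => by simpa using (mk_rel c (EnvRel.mul a b)).symm)

theorem of0_def (a : G) : of0 c a = mk c (TensorAlgebra.ι ℂ (a, 0)) := rfl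
theorem of1_def (ξ : Γ) : of1 c ξ = mk c (TensorAlgebra.ι ℂ (0, ξ)) := rfl

theorem of0_mul_of1 (a : G) (ξ : Γ) : of0 c a * of1 c ξ = of1 c (a • ξ) := by
  simpa [of0_def, of1_def] using mk_rel c (EnvRel.left a ξ)

theorem of1_mul_of0 (ξ : Γ) (a : G) : of1 c ξ * of0 c a = of1 c (op a • ξ) := by
  simpa [of0_def, of1_def] using mk_rel c (EnvRel.right ξ a)

/-- `g ↦ dg`, as a map from `G` to `Γ^∧`. -/
def d0 : G →ₗ[ℂ] c.Env := of1 c ∘ₗ c.d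

theorem d0_apply (a : G) : d0 c a = of1 c (c.d a) := rfl

theorem d0_one : d0 c 1 = 0 := by rw [d0_apply, d_one, map_zero]

theorem d0_mul (a b : G) : d0 c (a * b) = d0 c a * of0 c b + of0 c a * d0 c b := by
  simp only [d0_apply, of1_mul_of0, of0_mul_of1, c.leibniz, map_add]

theorem mul_of0_d0 (x : G ⊗[ℂ] G) :
    LinearMap.mul' ℂ _ (TensorProduct.map (of0 c).toLinearMap (d0 c) x) = of1 c (c.form x) := by
  induction x using TensorProduct.induction_on with
  | zero => simp
  | tmul a b => simp [d0_apply, of0_mul_of1]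
  | add x y hx hy => simp only [map_add, hx, hy]

theorem mul_d0_d0 (x : G ⊗[ℂ] G) (hx : c.form x = 0) :
    LinearMap.mul' ℂ _ (TensorProduct.map (d0 c) (d0 c) x) = 0 := by
  have h := mk_rel c (EnvRel.quad x hx)
  rw [map_zero] at h
  rw [← h]
  clear h hx
  induction x using TensorProduct.induction_on with
  | zero => simp
  | tmul a b => simp [d0_apply, of1_def]
  | add x y hx hy => simp only [map_add, hx, hy]

@[elab_as_elim]
theorem induction {p : c.Env → Prop} (h0 : ∀ a, p (of0 c a)) (h1 : ∀ ξ, p (of1 c ξ))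
    (hadd : ∀ x y, p x → p y → p (x + y)) (hmul : ∀ x y, p x → p y → p (x * y)) (w : c.Env) :
    p w := by
  obtain ⟨t, rfl⟩ := RingQuot.mkAlgHom_surjective ℂ c.EnvRel w
  change p (mk c t)
  induction t using TensorAlgebra.induction with
  | algebraMap r => rw [AlgHom.commutes, ← (of0 c).commutes]; exact h0 _
  | ι x =>
    have : x = (x.1, 0) + (0, x.2) := by simp
    rw [this, map_add, map_add]
    exact hadd _ _ (h0 x.1) (h1 x.2)
  | mul a b ha hb => rw [map_mul]; exact hmul _ _ ha hb
  | add a b ha hb => rw [map_add]; exact hadd _ _ ha hb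

section Lift

variable {A : Type*} [Ring A] [Algebra ℂ A]

/-- An algebra map `f` on `G` and an `f`-derivation `δ` that respect the relations of the calculus
extend to `Γ^∧`, with `dg` going to `δ g`. -/
def lift (f : G →ₐ[ℂ] A) (δ : G →ₗ[ℂ] A)
    (hδ : ∀ a b, δ (a * b) = δ a * f b + f a * δ b)
    (h1 : ∀ x, c.form x = 0 → LinearMap.mul' ℂ A (TensorProduct.map f.toLinearMap δ x) = 0)
    (h2 : ∀ x, c.form x = 0 → LinearMap.mul' ℂ A (TensorProduct.map δ δ x) = 0) :
    c.Env →ₐ[ℂ] A :=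
  RingQuot.liftAlgHom ℂ ⟨TensorAlgebra.lift ℂ (f.toLinearMap.coprod
    (c.desc (LinearMap.mul' ℂ A ∘ₗ TensorProduct.map f.toLinearMap δ) h1)), by
      have hF : ∀ x : G ⊗[ℂ] G,
          c.desc (LinearMap.mul' ℂ A ∘ₗ TensorProduct.map f.toLinearMap δ) h1 (c.form x) =
            LinearMap.mul' ℂ A (TensorProduct.map f.toLinearMap δ x) := fun x => desc_form _ _ _ _
      intro x y h
      induction h with
      | one => simp
      | mul a b => simp
      | left a ξ =>
        obtain ⟨u, rfl⟩ := c.form_surjective ξ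
        simp only [map_mul, TensorAlgebra.lift_ι_apply, LinearMap.coprod_apply, map_zero, zero_add,
          add_zero, AlgHom.toLinearMap_apply]
        induction u using TensorProduct.induction_on with
        | zero => simp
        | tmul x y =>
          rw [form_tmul, ← mul_smul, ← form_tmul, ← form_tmul, hF, hF]
          simp [mul_assoc]
        | add x y hx hy => simp only [map_add, smul_add, mul_add, hx, hy]
      | right ξ a =>
        obtain ⟨u, rfl⟩ := c.form_surjective ξ
        simp only [map_mul, TensorAlgebra.lift_ι_apply, LinearMap.coprod_apply, map_zero, zero_add,
          add_zero, AlgHom.toLinearMap_apply]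
        induction u using TensorProduct.induction_on with
        | zero => simp
        | tmul x y =>
          have : op a • c.form (x ⊗ₜ y) = c.form (x ⊗ₜ (y * a)) - c.form ((x * y) ⊗ₜ a) := by
            simp [c.leibniz, mul_smul, smul_comm x (op a) (c.d y)]
          rw [this, map_sub, hF, hF, hF]
          simp [hδ, mul_add, mul_assoc]
        | add x y hx hy => simp only [map_add, smul_add, add_mul, hx, hy]
      | quad x hx =>
        rw [map_zero, ← h2 x hx]
        clear hx
        induction x using TensorProduct.induction_on with
        | zero => simp
        | tmul x y =>
          have e : ∀ g, c.desc (LinearMap.mul' ℂ A ∘ₗ TensorProduct.map f.toLinearMap δ) h1 (c.d g)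
              = δ g := fun g => by
            have := hF (1 ⊗ₜ g)
            simpa using this
          simp [e]
        | add x y hx hy => simp only [map_add, hx, hy]⟩

variable (f : G →ₐ[ℂ] A) (δ : G →ₗ[ℂ] A)
    (hδ : ∀ a b, δ (a * b) = δ a * f b + f a * δ b)
    (h1 : ∀ x, c.form x = 0 → LinearMap.mul' ℂ A (TensorProduct.map f.toLinearMap δ x) = 0)
    (h2 : ∀ x, c.form x = 0 → LinearMap.mul' ℂ A (TensorProduct.map δ δ x) = 0)

@[simp] theorem lift_of0 (a : G) : lift c f δ hδ h1 h2 (of0 c a) = f a := by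
  refine (RingQuot.liftAlgHom_mkAlgHom_apply ℂ _ _ _).trans ?_
  simp

theorem lift_of1 (x : G ⊗[ℂ] G) : lift c f δ hδ h1 h2 (of1 c (c.form x)) =
    LinearMap.mul' ℂ A (TensorProduct.map f.toLinearMap δ x) := by
  refine (RingQuot.liftAlgHom_mkAlgHom_apply ℂ _ _ _).trans ?_
  simp [desc_form]

@[simp] theorem lift_d0 (a : G) : lift c f δ hδ h1 h2 (d0 c a) = δ a := by
  have := lift_of1 c f δ hδ h1 h2 (1 ⊗ₜ a)
  simpa [d0_apply] using this

end Lift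

end Env

end FODC
end Calculus

section Graded

variable {A B : Type*} [Ring A] [Algebra ℂ A] [Ring B] [Algebra ℂ B]

/-- Multiplication by the scalar `s n` on the elements of degree `n`. -/
def degreeScale (𝒜 : ℕ → Submodule ℂ A) [GradedAlgebra 𝒜] (s : ℕ → ℂ) : A →ₗ[ℂ] A :=
  (DirectSum.toModule ℂ ℕ A fun n => s n • (𝒜 n).subtype) ∘ₗ
    (DirectSum.decomposeLinearEquiv 𝒜).toLinearMap

theorem degreeScale_apply (𝒜 : ℕ → Submodule ℂ A) [GradedAlgebra 𝒜] (s : ℕ → ℂ) {n : ℕ} {w : A}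
    (hw : w ∈ 𝒜 n) : degreeScale 𝒜 s w = s n • w := by
  lift w to 𝒜 n using hw
  simp [degreeScale]

/-- The grading of a tensor product by the total degree. -/
def totalDegree (𝒜 : ℕ → Submodule ℂ A) (ℬ : ℕ → Submodule ℂ B) (n : ℕ) :
    Submodule ℂ (A ⊗[ℂ] B) :=
  ⨆ p : {p : ℕ × ℕ // p.1 + p.2 = n},
    LinearMap.range (TensorProduct.map (𝒜 p.1.1).subtype (ℬ p.1.2).subtype)

/-- The differential `d(w ⊗ z) = dw ⊗ z + (-1)^k w ⊗ dz`, for `w` of degree `k`. -/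
def tensorDifferential (𝒜 : ℕ → Submodule ℂ A) [GradedAlgebra 𝒜]
    (dA : A →ₗ[ℂ] A) (dB : B →ₗ[ℂ] B) : A ⊗[ℂ] B →ₗ[ℂ] A ⊗[ℂ] B :=
  TensorProduct.map dA LinearMap.id + TensorProduct.map (degreeScale 𝒜 fun n => (-1) ^ n) dB

/-- `d` is a differential for the grading `𝒜`. -/
structure IsDifferential (𝒜 : ℕ → Submodule ℂ A) (d : A →ₗ[ℂ] A) : Prop where
  mem : ∀ n, ∀ w ∈ 𝒜 n, d w ∈ 𝒜 (n + 1)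
  sq : ∀ w, d (d w) = 0
  leibniz : ∀ n, ∀ w ∈ 𝒜 n, ∀ z, d (w * z) = d w * z + (-1 : ℂ) ^ n • (w * d z)

end Graded

section Calculus

variable {G Γ : Type*} [Ring G] [Algebra ℂ G]
  [AddCommGroup Γ] [Module ℂ Γ] [Module G Γ] [Module Gᵐᵒᵖ Γ]
  [IsScalarTower ℂ G Γ] [IsScalarTower ℂ Gᵐᵒᵖ Γ] [SMulCommClass G Gᵐᵒᵖ Γ]

namespace FODC

variable (c : FODC G Γ)

namespace Env

/-- The grading of `Γ^∧`: the elements of degree `n` are spanned by the products `g ξ₁ ⋯ ξₙ` with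
`g ∈ G` and `ξᵢ ∈ Γ`. -/
def grading (n : ℕ) : Submodule ℂ c.Env :=
  LinearMap.range (of0 c).toLinearMap * LinearMap.range (of1 c) ^ n

theorem one_mem_range0 : (1 : Submodule ℂ c.Env) ≤ LinearMap.range (of0 c).toLinearMap := by
  rw [Submodule.one_le]; exact ⟨1, by simp⟩

theorem of0_mem (a : G) : of0 c a ∈ grading c 0 := by
  rw [grading, pow_zero, mul_one]; exact ⟨a, rfl⟩

theorem of1_mem (ξ : Γ) : of1 c ξ ∈ grading c 1 := by
  rw [grading, pow_one]
  simpa using Submodule.mul_mem_mul (one_mem_range0 c (Submodule.one_le.mp le_rfl))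
    (LinearMap.mem_range_self (of1 c) ξ)

theorem d0_mem (a : G) : d0 c a ∈ grading c 1 := of1_mem c _

theorem range_mul_comm (n : ℕ) :
    LinearMap.range (of1 c) ^ n * LinearMap.range (of0 c).toLinearMap ≤ grading c n := by
  induction n with
  | zero => simp [grading]
  | succ n ih =>
    have h : LinearMap.range (of1 c) * LinearMap.range (of0 c).toLinearMap ≤
        LinearMap.range (of0 c).toLinearMap * LinearMap.range (of1 c) := by
      rw [Submodule.mul_le]
      rintro _ ⟨ξ, rfl⟩ _ ⟨a, rfl⟩
      have := of1_mem c (op a • ξ)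
      rw [grading, pow_one] at this
      simpa [of1_mul_of0] using this
    calc _ = LinearMap.range (of1 c) ^ n *
          (LinearMap.range (of1 c) * LinearMap.range (of0 c).toLinearMap) := by
            rw [pow_succ, mul_assoc]
      _ ≤ LinearMap.range (of1 c) ^ n *
          (LinearMap.range (of0 c).toLinearMap * LinearMap.range (of1 c)) := mul_le_mul_right h _
      _ = (LinearMap.range (of1 c) ^ n * LinearMap.range (of0 c).toLinearMap) *
          LinearMap.range (of1 c) := by rw [mul_assoc]
      _ ≤ grading c n * LinearMap.range (of1 c) := mul_le_mul_left ih _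
      _ = grading c (n + 1) := by rw [grading, grading, pow_succ, mul_assoc]

instance : SetLike.GradedMonoid (grading c) where
  one_mem := by simpa using of0_mem c 1
  mul_mem := by
    intro m n x y hx hy
    have h : grading c m * grading c n ≤ grading c (m + n) := by
      have h0 : LinearMap.range (of0 c).toLinearMap * LinearMap.range (of0 c).toLinearMap ≤
          LinearMap.range (of0 c).toLinearMap := by
        rw [Submodule.mul_le]
        rintro _ ⟨a, rfl⟩ _ ⟨b, rfl⟩
        exact ⟨a * b, by simp⟩
      calc grading c m * grading c n = LinearMap.range (of0 c).toLinearMap *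
            (LinearMap.range (of1 c) ^ m * LinearMap.range (of0 c).toLinearMap) *
              LinearMap.range (of1 c) ^ n := by simp only [grading, mul_assoc]
        _ ≤ LinearMap.range (of0 c).toLinearMap * (LinearMap.range (of0 c).toLinearMap *
              LinearMap.range (of1 c) ^ m) * LinearMap.range (of1 c) ^ n :=
            mul_le_mul_left (mul_le_mul_right (range_mul_comm c m) _) _
        _ = LinearMap.range (of0 c).toLinearMap * LinearMap.range (of0 c).toLinearMap *
              LinearMap.range (of1 c) ^ (m + n) := by simp only [pow_add, mul_assoc]
        _ ≤ grading c (m + n) := mul_le_mul_left h0 _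
    exact h (Submodule.mul_mem_mul hx hy)

/-- Induction over the elements of degree `n`. -/
theorem grading_induction {p : ℕ → c.Env → Prop} (h0 : ∀ a, p 0 (of0 c a))
    (hadd : ∀ n x y, p n x → p n y → p n (x + y))
    (hmul : ∀ n x ξ, x ∈ grading c n → p n x → p (n + 1) (x * of1 c ξ))
    {n : ℕ} {w : c.Env} (hw : w ∈ grading c n) : p n w := by
  induction n generalizing w with
  | zero =>
    rw [grading, pow_zero, mul_one] at hw
    obtain ⟨a, rfl⟩ := hw
    exact h0 a
  | succ n ih =>
    rw [grading, pow_succ, ← mul_assoc] at hw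
    induction hw using Submodule.mul_induction_on' with
    | mem_mul_mem x hx y hy => obtain ⟨ξ, rfl⟩ := hy; exact hmul n x ξ hx (ih hx)
    | add x _ y _ hx hy => exact hadd _ _ _ hx hy

open Polynomial in
theorem weight_mul (f : G →ₗ[ℂ] c.Env) (i j : ℕ) (x : G ⊗[ℂ] G) :
    LinearMap.mul' ℂ c.Env[X] (TensorProduct.map
      ((monomial i).restrictScalars ℂ ∘ₗ f) ((monomial j).restrictScalars ℂ ∘ₗ d0 c) x) =
      monomial (i + j) (LinearMap.mul' ℂ c.Env (TensorProduct.map f (d0 c) x)) := by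
  induction x using TensorProduct.induction_on with
  | zero => simp
  | tmul a b => simp [monomial_mul_monomial]
  | add x y hx hy => simp only [map_add, hx, hy]

open Polynomial in
/-- The algebra map that multiplies the elements of degree `n` by the `n`-th power of a formal
variable. -/
def weight : c.Env →ₐ[ℂ] c.Env[X] :=
  lift c
    (AlgHom.ofLinearMap ((monomial 0).restrictScalars ℂ ∘ₗ (of0 c).toLinearMap)
      (by simp) (fun a b => by simp))
    ((monomial 1).restrictScalars ℂ ∘ₗ d0 c)
    (fun a b => by
      change monomial 1 (d0 c (a * b)) = monomial 1 (d0 c a) * monomial 0 (of0 c b) +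
        monomial 0 (of0 c a) * monomial 1 (d0 c b)
      rw [monomial_mul_monomial, monomial_mul_monomial, d0_mul, map_add])
    (fun x hx => by
      refine (weight_mul c (of0 c).toLinearMap 0 1 x).trans ?_
      rw [mul_of0_d0, hx, map_zero, map_zero])
    (fun x hx => by rw [weight_mul, mul_d0_d0 c x hx, map_zero])

open Polynomial in
theorem weight_of0 (a : G) : weight c (of0 c a) = monomial 0 (of0 c a) :=
  lift_of0 c _ _ _ _ _ a

open Polynomial in
theorem weight_of1 (ξ : Γ) : weight c (of1 c ξ) = monomial 1 (of1 c ξ) := by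
  obtain ⟨x, rfl⟩ := c.form_surjective ξ
  refine (lift_of1 c _ _ _ _ _ x).trans ((weight_mul c (of0 c).toLinearMap 0 1 x).trans ?_)
  rw [mul_of0_d0]

open Polynomial in
theorem weight_of_mem {n : ℕ} {w : c.Env} (hw : w ∈ grading c n) :
    weight c w = monomial n w :=
  grading_induction c (p := fun n w => weight c w = monomial n w) (weight_of0 c)
    (fun n x y hx hy => by rw [map_add, hx, hy, map_add])
    (fun n x ξ _ hx => by rw [map_mul, hx, weight_of1, monomial_mul_monomial]) hw

theorem isInternal : DirectSum.IsInternal (grading c) := by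
  constructor
  · have key : ∀ (x : ⨁ n, grading c n) (n : ℕ),
        (weight c (DirectSum.coeAddMonoidHom (grading c) x)).coeff n = x n := by
      intro x n
      induction x using DirectSum.induction_on with
      | zero => simp
      | of i x =>
        rw [DirectSum.coeAddMonoidHom_of, weight_of_mem c x.2, Polynomial.coeff_monomial]
        by_cases h : i = n
        · subst h; simp
        · rw [if_neg h, DirectSum.of_eq_of_ne _ _ _ (Ne.symm h)]; rfl
      | add x y hx hy => simp [hx, hy]
    intro x y h
    ext n
    rw [← key, ← key, h]
  · intro w
    induction w using induction with
    | h0 a => exact ⟨DirectSum.of _ 0 ⟨_, of0_mem c a⟩, DirectSum.coeAddMonoidHom_of _ _ _⟩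
    | h1 ξ => exact ⟨DirectSum.of _ 1 ⟨_, of1_mem c ξ⟩, DirectSum.coeAddMonoidHom_of _ _ _⟩
    | hadd x y hx hy =>
      obtain ⟨u, rfl⟩ := hx; obtain ⟨v, rfl⟩ := hy
      exact ⟨u + v, map_add _ _ _⟩
    | hmul x y hx hy =>
      obtain ⟨u, rfl⟩ := hx; obtain ⟨v, rfl⟩ := hy
      exact ⟨u * v, map_mul (DirectSum.coeRingHom (grading c)) _ _⟩

instance : GradedAlgebra (grading c) where
  toDecomposition := (isInternal c).chooseDecomposition

end Env
end FODC
end Calculus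

section Calculus

variable {G Γ : Type*} [Ring G] [Algebra ℂ G]
  [AddCommGroup Γ] [Module ℂ Γ] [Module G Γ] [Module Gᵐᵒᵖ Γ]
  [IsScalarTower ℂ G Γ] [IsScalarTower ℂ Gᵐᵒᵖ Γ] [SMulCommClass G Gᵐᵒᵖ Γ]

namespace FODC

variable (c : FODC G Γ)

namespace Env

/-- `a ↦ (a, da; 0, a)`. -/
def dMat0 : G →ₐ[ℂ] Matrix (Fin 2) (Fin 2) c.Env :=
  AlgHom.ofLinearMap
    { toFun := fun a => !![of0 c a, d0 c a; 0, of0 c a]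
      map_add' := fun a b => by ext i j; fin_cases i <;> fin_cases j <;> simp
      map_smul' := fun a b => by ext i j; fin_cases i <;> fin_cases j <;> simp }
    (by ext i j; fin_cases i <;> fin_cases j <;> simp [d0_one])
    (fun a b => by
      ext i j
      fin_cases i <;> fin_cases j <;> simp [Matrix.mul_apply, d0_mul, add_comm])

theorem dMat0_apply (a : G) : dMat0 c a = !![of0 c a, d0 c a; 0, of0 c a] := rfl

/-- `a ↦ (-da, 0; 0, da)`. -/
def dMat1 : G →ₗ[ℂ] Matrix (Fin 2) (Fin 2) c.Env where
  toFun a := !![-d0 c a, 0; 0, d0 c a]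
  map_add' a b := by ext i j; fin_cases i <;> fin_cases j <;> simp [add_comm]
  map_smul' a b := by ext i j; fin_cases i <;> fin_cases j <;> simp

theorem dMat1_apply (a : G) : dMat1 c a = !![-d0 c a, 0; 0, d0 c a] := rfl

theorem mul_dMat01 (x : G ⊗[ℂ] G) :
    LinearMap.mul' ℂ _ (TensorProduct.map (dMat0 c).toLinearMap (dMat1 c) x) =
      !![-of1 c (c.form x), LinearMap.mul' ℂ _ (TensorProduct.map (d0 c) (d0 c) x);
        0, of1 c (c.form x)] := by
  induction x using TensorProduct.induction_on with
  | zero => ext i j; fin_cases i <;> fin_cases j <;> simp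
  | tmul a b =>
    ext i j
    fin_cases i <;> fin_cases j <;>
      simp [dMat0_apply, dMat1_apply, Matrix.mul_apply, ← of0_mul_of1, d0_apply]
  | add x y hx hy =>
    simp only [map_add, hx, hy]
    ext i j
    fin_cases i <;> fin_cases j <;> simp [add_comm]

theorem mul_dMat11 (x : G ⊗[ℂ] G) :
    LinearMap.mul' ℂ _ (TensorProduct.map (dMat1 c) (dMat1 c) x) =
      !![LinearMap.mul' ℂ _ (TensorProduct.map (d0 c) (d0 c) x), 0;
        0, LinearMap.mul' ℂ _ (TensorProduct.map (d0 c) (d0 c) x)] := by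
  induction x using TensorProduct.induction_on with
  | zero => ext i j; fin_cases i <;> fin_cases j <;> simp
  | tmul a b =>
    ext i j
    fin_cases i <;> fin_cases j <;> simp [dMat1_apply, Matrix.mul_apply]
  | add x y hx hy =>
    simp only [map_add, hx, hy]
    ext i j
    fin_cases i <;> fin_cases j <;> simp

/-- The algebra map `w ↦ ((-1)^k w, dw; 0, w)`, for `w` of degree `k`. -/
def dMat : c.Env →ₐ[ℂ] Matrix (Fin 2) (Fin 2) c.Env :=
  lift c (dMat0 c) (dMat1 c)
    (fun a b => by
      ext i j
      fin_cases i <;> fin_cases j <;>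
        simp [dMat0_apply, dMat1_apply, d0_mul, add_comm])
    (fun x hx => by
      rw [mul_dMat01, hx, mul_d0_d0 c x hx, map_zero, neg_zero]
      ext i j
      fin_cases i <;> fin_cases j <;> rfl)
    (fun x hx => by
      rw [mul_dMat11, mul_d0_d0 c x hx]
      ext i j
      fin_cases i <;> fin_cases j <;> rfl)

theorem dMat_of0 (a : G) : dMat c (of0 c a) = !![of0 c a, d0 c a; 0, of0 c a] :=
  lift_of0 c _ _ _ _ _ a

theorem dMat_of1 (x : G ⊗[ℂ] G) : dMat c (of1 c (c.form x)) =
    !![-of1 c (c.form x), LinearMap.mul' ℂ _ (TensorProduct.map (d0 c) (d0 c) x);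
        0, of1 c (c.form x)] :=
  (lift_of1 c _ _ _ _ _ x).trans (mul_dMat01 c x)

/-- The differential of `Γ^∧`. -/
def d : c.Env →ₗ[ℂ] c.Env where
  toFun w := dMat c w 0 1
  map_add' a b := by simp
  map_smul' a b := by simp

theorem d_apply (w : c.Env) : d c w = dMat c w 0 1 := rfl

@[simp] theorem d_of0 (a : G) : d c (of0 c a) = of1 c (c.d a) := by
  rw [d_apply, dMat_of0]; rfl

theorem d_form (x : G ⊗[ℂ] G) : d c (of1 c (c.form x)) =
    LinearMap.mul' ℂ _ (TensorProduct.map (d0 c) (d0 c) x) := by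
  rw [d_apply, dMat_of1]; rfl

theorem d_of1_d (a : G) : d c (of1 c (c.d a)) = 0 := by
  have h := d_form c (1 ⊗ₜ a)
  simpa [d0_one] using h

theorem dMat_10_11 (w : c.Env) : dMat c w 1 0 = 0 ∧ dMat c w 1 1 = w := by
  induction w using induction with
  | h0 a => rw [dMat_of0]; simp
  | h1 ξ => obtain ⟨x, rfl⟩ := c.form_surjective ξ; rw [dMat_of1]; simp
  | hadd x y hx hy => simp [hx, hy]
  | hmul x y hx hy => simp [Matrix.mul_apply, hx, hy]

theorem dMat_00 {n : ℕ} {w : c.Env} (hw : w ∈ grading c n) :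
    dMat c w 0 0 = (-1 : ℂ) ^ n • w :=
  grading_induction c (p := fun n w => dMat c w 0 0 = (-1 : ℂ) ^ n • w)
    (fun a => by rw [dMat_of0]; simp)
    (fun n x y hx hy => by simp [hx, hy])
    (fun n x ξ _ hx => by
      obtain ⟨u, rfl⟩ := c.form_surjective ξ
      rw [map_mul, Matrix.mul_apply, Fin.sum_univ_two, (dMat_10_11 c _).1, hx, dMat_of1]
      simp [pow_succ]) hw

theorem d_mul {n : ℕ} {w : c.Env} (hw : w ∈ grading c n) (z : c.Env) :
    d c (w * z) = d c w * z + (-1 : ℂ) ^ n • (w * d c z) := by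
  rw [d_apply, map_mul, Matrix.mul_apply, Fin.sum_univ_two, dMat_00 c hw, (dMat_10_11 c z).2,
    add_comm, smul_mul_assoc]
  rfl

theorem d_of1_mem (ξ : Γ) : d c (of1 c ξ) ∈ grading c 2 := by
  obtain ⟨x, rfl⟩ := c.form_surjective ξ
  rw [d_form]
  induction x using TensorProduct.induction_on with
  | zero => simp
  | tmul a b => simpa using SetLike.mul_mem_graded (d0_mem c a) (d0_mem c b)
  | add x y hx hy => simpa using Submodule.add_mem _ hx hy

theorem d_d_of1 (ξ : Γ) : d c (d c (of1 c ξ)) = 0 := by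
  obtain ⟨x, rfl⟩ := c.form_surjective ξ
  rw [d_form]
  induction x using TensorProduct.induction_on with
  | zero => simp
  | tmul a b =>
    simp only [TensorProduct.map_tmul, LinearMap.mul'_apply]
    rw [d_mul c (d0_mem c a), d0_apply, d0_apply, d_of1_d, d_of1_d]
    simp
  | add x y hx hy => simp only [map_add, hx, hy, add_zero]

theorem isDifferential : IsDifferential (grading c) (d c) where
  mem := fun n w hw => grading_induction c (p := fun n w => d c w ∈ grading c (n + 1))
    (fun a => by simpa using of1_mem c _)
    (fun n x y hx hy => by simpa using Submodule.add_mem _ hx hy)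
    (fun n x ξ hx hdx => by
      rw [d_mul c hx]
      exact Submodule.add_mem _ (SetLike.mul_mem_graded hdx (of1_mem c ξ))
        (Submodule.smul_mem _ _
          (show x * d c (of1 c ξ) ∈ grading c (n + 2) from
            SetLike.mul_mem_graded hx (d_of1_mem c ξ)))) hw
  leibniz := fun n w hw z => d_mul c hw z
  sq := fun w => by
    have key : ∀ n, ∀ w ∈ grading c n, d c w ∈ grading c (n + 1) ∧ d c (d c w) = 0 :=
      fun n w hw => grading_induction c
        (p := fun n w => d c w ∈ grading c (n + 1) ∧ d c (d c w) = 0)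
        (fun a => ⟨by simpa using of1_mem c _, by rw [d_of0, d_of1_d]⟩)
        (fun n x y hx hy => ⟨by simpa using Submodule.add_mem _ hx.1 hy.1, by
          rw [map_add, map_add, hx.2, hy.2, add_zero]⟩)
        (fun n x ξ hx hdx => by
          rw [d_mul c hx]
          refine ⟨Submodule.add_mem _ (SetLike.mul_mem_graded hdx.1 (of1_mem c ξ))
            (Submodule.smul_mem _ _
          (show x * d c (of1 c ξ) ∈ grading c (n + 2) from
            SetLike.mul_mem_graded hx (d_of1_mem c ξ))), ?_⟩
          rw [map_add, map_smul, d_mul c hdx.1, d_mul c hx, hdx.2, d_d_of1]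
          simp [pow_succ]) hw
    induction w using DirectSum.Decomposition.inductionOn (grading c) with
    | zero => simp
    | homogeneous w => exact (key _ w w.2).2
    | add x y hx hy => rw [map_add, map_add, hx, hy, add_zero]

end Env
end FODC
end Calculus

section GradedTensor

variable {A B : Type*} [Ring A] [Algebra ℂ A] [Ring B] [Algebra ℂ B]
  (𝒜 : ℕ → Submodule ℂ A) (ℬ : ℕ → Submodule ℂ B) [GradedAlgebra 𝒜] [GradedAlgebra ℬ]

theorem of_mul_of {i j : ℕ} {a' : A} {b : B} (hb : b ∈ ℬ j) (ha : a' ∈ 𝒜 i) (a : A) (b' : B) :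
    GradedTensorProduct.of ℂ 𝒜 ℬ (a ⊗ₜ b) * GradedTensorProduct.of ℂ 𝒜 ℬ (a' ⊗ₜ b') =
      (-1 : ℂ) ^ (j * i) • GradedTensorProduct.of ℂ 𝒜 ℬ ((a * a') ⊗ₜ (b * b')) := by
  have h := GradedTensorProduct.tmul_coe_mul_coe_tmul (R := ℂ) 𝒜 ℬ a ⟨b, hb⟩ ⟨a', ha⟩ b'
  refine h.trans ?_
  rcases Nat.even_or_odd (j * i) with e | e <;> simp [e.neg_one_pow]

end GradedTensor

section Hopf

open Coalgebra HopfAlgebra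

variable {G Γ : Type*} [Ring G] [HopfAlgebra ℂ G]
  [AddCommGroup Γ] [Module ℂ Γ] [Module G Γ] [Module Gᵐᵒᵖ Γ]
  [IsScalarTower ℂ G Γ] [IsScalarTower ℂ Gᵐᵒᵖ Γ] [SMulCommClass G Gᵐᵒᵖ Γ]

namespace FODC

variable (c : FODC G Γ)

/-- The map `a ⊗ b ↦ φ(a) (id ⊗ d) φ(b) = a⁽¹⁾b⁽¹⁾ ⊗ a⁽²⁾db⁽²⁾`. -/
def leftMap : G ⊗[ℂ] G →ₗ[ℂ] G ⊗[ℂ] Γ :=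
  TensorProduct.map (LinearMap.mul' ℂ G) c.form ∘ₗ comul

/-- The map `a ⊗ b ↦ φ(a) (d ⊗ id) φ(b) = a⁽¹⁾db⁽¹⁾ ⊗ a⁽²⁾b⁽²⁾`. -/
def rightMap : G ⊗[ℂ] G →ₗ[ℂ] Γ ⊗[ℂ] G :=
  TensorProduct.map c.form (LinearMap.mul' ℂ G) ∘ₗ comul

/-- A first-order calculus is bicovariant if `∑ aᵢ dbᵢ = 0` implies
`∑ φ(aᵢ) (id ⊗ d) φ(bᵢ) = 0` and `∑ φ(aᵢ) (d ⊗ id) φ(bᵢ) = 0`. -/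
structure IsBicovariant : Prop where
  left : ∀ x, c.form x = 0 → c.leftMap x = 0
  right : ∀ x, c.form x = 0 → c.rightMap x = 0

namespace Env

/-- The counit of `Γ^∧`, which extends the counit of `G` by zero. -/
def counit : c.Env →ₐ[ℂ] ℂ :=
  lift c (Bialgebra.counitAlgHom ℂ G) 0 (by simp) (by simp) (by simp)

theorem counit_of0 (a : G) : counit c (of0 c a) = Coalgebra.counit (R := ℂ) a :=
  lift_of0 c _ _ _ _ _ a

theorem counit_of1 (ξ : Γ) : counit c (of1 c ξ) = 0 := by
  obtain ⟨x, rfl⟩ := c.form_surjective ξ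
  exact (lift_of1 c _ _ _ _ _ x).trans (by simp)

/-- The linear identification of `Γ^∧ ⊗ Γ^∧` with the graded tensor product algebra. -/
abbrev gr : c.Env ⊗[ℂ] c.Env ≃ₗ[ℂ] GradedTensorProduct ℂ (grading c) (grading c) :=
  GradedTensorProduct.of ℂ (grading c) (grading c)

/-- `a ⊗ b ↦ a ⊗ b`, as a map from `G ⊗ G` to `Γ^∧ ⊗ Γ^∧`. -/
def comulP : G ⊗[ℂ] G →ₗ[ℂ] GradedTensorProduct ℂ (grading c) (grading c) :=
  (gr c).toLinearMap ∘ₗ TensorProduct.map (of0 c).toLinearMap (of0 c).toLinearMap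

/-- `a ⊗ b ↦ da ⊗ b + a ⊗ db`, as a map from `G ⊗ G` to `Γ^∧ ⊗ Γ^∧`. -/
def comulQ : G ⊗[ℂ] G →ₗ[ℂ] GradedTensorProduct ℂ (grading c) (grading c) :=
  (gr c).toLinearMap ∘ₗ
    (TensorProduct.map (d0 c) (of0 c).toLinearMap + TensorProduct.map (of0 c).toLinearMap (d0 c))

theorem comulP_tmul (a b : G) : comulP c (a ⊗ₜ b) = gr c (of0 c a ⊗ₜ of0 c b) := rfl

theorem comulQ_tmul (a b : G) :
    comulQ c (a ⊗ₜ b) = gr c (d0 c a ⊗ₜ of0 c b) + gr c (of0 c a ⊗ₜ d0 c b) := by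
  simp [comulQ]

theorem comulP_mul (y z : G ⊗[ℂ] G) : comulP c (y * z) = comulP c y * comulP c z := by
  induction y using TensorProduct.induction_on with
  | zero => simp
  | add y y' hy hy' => simp only [add_mul, map_add, hy, hy']
  | tmul a b =>
    induction z using TensorProduct.induction_on with
    | zero => simp
    | add z z' hz hz' => simp only [mul_add, map_add, hz, hz']
    | tmul a' b' =>
      simp only [Algebra.TensorProduct.tmul_mul_tmul, comulP_tmul,
        of_mul_of _ _ (of0_mem c b) (of0_mem c a')]
      simp

theorem comulQ_mul (y z : G ⊗[ℂ] G) :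
    comulQ c (y * z) = comulQ c y * comulP c z + comulP c y * comulQ c z := by
  induction y using TensorProduct.induction_on with
  | zero => simp
  | add y y' hy hy' => simp only [add_mul, map_add, hy, hy']; abel
  | tmul a b =>
    induction z using TensorProduct.induction_on with
    | zero => simp
    | add z z' hz hz' => simp only [mul_add, map_add, hz, hz']; abel
    | tmul a' b' =>
      simp only [Algebra.TensorProduct.tmul_mul_tmul, comulP_tmul, comulQ_tmul, add_mul, mul_add,
        of_mul_of _ _ (of0_mem c b) (of0_mem c a'), of_mul_of _ _ (d0_mem c b) (of0_mem c a'),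
        of_mul_of _ _ (of0_mem c b) (d0_mem c a'), d0_mul, map_mul, TensorProduct.add_tmul,
        TensorProduct.tmul_add, map_add]
      simp
      abel

theorem mul_comulPQ (x : G ⊗[ℂ] G) :
    LinearMap.mul' ℂ _ (TensorProduct.map (comulP c ∘ₗ comul) (comulQ c ∘ₗ comul) x) =
      gr c (TensorProduct.map (of1 c) (of0 c).toLinearMap (c.rightMap x) +
        TensorProduct.map (of0 c).toLinearMap (of1 c) (c.leftMap x)) := by
  induction x using TensorProduct.induction_on with
  | zero => simp
  | add x y hx hy => simp only [map_add, hx, hy]; abel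
  | tmul a b =>
    simp only [TensorProduct.map_tmul, LinearMap.mul'_apply, LinearMap.comp_apply, rightMap,
      leftMap, TensorProduct.comul_tmul]
    generalize (comul a : G ⊗[ℂ] G) = y
    generalize (comul b : G ⊗[ℂ] G) = z
    induction y using TensorProduct.induction_on with
    | zero => simp
    | add y y' hy hy' => simp only [add_mul, map_add, hy, hy', TensorProduct.add_tmul]; abel
    | tmul a b =>
      induction z using TensorProduct.induction_on with
      | zero => simp
      | add z z' hz hz' => simp only [mul_add, map_add, hz, hz', TensorProduct.tmul_add]; abel
      | tmul a' b' =>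
        simp only [comulP_tmul, comulQ_tmul, mul_add,
          of_mul_of _ _ (of0_mem c b) (of0_mem c a'), of_mul_of _ _ (of0_mem c b) (d0_mem c a')]
        simp [d0_apply, of0_mul_of1]

theorem mul_comulQQ (x : G ⊗[ℂ] G) :
    LinearMap.mul' ℂ _ (TensorProduct.map (comulQ c ∘ₗ comul) (comulQ c ∘ₗ comul) x) =
      gr c (TensorProduct.map (d c ∘ₗ of1 c) (of0 c).toLinearMap (c.rightMap x) +
        TensorProduct.map (d0 c) (of1 c) (c.leftMap x) -
        TensorProduct.map (of1 c) (d0 c) (c.rightMap x) +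
        TensorProduct.map (of0 c).toLinearMap (d c ∘ₗ of1 c) (c.leftMap x)) := by
  induction x using TensorProduct.induction_on with
  | zero => simp
  | add x y hx hy => simp only [map_add, map_sub, hx, hy]; abel
  | tmul a b =>
    simp only [TensorProduct.map_tmul, LinearMap.mul'_apply, LinearMap.comp_apply, rightMap,
      leftMap, TensorProduct.comul_tmul]
    generalize (comul a : G ⊗[ℂ] G) = y
    generalize (comul b : G ⊗[ℂ] G) = z
    induction y using TensorProduct.induction_on with
    | zero => simp
    | add y y' hy hy' =>
      simp only [add_mul, map_add, map_sub, hy, hy', TensorProduct.add_tmul]; abel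
    | tmul a b =>
      induction z using TensorProduct.induction_on with
      | zero => simp
      | add z z' hz hz' =>
        simp only [mul_add, map_add, map_sub, hz, hz', TensorProduct.tmul_add]; abel
      | tmul a' b' =>
        have e : ∀ a b : G, d c (of0 c a * d0 c b) = d0 c a * d0 c b := fun a b => by
          simpa [d0_apply, of0_mul_of1] using d_form c (a ⊗ₜ b)
        simp only [comulQ_tmul, mul_add, add_mul,
          of_mul_of _ _ (of0_mem c b) (of0_mem c a'), of_mul_of _ _ (of0_mem c b) (d0_mem c a'),
          of_mul_of _ _ (d0_mem c b) (of0_mem c a'), of_mul_of _ _ (d0_mem c b) (d0_mem c a')]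
        simp [← of0_mul_of1, ← d0_apply, e, d0_mul, TensorProduct.add_tmul, TensorProduct.tmul_add]
        abel

variable {c}

/-- The coproduct of `Γ^∧`: the morphism of graded differential algebras that extends the coproduct
of `G`, so that `φ(dg) = dg⁽¹⁾ ⊗ g⁽²⁾ + g⁽¹⁾ ⊗ dg⁽²⁾`. -/
def comul (hc : c.IsBicovariant) :
    c.Env →ₐ[ℂ] GradedTensorProduct ℂ (grading c) (grading c) :=
  lift c
    (AlgHom.ofLinearMap (comulP c ∘ₗ Coalgebra.comul)
      (by simp [Algebra.TensorProduct.one_def, comulP_tmul]; rfl)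
      (fun a b => by simp [comulP_mul]))
    (comulQ c ∘ₗ Coalgebra.comul)
    (fun a b => by simp [comulQ_mul])
    (fun x hx => by
      refine (mul_comulPQ c x).trans ?_
      rw [hc.left x hx, hc.right x hx]
      simp)
    (fun x hx => by
      rw [mul_comulQQ, hc.left x hx, hc.right x hx]
      simp)

theorem comul_of0 (hc : c.IsBicovariant) (a : G) :
    comul hc (of0 c a) = comulP c (Coalgebra.comul a) :=
  lift_of0 c _ _ _ _ _ a

theorem comul_d0 (hc : c.IsBicovariant) (a : G) :
    comul hc (d0 c a) = comulQ c (Coalgebra.comul a) :=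
  lift_d0 c _ _ _ _ _ a

end Env
end FODC
end Hopf

section Antipode

open HopfAlgebra WithConv

variable {G Γ : Type*} [Ring G] [HopfAlgebra ℂ G]
  [AddCommGroup Γ] [Module ℂ Γ] [Module G Γ] [Module Gᵐᵒᵖ Γ]
  [IsScalarTower ℂ G Γ] [IsScalarTower ℂ Gᵐᵒᵖ Γ] [SMulCommClass G Gᵐᵒᵖ Γ]

/-- The coalgebra map `a ⊗ b ↦ ε(b) a`. -/
def prL (G : Type*) [Ring G] [HopfAlgebra ℂ G] : G ⊗[ℂ] G →ₗc[ℂ] G :=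
  (Coalgebra.TensorProduct.rid ℂ ℂ G).toCoalgHom.comp
    (Coalgebra.TensorProduct.map (CoalgHom.id ℂ G) (Bialgebra.counitBialgHom ℂ G).toCoalgHom)

/-- The coalgebra map `a ⊗ b ↦ ε(a) b`. -/
def prR (G : Type*) [Ring G] [HopfAlgebra ℂ G] : G ⊗[ℂ] G →ₗc[ℂ] G :=
  (Coalgebra.TensorProduct.lid ℂ G).toCoalgHom.comp
    (Coalgebra.TensorProduct.map (Bialgebra.counitBialgHom ℂ G).toCoalgHom (CoalgHom.id ℂ G))

theorem prL_tmul (a b : G) : prL G (a ⊗ₜ b) = Coalgebra.counit (R := ℂ) b • a := rfl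
theorem prR_tmul (a b : G) : prR G (a ⊗ₜ b) = Coalgebra.counit (R := ℂ) a • b := rfl

section

variable {E : Type*} [Ring E] [Algebra ℂ E] (u v : G →ₗ[ℂ] E)

theorem conv_LL : toConv (u ∘ₗ (prL G).toLinearMap) * toConv (v ∘ₗ (prL G).toLinearMap) =
    toConv ((toConv u * toConv v).ofConv ∘ₗ (prL G).toLinearMap) := by
  rw [LinearMap.convMul_comp_coalgHom_distrib]

theorem conv_RR : toConv (u ∘ₗ (prR G).toLinearMap) * toConv (v ∘ₗ (prR G).toLinearMap) =
    toConv ((toConv u * toConv v).ofConv ∘ₗ (prR G).toLinearMap) := by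
  rw [LinearMap.convMul_comp_coalgHom_distrib]

theorem conv_one_L : toConv ((1 : WithConv (G →ₗ[ℂ] E)).ofConv ∘ₗ (prL G).toLinearMap) = 1 := by
  rw [LinearMap.convOne_def, LinearMap.convOne_def, LinearMap.comp_assoc]
  simp

theorem conv_one_R : toConv ((1 : WithConv (G →ₗ[ℂ] E)).ofConv ∘ₗ (prR G).toLinearMap) = 1 := by
  rw [LinearMap.convOne_def, LinearMap.convOne_def, LinearMap.comp_assoc]
  simp

theorem conv_LR : toConv (u ∘ₗ (prL G).toLinearMap) * toConv (v ∘ₗ (prR G).toLinearMap) =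
    toConv (LinearMap.mul' ℂ E ∘ₗ TensorProduct.map u v) := by
  have key : ∀ y z : G ⊗[ℂ] G,
      LinearMap.mul' ℂ E (TensorProduct.map (u ∘ₗ (prL G).toLinearMap) (v ∘ₗ (prR G).toLinearMap)
        (TensorProduct.AlgebraTensorModule.tensorTensorTensorComm ℂ ℂ ℂ ℂ G G G G (y ⊗ₜ z))) =
      u (TensorProduct.rid ℂ G (Coalgebra.counit.lTensor G y)) *
        v (TensorProduct.lid ℂ G (Coalgebra.counit.rTensor G z)) := by
    intro y z
    induction y using TensorProduct.induction_on with
    | zero => simp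
    | add y y' hy hy' => simp only [map_add, TensorProduct.add_tmul, hy, hy', add_mul]
    | tmul a b =>
      induction z using TensorProduct.induction_on with
      | zero => simp
      | add z z' hz hz' => simp only [map_add, TensorProduct.tmul_add, hz, hz', mul_add]
      | tmul a' b' => simp [prL_tmul, prR_tmul, smul_smul, mul_comm]
  apply WithConv.ext
  ext a b
  have := key (Coalgebra.comul a) (Coalgebra.comul b)
  rw [← TensorProduct.comul_tmul] at this
  refine this.trans ?_
  simp

theorem conv_RL : toConv (u ∘ₗ (prR G).toLinearMap) * toConv (v ∘ₗ (prL G).toLinearMap) =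
    toConv (LinearMap.mul' ℂ E ∘ₗ TensorProduct.map u v ∘ₗ
      (TensorProduct.comm ℂ G G).toLinearMap) := by
  have key : ∀ y z : G ⊗[ℂ] G,
      LinearMap.mul' ℂ E (TensorProduct.map (u ∘ₗ (prR G).toLinearMap) (v ∘ₗ (prL G).toLinearMap)
        (TensorProduct.AlgebraTensorModule.tensorTensorTensorComm ℂ ℂ ℂ ℂ G G G G (y ⊗ₜ z))) =
      u (TensorProduct.rid ℂ G (Coalgebra.counit.lTensor G z)) *
        v (TensorProduct.lid ℂ G (Coalgebra.counit.rTensor G y)) := by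
    intro y z
    induction y using TensorProduct.induction_on with
    | zero => simp
    | add y y' hy hy' => simp only [map_add, TensorProduct.add_tmul, hy, hy', mul_add]
    | tmul a b =>
      induction z using TensorProduct.induction_on with
      | zero => simp
      | add z z' hz hz' => simp only [map_add, TensorProduct.tmul_add, hz, hz', add_mul]
      | tmul a' b' => simp [prL_tmul, prR_tmul, smul_smul, mul_comm]
  apply WithConv.ext
  ext a b
  have := key (Coalgebra.comul a) (Coalgebra.comul b)
  rw [← TensorProduct.comul_tmul] at this
  refine this.trans ?_
  simp

end

namespace FODC

variable (c : FODC G Γ)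

namespace Env

/-- `a ⊗ b ↦ dκ(b) κ(a)`. -/
def antipodeForm : G ⊗[ℂ] G →ₗ[ℂ] c.Env :=
  LinearMap.mul' ℂ c.Env ∘ₗ TensorProduct.map (d0 c ∘ₗ antipode ℂ)
    ((of0 c).toLinearMap ∘ₗ antipode ℂ) ∘ₗ (TensorProduct.comm ℂ G G).toLinearMap

theorem antipodeForm_tmul (a b : G) : antipodeForm c (a ⊗ₜ b) =
    d0 c (antipode ℂ b) * of0 c (antipode ℂ a) := rfl

theorem antipode_conv : toConv ((of0 c).toLinearMap ∘ₗ antipode ℂ) * toConv (of0 c).toLinearMap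
    = 1 := by
  have := LinearMap.algHom_comp_convMul_distrib (R := ℂ) (of0 c)
    (toConv (antipode ℂ : G →ₗ[ℂ] G)) (toConv LinearMap.id)
  rw [LinearMap.antipode_mul_id] at this
  rw [← WithConv.ofConv_injective.eq_iff]
  refine Eq.trans this.symm ?_
  ext a
  simp

theorem conv_antipode : toConv (of0 c).toLinearMap * toConv ((of0 c).toLinearMap ∘ₗ antipode ℂ)
    = 1 := by
  have := LinearMap.algHom_comp_convMul_distrib (R := ℂ) (of0 c)
    (toConv LinearMap.id) (toConv (antipode ℂ : G →ₗ[ℂ] G))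
  rw [LinearMap.id_mul_antipode] at this
  rw [← WithConv.ofConv_injective.eq_iff]
  refine Eq.trans this.symm ?_
  ext a
  simp

theorem antipode_conv_d : toConv ((of0 c).toLinearMap ∘ₗ antipode ℂ) * toConv (d0 c) =
    - (toConv (d0 c ∘ₗ antipode ℂ) * toConv (of0 c).toLinearMap) := by
  have key : ∀ y : G ⊗[ℂ] G,
      LinearMap.mul' ℂ c.Env (TensorProduct.map (d0 c ∘ₗ antipode ℂ) (of0 c).toLinearMap y) +
      LinearMap.mul' ℂ c.Env (TensorProduct.map ((of0 c).toLinearMap ∘ₗ antipode ℂ) (d0 c) y) =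
      d0 c (LinearMap.mul' ℂ G ((antipode ℂ).rTensor G y)) := by
    intro y
    induction y using TensorProduct.induction_on with
    | zero => simp
    | tmul a b => simp [d0_mul]
    | add y z hy hz => simp only [map_add, ← hy, ← hz]; abel
  rw [eq_neg_iff_add_eq_zero, add_comm, ← WithConv.ofConv_injective.eq_iff]
  ext a
  refine (key (Coalgebra.comul a)).trans ?_
  rw [mul_antipode_rTensor_comul_apply, Algebra.algebraMap_eq_smul_one, map_smul, d0_one]
  simp

theorem antipodeForm_eq_zero (hc : c.IsBicovariant) (x : G ⊗[ℂ] G) (hx : c.form x = 0) :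
    antipodeForm c x = 0 := by
  let i := (of0 c).toLinearMap
  let k := (of0 c).toLinearMap ∘ₗ (antipode ℂ : G →ₗ[ℂ] G)
  let P := toConv (i ∘ₗ (prL G).toLinearMap)
  let P' := toConv (k ∘ₗ (prL G).toLinearMap)
  let Q := toConv (i ∘ₗ (prR G).toLinearMap)
  let Q' := toConv (k ∘ₗ (prR G).toLinearMap)
  let dQ := toConv (d0 c ∘ₗ (prR G).toLinearMap)
  let dQ' := toConv ((d0 c ∘ₗ antipode ℂ) ∘ₗ (prR G).toLinearMap)
  let N := toConv (k ∘ₗ LinearMap.mul' ℂ G)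
  have hP : P' * P = 1 := by
    simp only [P, P']
    rw [conv_LL, antipode_conv, conv_one_L]
  have hQ : Q * Q' = 1 := by
    simp only [Q, Q']
    rw [conv_RR, conv_antipode, conv_one_R]
  have hdQ : Q' * dQ = -(dQ' * Q) := by
    simp only [Q, Q', dQ, dQ']
    rw [conv_RR, conv_RR, antipode_conv_d]
    rfl
  have hμ : P * dQ = toConv (of1 c ∘ₗ c.form) := by
    simp only [P, dQ]
    rw [conv_LR]
    congr 1
    ext a b
    simp [i, d0_apply, of0_mul_of1]
  have hN : Q' * P' = N := by
    simp only [Q', P', N]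
    rw [conv_RL]
    congr 1
    ext a b
    simp [k, antipode_mul_antidistrib]
  have hS : dQ' * P' = toConv (antipodeForm c) := by
    simp only [dQ', P']
    rw [conv_RL]
    rfl
  have main : toConv (antipodeForm c) = -(N * (toConv (of1 c ∘ₗ c.form) * N)) := by
    rw [← hS, ← hN, ← hμ]
    calc dQ' * P' = (dQ' * (Q * Q')) * P' := by rw [hQ, mul_one]
      _ = -((Q' * dQ) * Q' * P') := by rw [hdQ]; simp only [neg_mul, neg_neg, mul_assoc]
      _ = -(Q' * (P' * P) * dQ * Q' * P') := by rw [hP, mul_one]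
      _ = _ := by simp only [mul_assoc]
  have inner : (toConv (of1 c ∘ₗ c.form) * N).ofConv =
      (LinearMap.mul' ℂ c.Env ∘ₗ TensorProduct.map (of1 c) k ∘ₗ c.desc c.rightMap hc.right) ∘ₗ
        c.form := by
    apply LinearMap.ext
    intro y
    simp only [LinearMap.comp_apply, desc_form, rightMap, N]
    rw [← LinearMap.comp_apply (TensorProduct.map (of1 c) k), ← TensorProduct.map_comp]
    rfl
  have outer : (N * (toConv (of1 c ∘ₗ c.form) * N)).ofConv x = 0 := by
    change LinearMap.mul' ℂ c.Env (TensorProduct.map (k ∘ₗ LinearMap.mul' ℂ G)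
      (toConv (of1 c ∘ₗ c.form) * N).ofConv (Coalgebra.comul x)) = 0
    rw [inner, TensorProduct.map_comp]
    have := hc.left x hx
    rw [leftMap, LinearMap.comp_apply] at this
    rw [LinearMap.comp_apply, this, map_zero, map_zero]
  have := congrArg (fun f => f.ofConv x) main
  refine this.trans ?_
  change -((N * (toConv (of1 c ∘ₗ c.form) * N)).ofConv x) = 0
  rw [outer, neg_zero]

variable {c}

/-- The antimultiplicative map underlying the antipode of `Γ^∧`. -/
def antipodeOp (hc : c.IsBicovariant) : c.Env →ₐ[ℂ] c.Envᵐᵒᵖ :=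
  lift c ((AlgHom.op (of0 c)).comp (antipodeAlgHomOp ℂ G))
    ((MulOpposite.opLinearEquiv ℂ).toLinearMap ∘ₗ d0 c ∘ₗ antipode ℂ)
    (fun a b => by
      apply MulOpposite.unop_injective
      simp [antipode_mul_antidistrib, d0_mul, add_comm])
    (fun x hx => by
      have key : ∀ x : G ⊗[ℂ] G, LinearMap.mul' ℂ _ (TensorProduct.map
          ((AlgHom.op (of0 c)).comp (antipodeAlgHomOp ℂ G)).toLinearMap
          ((MulOpposite.opLinearEquiv ℂ).toLinearMap ∘ₗ d0 c ∘ₗ antipode ℂ) x) =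
          op (antipodeForm c x) := by
        intro x
        induction x using TensorProduct.induction_on with
        | zero => simp
        | tmul a b => simp [antipodeForm_tmul]
        | add y z hy hz => simp only [map_add, hy, hz, MulOpposite.op_add]
      rw [key, antipodeForm_eq_zero c hc x hx, MulOpposite.op_zero])
    (fun x hx => by
      have key : ∀ x : G ⊗[ℂ] G, LinearMap.mul' ℂ _ (TensorProduct.map
          ((MulOpposite.opLinearEquiv ℂ).toLinearMap ∘ₗ d0 c ∘ₗ antipode ℂ)
          ((MulOpposite.opLinearEquiv ℂ).toLinearMap ∘ₗ d0 c ∘ₗ antipode ℂ) x) =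
          op (-d c (antipodeForm c x)) := by
        intro x
        induction x using TensorProduct.induction_on with
        | zero => simp
        | tmul a b =>
          rw [antipodeForm_tmul, d_mul c (d0_mem c _), d0_apply c (antipode ℂ b), d_of1_d, d_of0]
          simp [d0_apply]
        | add y z hy hz => simp only [map_add, hy, hz, MulOpposite.op_add, neg_add]
      rw [key, antipodeForm_eq_zero c hc x hx, map_zero, neg_zero, MulOpposite.op_zero])

/-- The antipode `κ` of `Γ^∧`: the graded antimultiplicative extension of the antipode of `G` that
commutes with `d`. The sign turns an antimultiplicative map into a graded antimultiplicative one,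
because `(m + n).choose 2 = m.choose 2 + n.choose 2 + m * n`. -/
def antipode (hc : c.IsBicovariant) : c.Env →ₗ[ℂ] c.Env :=
  degreeScale (grading c) (fun n => (-1) ^ n.choose 2) ∘ₗ
    (MulOpposite.opLinearEquiv ℂ).symm.toLinearMap ∘ₗ (antipodeOp hc).toLinearMap

theorem antipodeOp_of0 (hc : c.IsBicovariant) (a : G) :
    (antipodeOp hc (of0 c a)).unop = of0 c (HopfAlgebra.antipode ℂ a) :=
  congrArg MulOpposite.unop (lift_of0 c _ _ _ _ _ a)

theorem antipodeOp_d0 (hc : c.IsBicovariant) (a : G) :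
    (antipodeOp hc (d0 c a)).unop = d0 c (HopfAlgebra.antipode ℂ a) :=
  congrArg MulOpposite.unop (lift_d0 c _ _ _ _ _ a)

theorem antipodeOp_of1_mem (hc : c.IsBicovariant) (ξ : Γ) :
    (antipodeOp hc (of1 c ξ)).unop ∈ grading c 1 := by
  obtain ⟨x, rfl⟩ := c.form_surjective ξ
  rw [← mul_of0_d0]
  induction x using TensorProduct.induction_on with
  | zero => simp
  | tmul a b =>
    simp only [TensorProduct.map_tmul, LinearMap.mul'_apply, AlgHom.toLinearMap_apply, map_mul,
      MulOpposite.unop_mul, antipodeOp_of0, antipodeOp_d0]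
    simpa using SetLike.mul_mem_graded (d0_mem c _) (of0_mem c _)
  | add y z hy hz => simpa using Submodule.add_mem _ hy hz

theorem antipodeOp_mem (hc : c.IsBicovariant) {n : ℕ} {w : c.Env} (hw : w ∈ grading c n) :
    (antipodeOp hc w).unop ∈ grading c n :=
  grading_induction c (p := fun n w => (antipodeOp hc w).unop ∈ grading c n)
    (fun a => by rw [antipodeOp_of0]; exact of0_mem c _)
    (fun n x y hx hy => by simpa using Submodule.add_mem _ hx hy)
    (fun n x ξ _ hx => by
      rw [map_mul, MulOpposite.unop_mul, add_comm]
      exact SetLike.mul_mem_graded (antipodeOp_of1_mem hc ξ) hx) hw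

theorem antipode_apply (hc : c.IsBicovariant) {n : ℕ} {w : c.Env} (hw : w ∈ grading c n) :
    antipode hc w = (-1 : ℂ) ^ n.choose 2 • (antipodeOp hc w).unop :=
  degreeScale_apply _ _ (antipodeOp_mem hc hw)

theorem antipode_of0 (hc : c.IsBicovariant) (a : G) :
    antipode hc (of0 c a) = of0 c (HopfAlgebra.antipode ℂ a) := by
  rw [antipode_apply hc (of0_mem c a), antipodeOp_of0]; simp

theorem antipode_d0 (hc : c.IsBicovariant) (a : G) :
    antipode hc (d0 c a) = d0 c (HopfAlgebra.antipode ℂ a) := by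
  rw [antipode_apply hc (d0_mem c a), antipodeOp_d0]; simp

theorem add_choose_two (m n : ℕ) : (m + n).choose 2 = m.choose 2 + n.choose 2 + m * n := by
  induction n with
  | zero => simp
  | succ n ih =>
    rw [← add_assoc, Nat.choose_succ_succ, ih, Nat.choose_succ_succ n 1, Nat.choose_one_right,
      Nat.choose_one_right]
    ring

theorem antipode_mul (hc : c.IsBicovariant) {m n : ℕ} {w z : c.Env} (hw : w ∈ grading c m)
    (hz : z ∈ grading c n) :
    antipode hc (w * z) = (-1 : ℂ) ^ (m * n) • (antipode hc z * antipode hc w) := by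
  rw [antipode_apply hc (SetLike.mul_mem_graded hw hz), antipode_apply hc hw, antipode_apply hc hz,
    map_mul, MulOpposite.unop_mul, smul_mul_assoc, mul_smul_comm, smul_smul, smul_smul,
    add_choose_two, pow_add, pow_add]
  congr 1
  ring

end Env
end FODC
end Antipode

section QuantumGroup

variable {G : Type*} [Ring G] [HopfAlgebra ℂ G] [StarRing G] [StarModule ℂ G]

/-- `u` is the matrix of a finite-dimensional unitary representation of the quantum group. -/
structure IsUnitaryRep {n : ℕ} (u : Matrix (Fin n) (Fin n) G) : Prop where
  comul : ∀ i j, Coalgebra.comul (R := ℂ) (u i j) = ∑ k, u i k ⊗ₜ[ℂ] u k j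
  counit : ∀ i j, Coalgebra.counit (R := ℂ) (u i j) = if i = j then 1 else 0
  unitary : u ∈ unitary (Matrix (Fin n) (Fin n) G)

/-- The representation `eᵢ ↦ ∑ⱼ eⱼ ⊗ uⱼᵢ` on `ℂⁿ` with matrix `u`. -/
def repMap {n : ℕ} (u : Matrix (Fin n) (Fin n) G) : (Fin n → ℂ) →ₗ[ℂ] (Fin n → ℂ) ⊗[ℂ] G :=
  (Pi.basisFun ℂ (Fin n)).constr ℂ fun i => ∑ j, Pi.single j 1 ⊗ₜ[ℂ] u j i

/-- The representation with matrix `u` is irreducible: it is nonzero, and the only subspaces `L`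
that it maps to `L ⊗ G` are the trivial ones. -/
def IsIrreducibleRep {n : ℕ} (u : Matrix (Fin n) (Fin n) G) : Prop :=
  0 < n ∧ ∀ L : Submodule ℂ (Fin n → ℂ),
    (∀ v ∈ L, repMap u v ∈ LinearMap.range (L.subtype.rTensor G)) → L = ⊥ ∨ L = ⊤

variable (G) in
/-- The Hopf `*`-algebra `G` is the dense `*`-Hopf algebra of a compact matrix quantum group: it is
spanned by the matrix coefficients of its irreducible unitary representations, and it is generated
as a `*`-algebra by the coefficients of one (fundamental) unitary representation. -/
structure IsCompactMatrixQuantumGroup : Prop where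
  comul_star : ∀ a : G, Coalgebra.comul (R := ℂ) (star a) = star (Coalgebra.comul (R := ℂ) a)
  span_coeff : Submodule.span ℂ {a : G | ∃ (n : ℕ) (u : Matrix (Fin n) (Fin n) G),
    IsUnitaryRep u ∧ IsIrreducibleRep u ∧ ∃ i j, u i j = a} = ⊤
  fundamental : ∃ (n : ℕ) (u : Matrix (Fin n) (Fin n) G), IsUnitaryRep u ∧
    StarAlgebra.adjoin ℂ {a : G | ∃ i j, u i j = a} = ⊤

/-- A first-order calculus is a `*`-calculus if `(∑ aᵢ dbᵢ)* = ∑ d(bᵢ*) aᵢ*` is well defined. -/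
def FODC.IsStarCalculus {Γ : Type*} [AddCommGroup Γ] [Module ℂ Γ] [Module G Γ] [Module Gᵐᵒᵖ Γ]
    (c : FODC G Γ) : Prop :=
  ∀ (n : ℕ) (a b : Fin n → G), ∑ i, a i • c.d (b i) = 0 →
    ∑ i, op (star (a i)) • c.d (star (b i)) = 0

end QuantumGroup

section Bundle

variable (G P : Type*) [Ring G] [HopfAlgebra ℂ G] [StarRing G] [StarModule ℂ G]
  [Ring P] [Algebra ℂ P] [StarRing P] [StarModule ℂ P]

/-- A quantum principal bundle with total space `P` and structure group `G`. The base space is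
determined by the coaction; see `QuantumPrincipalBundle.base`. -/
structure QuantumPrincipalBundle where
  /-- The coaction `Φ` of `G` on the total space. -/
  coact : P →ₐ[ℂ] P ⊗[ℂ] G
  coact_star : ∀ x, coact (star x) = star (coact x)
  coact_counit : ∀ x, TensorProduct.rid ℂ P (Coalgebra.counit.lTensor P (coact x)) = x
  coact_coassoc : ∀ x, Coalgebra.comul.lTensor P (coact x) =
    TensorProduct.assoc ℂ P G G (coact.toLinearMap.rTensor G (coact x))
  /-- `x ⊗ y ↦ (x ⊗ 1) Φ(y)` is surjective. -/
  canonical_surjective : Function.Surjective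
    (LinearMap.mul' ℂ (P ⊗[ℂ] G) ∘ₗ
      TensorProduct.map Algebra.TensorProduct.includeLeft.toLinearMap coact.toLinearMap)

namespace QuantumPrincipalBundle

variable {G P} (B : QuantumPrincipalBundle G P)

/-- The base space `M = {x | Φ(x) = x ⊗ 1}`. -/
def base : Subalgebra ℂ P := AlgHom.equalizer B.coact Algebra.TensorProduct.includeLeft

/-- For every irreducible unitary representation with matrix `u` there are finitely many
intertwiners `T_k` into the total space such that the elements `x k i = T_k(eᵢ)` satisfy
`∑ₖ (x k i)* (x k j) = δᵢⱼ`. -/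
def HasFrames : Prop :=
  ∀ (n : ℕ) (u : Matrix (Fin n) (Fin n) G), IsUnitaryRep u → IsIrreducibleRep u →
    ∃ (m : ℕ) (x : Matrix (Fin m) (Fin n) P),
      (∀ k i, B.coact (x k i) = ∑ j, x k j ⊗ₜ[ℂ] u j i) ∧
      ∀ i j, ∑ k, star (x k i) * x k j = if i = j then 1 else 0

end QuantumPrincipalBundle

variable {G P} {Γ Ω : Type*} [AddCommGroup Γ] [Module ℂ Γ] [Module G Γ] [Module Gᵐᵒᵖ Γ]
  [IsScalarTower ℂ G Γ] [IsScalarTower ℂ Gᵐᵒᵖ Γ] [SMulCommClass G Gᵐᵒᵖ Γ]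
  [Ring Ω] [Algebra ℂ Ω]

/-- A differential calculus on a quantum principal bundle: a graded differential `*`-algebra `Ω`
generated by its elements of degree zero, which are the elements of the total space, and an
extension `Ψ` of the coaction to a morphism of graded differential algebras into the graded tensor
product `Ω ⊗ Γ^∧`. Since `Ω` is generated by the total space as a differential algebra, `Ψ` also
respects the `*` operation. -/
structure BundleCalculus (B : QuantumPrincipalBundle G P) (c : FODC G Γ)
    (𝒜 : ℕ → Submodule ℂ Ω) [GradedAlgebra 𝒜] where
  d : Ω →ₗ[ℂ] Ω
  isDifferential : IsDifferential 𝒜 d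
  /-- The `*` operation on `Ω`. -/
  st : Ω → Ω
  st_st : ∀ w, st (st w) = w
  st_add : ∀ w z, st (w + z) = st w + st z
  st_smul : ∀ (r : ℂ) (w), st (r • w) = star r • st w
  st_mem : ∀ n, ∀ w ∈ 𝒜 n, st w ∈ 𝒜 n
  st_mul : ∀ m n, ∀ w ∈ 𝒜 m, ∀ z ∈ 𝒜 n, st (w * z) = (-1 : ℂ) ^ (m * n) • (st z * st w)
  st_d : ∀ w, st (d w) = d (st w)
  /-- The identification of the total space with the elements of degree zero. -/
  incl : P →ₐ[ℂ] Ω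
  incl_injective : Function.Injective incl
  incl_range : LinearMap.range incl.toLinearMap = 𝒜 0
  incl_star : ∀ x, incl (star x) = st (incl x)
  generated : Algebra.adjoin ℂ (Set.range incl ∪ Set.range fun x => d (incl x)) = ⊤
  Ψ : Ω →ₐ[ℂ] GradedTensorProduct ℂ 𝒜 (FODC.Env.grading c)
  Ψ_mem : ∀ n, ∀ w ∈ 𝒜 n, (GradedTensorProduct.of ℂ 𝒜 (FODC.Env.grading c)).symm (Ψ w) ∈
    totalDegree 𝒜 (FODC.Env.grading c) n
  Ψ_d : ∀ w, (GradedTensorProduct.of ℂ 𝒜 (FODC.Env.grading c)).symm (Ψ (d w)) =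
    tensorDifferential 𝒜 d (FODC.Env.d c)
      ((GradedTensorProduct.of ℂ 𝒜 (FODC.Env.grading c)).symm (Ψ w))
  Ψ_incl : ∀ x, (GradedTensorProduct.of ℂ 𝒜 (FODC.Env.grading c)).symm (Ψ (incl x)) =
    TensorProduct.map incl.toLinearMap (FODC.Env.of0 c).toLinearMap (B.coact x)

namespace BundleCalculus

variable {B : QuantumPrincipalBundle G P} {c : FODC G Γ} {𝒜 : ℕ → Submodule ℂ Ω}
  [GradedAlgebra 𝒜] (D : BundleCalculus B c 𝒜)

/-- `Ψ` as a linear map `Ω → Ω ⊗ Γ^∧`. -/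
def coact : Ω →ₗ[ℂ] Ω ⊗[ℂ] c.Env :=
  (GradedTensorProduct.of ℂ 𝒜 (FODC.Env.grading c)).symm.toLinearMap ∘ₗ D.Ψ.toLinearMap

/-- The algebra `Ω(M) = {μ | Ψ(μ) = μ ⊗ 1}` of base forms. -/
def baseForms : Subalgebra ℂ Ω :=
  AlgHom.equalizer D.Ψ (GradedTensorProduct.includeLeft 𝒜 (FODC.Env.grading c))

/-- The relations `w μ ⊗ z = w ⊗ μ z`, for `μ ∈ Ω(M)`. -/
def balancedRel : Submodule ℂ (Ω ⊗[ℂ] Ω) :=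
  Submodule.span ℂ {x | ∃ w z, ∃ μ ∈ D.baseForms, (w * μ) ⊗ₜ[ℂ] z - w ⊗ₜ[ℂ] (μ * z) = x}

/-- The tensor product `Ω ⊗_{Ω(M)} Ω`. -/
abbrev BalancedTensor : Type _ := (Ω ⊗[ℂ] Ω) ⧸ D.balancedRel

/-- The map `Ω ⊗_{Ω(M)} Ω → Ω ⊗ Γ^∧`, `w ⊗ z ↦ (w ⊗ 1) Ψ(z)`. -/
def canonical : D.BalancedTensor →ₗ[ℂ] Ω ⊗[ℂ] c.Env :=
  D.balancedRel.liftQ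
    ((GradedTensorProduct.of ℂ 𝒜 (FODC.Env.grading c)).symm.toLinearMap ∘ₗ
      LinearMap.mul' ℂ (GradedTensorProduct ℂ 𝒜 (FODC.Env.grading c)) ∘ₗ
      TensorProduct.map (GradedTensorProduct.includeLeft 𝒜 (FODC.Env.grading c)).toLinearMap
        D.Ψ.toLinearMap)
    (Submodule.span_le.mpr (by
      rintro _ ⟨w, z, μ, hμ, rfl⟩
      have h : D.Ψ μ = GradedTensorProduct.includeLeft 𝒜 (FODC.Env.grading c) μ := hμ
      simp only [SetLike.mem_coe, LinearMap.mem_ker, LinearMap.comp_apply, map_sub,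
        TensorProduct.map_tmul, LinearMap.mul'_apply, AlgHom.toLinearMap_apply, map_mul, h,
        mul_assoc, sub_self]))

/-- The quantum translation map `ϑ ↦ β⁻¹(1 ⊗ ϑ)`, where `β` is the map `canonical`. -/
def qtrs (hβ : Function.Bijective D.canonical) : c.Env →ₗ[ℂ] D.BalancedTensor :=
  (LinearEquiv.ofBijective D.canonical hβ).symm.toLinearMap ∘ₗ TensorProduct.mk ℂ Ω c.Env 1

/-- The map `m ∘ (id ⊗ F) : Ω ⊗_{Ω(M)} Ω → Ω`, for a left `Ω(M)`-linear map `F`. -/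
def mulMap (F : Ω →ₗ[ℂ] Ω) (hF : ∀ μ ∈ D.baseForms, ∀ w, F (μ * w) = μ * F w) :
    D.BalancedTensor →ₗ[ℂ] Ω :=
  D.balancedRel.liftQ (LinearMap.mul' ℂ Ω ∘ₗ TensorProduct.map LinearMap.id F)
    (Submodule.span_le.mpr (by
      rintro _ ⟨w, z, μ, hμ, rfl⟩
      simp [hF μ hμ, mul_assoc]))

/-- The conditions on the automorphisms `F` of `Ω`: they are graded, left `Ω(M)`-linear, unital
and they commute with the coaction `Ψ`. -/
structure IsGaugeAut (F : Ω →ₗ[ℂ] Ω) : Prop where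
  mem : ∀ n, ∀ w ∈ 𝒜 n, F w ∈ 𝒜 n
  map_base_mul : ∀ μ ∈ D.baseForms, ∀ w, F (μ * w) = μ * F w
  map_one : F 1 = 1
  coact : ∀ w, F.rTensor c.Env (D.coact w) = D.coact (F w)

theorem inv_mem (F : Ω ≃ₗ[ℂ] Ω) (h : ∀ n, ∀ w ∈ 𝒜 n, F w ∈ 𝒜 n) (n : ℕ) (w : Ω)
    (hw : w ∈ 𝒜 n) : F.symm w ∈ 𝒜 n := by
  classical
  have key : ∀ v : Ω, ∀ i, (DirectSum.decompose 𝒜 (F v) i : Ω) =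
      F (DirectSum.decompose 𝒜 v i) := by
    intro v i
    induction v using DirectSum.Decomposition.inductionOn 𝒜 with
    | zero => simp
    | homogeneous v =>
      rename_i j
      rw [DirectSum.decompose_coe, DirectSum.decompose_of_mem 𝒜 (h j v v.2)]
      by_cases e : j = i
      · subst e; simp
      · rw [DirectSum.of_eq_of_ne _ _ _ (Ne.symm e), DirectSum.of_eq_of_ne _ _ _ (Ne.symm e)]
        simp
    | add v v' hv hv' => simp [hv, hv']
  have e := key (F.symm w) n
  rw [LinearEquiv.apply_symm_apply, DirectSum.decompose_of_mem_same 𝒜 hw] at e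
  have : F.symm w = (DirectSum.decompose 𝒜 (F.symm w) n : Ω) := by
    rw [LinearEquiv.symm_apply_eq]; exact e
  rw [this]
  exact (DirectSum.decompose 𝒜 (F.symm w) n).2

/-- The group (under composition `(F₁ * F₂)(w) = F₁(F₂(w))`) of all graded left `Ω(M)`-module
automorphisms `F` of `Ω` with `F(1) = 1` that commute with the coaction. -/
def gaugeAut : Subgroup (Ω ≃ₗ[ℂ] Ω) where
  carrier := {F | D.IsGaugeAut F.toLinearMap}
  one_mem' := ⟨fun _ _ h => h, fun _ _ _ => rfl, rfl, fun w => by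
    change LinearMap.rTensor c.Env LinearMap.id _ = _
    rw [LinearMap.rTensor_id]; rfl⟩
  mul_mem' := fun {F F'} hF hF' => ⟨fun n w hw => hF.mem n _ (hF'.mem n w hw),
    fun μ hμ w => (congrArg F (hF'.map_base_mul μ hμ w)).trans (hF.map_base_mul μ hμ _),
    (congrArg F hF'.map_one).trans hF.map_one, fun w => by
      change LinearMap.rTensor c.Env (F.toLinearMap ∘ₗ F'.toLinearMap) _ = _
      rw [LinearMap.rTensor_comp, LinearMap.comp_apply, hF'.coact, hF.coact]; rfl⟩
  inv_mem' := fun {F} hF => ⟨inv_mem F hF.mem,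
    fun μ hμ w => F.symm_apply_eq.mpr (by
      have := hF.map_base_mul μ hμ (F.symm w)
      simpa using this.symm),
    F.symm_apply_eq.mpr hF.map_one.symm, fun w => by
      obtain ⟨v, rfl⟩ := F.surjective w
      have := hF.coact v
      simp only [LinearEquiv.coe_coe] at this
      rw [← this]
      change LinearMap.rTensor c.Env F.symm.toLinearMap _ = D.coact (F.symm (F v))
      rw [← LinearMap.comp_apply, ← LinearMap.rTensor_comp]
      simp⟩

/-- The convolution product `f * g = m ∘ (f ⊗ g) ∘ φ`. -/
def conv (_D : BundleCalculus B c 𝒜) (hc : c.IsBicovariant) (f g : c.Env →ₗ[ℂ] Ω) :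
    c.Env →ₗ[ℂ] Ω :=
  LinearMap.mul' ℂ Ω ∘ₗ TensorProduct.map f g ∘ₗ (FODC.Env.gr c).symm.toLinearMap ∘ₗ
    (FODC.Env.comul hc).toLinearMap

/-- The unit `ϑ ↦ ε(ϑ) 1` for the convolution product. -/
def convUnit (_D : BundleCalculus B c 𝒜) : c.Env →ₗ[ℂ] Ω :=
  Algebra.linearMap ℂ Ω ∘ₗ (FODC.Env.counit c).toLinearMap

end BundleCalculus

/-- The right adjoint coaction of `Γ^∧`,
`Ad(ϑ) = (-1)^{∂ϑ⁽¹⁾ ∂ϑ⁽²⁾} ϑ⁽²⁾ ⊗ κ(ϑ⁽¹⁾) ϑ⁽³⁾`. -/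
def FODC.Env.adj {c : FODC G Γ} (hc : c.IsBicovariant) : c.Env →ₗ[ℂ] c.Env ⊗[ℂ] c.Env :=
  (LinearMap.mul' ℂ c.Env).lTensor c.Env ∘ₗ
    (TensorProduct.assoc ℂ c.Env c.Env c.Env).toLinearMap ∘ₗ
    ((gr c).symm.toLinearMap ∘ₗ
      (GradedTensorProduct.comm (R := ℂ) (grading c) (grading c)).toLinearMap ∘ₗ
      (gr c).toLinearMap ∘ₗ
      (antipode hc).rTensor c.Env ∘ₗ
      (gr c).symm.toLinearMap ∘ₗ (comul hc).toLinearMap).rTensor c.Env ∘ₗ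
    (gr c).symm.toLinearMap ∘ₗ (comul hc).toLinearMap

namespace BundleCalculus

variable {B : QuantumPrincipalBundle G P} {c : FODC G Γ} {𝒜 : ℕ → Submodule ℂ Ω}
  [GradedAlgebra 𝒜] (D : BundleCalculus B c 𝒜)

/-- The convolution-invertible maps: graded linear maps `f : Γ^∧ → Ω` with `f(1) = 1` and
`(f ⊗ id) ∘ Ad = Ψ ∘ f` that have a graded linear inverse for the convolution product. -/
structure IsGaugeMap (hc : c.IsBicovariant) (f : c.Env →ₗ[ℂ] Ω) : Prop where
  mem : ∀ n, ∀ ϑ ∈ FODC.Env.grading c n, f ϑ ∈ 𝒜 n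
  map_one : f 1 = 1
  covariant : ∀ ϑ, f.rTensor c.Env (FODC.Env.adj hc ϑ) = D.coact (f ϑ)
  invertible : ∃ g : c.Env →ₗ[ℂ] Ω, (∀ n, ∀ ϑ ∈ FODC.Env.grading c n, g ϑ ∈ 𝒜 n) ∧
    D.conv hc f g = D.convUnit ∧ D.conv hc g f = D.convUnit

/-- The type of all convolution-invertible maps. -/
abbrev GaugeMap (hc : c.IsBicovariant) : Type _ := {f : c.Env →ₗ[ℂ] Ω // D.IsGaugeMap hc f}

end BundleCalculus

end Bundle

end QGauge

end

/-!
The heart of the matter is the bijectivity of the canonical map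
`β : Ω ⊗_{Ω(M)} Ω → Ω ⊗ Γ^∧`. Once it is known, both the covariance of `f : Γ^∧ → Ω` and the
passage between automorphisms and convolution-invertible maps are identities in convolution
algebras of maps `Γ^∧ → Ω ⊗ Γ^∧`. With `j(w) = w ⊗ 1` and `i(ϑ) = 1 ⊗ ϑ`, the adjoint coaction is
conjugation by `i` (`adj_eq_conj`), so that `f` is covariant if and only if
`Ψ ∘ f = (i ∘ κ) * (j ∘ f) * i`; all signs are absorbed by the multiplication of the graded tensor
product. A map `k` on `Γ^∧` is determined by `w ↦ w⁽⁰⁾ k(w⁽¹⁾)` because `β` is surjective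
(`convAct_cancel`), and this turns the composition of automorphisms into convolution
(`cotranslate_conv`, `gaugeEquiv`).

The inverse of `β` comes from an action of the algebra `Γ^∧` on `Ω ⊗_{Ω(M)} Ω` (`envAct`) which
corresponds to left multiplication by `1 ⊗ ϑ` under `β`; then `w ⊗ ϑ ↦ w (ϑ · (1 ⊗ 1))` is inverse
to `β` (`canonicalInv`). By the universal property of `Γ^∧`, the action is given by operators `f(g)`
and `δ(g)`, for `g ∈ G`, subject to the relations of the calculus.

* In degree zero, `G` is cosemisimple (`exists_colinear_section`, `mem_span_of_irreducible`), so the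
  surjection `P ⊗ P → P ⊗ G` has a colinear section. It gives the translation map `s` on `G`, which
  for each frame `x` is `u i j ↦ ∑ₖ (x k i)* ⊗ x k j` (`exists_isGroupTranslation`). This inverts
  `β` on the image of `Ω ⊗ Hor`, where `Hor` is the space of horizontal forms
  (`extend_zeroCoaction`), so identities between elements of this image can be checked after
  applying `β`. In particular the operators `f(g) : w ⊗ z ↦ w s(g) z` are well defined and
  multiplicative (`fiberHom`).
* The operator `δ(g)` is the commutator of `f(g)` with the differential (`fiberDer`). It has to be
  shown that `∑ g dh = 0` implies `∑ f(g) δ(h) = 0`. By left covariance of the calculus it suffices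
  that `κ(h⁽¹⁾) dh⁽²⁾ = 0` implies `f(κ(h⁽¹⁾)) δ(h⁽²⁾) = 0`
  (`mul'_map_eq_zero_of_maurerCartan`). For `h = u i j` both sides are represented, modulo
  horizontal terms, by the form `∑ₖ (x k i)* d(x k j)` (`exists_maurerCartan_representative`), so
  the problem is reduced to the image of `Ω ⊗ Hor`, where `β` is injective.
-/

open scoped TensorProduct DirectSum
open MulOpposite (op)

noncomputable section

set_option linter.unusedSectionVars false

namespace QGauge

/-! ### Graded tensor products and coactions that are determined on generators -/

section Parity

variable {A B : Type*} [Ring A] [Algebra ℂ A] [Ring B] [Algebra ℂ B]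
  (𝒜 : ℕ → Submodule ℂ A) (ℬ : ℕ → Submodule ℂ B) [GradedAlgebra 𝒜] [GradedAlgebra ℬ]

/-- The parity operator `w ↦ (-1)^n w`, for `w` of degree `n`. -/
def parity : A →ₗ[ℂ] A := degreeScale 𝒜 fun n => (-1) ^ n

theorem parity_apply {n : ℕ} {w : A} (hw : w ∈ 𝒜 n) : parity 𝒜 w = (-1 : ℂ) ^ n • w :=
  degreeScale_apply 𝒜 _ hw

theorem parity_of_mem_zero {w : A} (hw : w ∈ 𝒜 0) : parity 𝒜 w = w := by
  simp [parity_apply 𝒜 hw]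

theorem parity_of_mem_one {w : A} (hw : w ∈ 𝒜 1) : parity 𝒜 w = -w := by
  simp [parity_apply 𝒜 hw]

/-- Two linear maps that agree on homogeneous elements are equal. -/
theorem linearMap_ext_homogeneous {N : Type*} [AddCommGroup N] [Module ℂ N] {S T : A →ₗ[ℂ] N}
    (h : ∀ n, ∀ w ∈ 𝒜 n, S w = T w) : S = T := by
  ext w
  induction w using DirectSum.Decomposition.inductionOn 𝒜 with
  | zero => simp
  | homogeneous w => exact h _ _ w.2
  | add v w hv hw => rw [map_add, map_add, hv, hw]

theorem parity_mul (w z : A) : parity 𝒜 (w * z) = parity 𝒜 w * parity 𝒜 z := by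
  have : (LinearMap.mul ℂ A).compr₂ (parity 𝒜) =
      (LinearMap.mul ℂ A).compl₁₂ (parity 𝒜) (parity 𝒜) := by
    refine linearMap_ext_homogeneous 𝒜 fun m w hw => linearMap_ext_homogeneous 𝒜 fun n z hz => ?_
    simp [parity_apply 𝒜 hw, parity_apply 𝒜 hz, parity_apply 𝒜 (SetLike.mul_mem_graded hw hz),
      smul_smul, pow_add, mul_comm]
  exact LinearMap.congr_fun₂ this w z

theorem parity_one : parity 𝒜 1 = 1 := parity_of_mem_zero 𝒜 SetLike.GradedOne.one_mem

theorem parity_mem {n : ℕ} {w : A} (hw : w ∈ 𝒜 n) : parity 𝒜 w ∈ 𝒜 n := by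
  rw [parity_apply 𝒜 hw]; exact Submodule.smul_mem _ _ hw

theorem tmul_mul_tmul_zero (a : A) (b : B) {a' : A} (ha : a' ∈ 𝒜 0) (b' : B) :
    GradedTensorProduct.of ℂ 𝒜 ℬ (a ⊗ₜ b) * GradedTensorProduct.of ℂ 𝒜 ℬ (a' ⊗ₜ b') =
      GradedTensorProduct.of ℂ 𝒜 ℬ ((a * a') ⊗ₜ (b * b')) := by
  induction b using DirectSum.Decomposition.inductionOn ℬ with
  | zero => simp
  | homogeneous b => rw [of_mul_of 𝒜 ℬ b.2 ha]; simp
  | add b c hb hc => simp only [TensorProduct.tmul_add, map_add, add_mul, hb, hc]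

theorem tmul_mul_tmul_one (a : A) (b : B) {a' : A} (ha : a' ∈ 𝒜 1) (b' : B) :
    GradedTensorProduct.of ℂ 𝒜 ℬ (a ⊗ₜ b) * GradedTensorProduct.of ℂ 𝒜 ℬ (a' ⊗ₜ b') =
      GradedTensorProduct.of ℂ 𝒜 ℬ ((a * a') ⊗ₜ (parity ℬ b * b')) := by
  induction b using DirectSum.Decomposition.inductionOn ℬ with
  | zero => simp
  | homogeneous b =>
    rw [of_mul_of 𝒜 ℬ b.2 ha, parity_apply ℬ b.2]
    simp [TensorProduct.tmul_smul]
  | add b c hb hc => simp only [TensorProduct.tmul_add, map_add, add_mul, hb, hc]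

theorem tmul_mul_tmul_left_zero (a : A) {b : B} (hb : b ∈ ℬ 0) (a' : A) (b' : B) :
    GradedTensorProduct.of ℂ 𝒜 ℬ (a ⊗ₜ b) * GradedTensorProduct.of ℂ 𝒜 ℬ (a' ⊗ₜ b') =
      GradedTensorProduct.of ℂ 𝒜 ℬ ((a * a') ⊗ₜ (b * b')) := by
  induction a' using DirectSum.Decomposition.inductionOn 𝒜 with
  | zero => simp
  | homogeneous b => rw [of_mul_of 𝒜 ℬ hb b.2]; simp
  | add b c hb hc => simp only [TensorProduct.add_tmul, map_add, mul_add, hb, hc]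

theorem tmul_mul_tmul_left_one (a : A) {b : B} (hb : b ∈ ℬ 1) (a' : A) (b' : B) :
    GradedTensorProduct.of ℂ 𝒜 ℬ (a ⊗ₜ b) * GradedTensorProduct.of ℂ 𝒜 ℬ (a' ⊗ₜ b') =
      GradedTensorProduct.of ℂ 𝒜 ℬ ((a * parity 𝒜 a') ⊗ₜ (b * b')) := by
  induction a' using DirectSum.Decomposition.inductionOn 𝒜 with
  | zero => simp
  | homogeneous a' =>
    rw [of_mul_of 𝒜 ℬ hb a'.2, parity_apply 𝒜 a'.2, mul_smul_comm, ← TensorProduct.smul_tmul',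
      map_smul, one_mul]
  | add b c hb hc => simp only [TensorProduct.add_tmul, map_add, mul_add, hb, hc]

end Parity

section Comodule

open Coalgebra

variable {G Γ : Type*} [Ring G] [HopfAlgebra ℂ G]
  [AddCommGroup Γ] [Module ℂ Γ] [Module G Γ] [Module Gᵐᵒᵖ Γ]
  [IsScalarTower ℂ G Γ] [IsScalarTower ℂ Gᵐᵒᵖ Γ] [SMulCommClass G Gᵐᵒᵖ Γ]
  {c : FODC G Γ}

open FODC.Env

variable {P X : Type*} [AddCommGroup P] [Module ℂ P] [Ring X] [Algebra ℂ X]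

/-- An algebra `X` that is generated by the images of linear maps `i` and `δ` on `P`, and a
multiplicative map `Ψ : X → X ⊗ Γ^∧` that is given on the generators by a coaction
`ρ : P → P ⊗ G` as if `δ = d ∘ i` and `Ψ` commuted with the differentials. -/
structure IsDiffCoaction (𝒜 : ℕ → Submodule ℂ X) [GradedAlgebra 𝒜]
    (Ψ : X →ₐ[ℂ] GradedTensorProduct ℂ 𝒜 (grading c)) (i δ : P →ₗ[ℂ] X)
    (ρ : P →ₗ[ℂ] P ⊗[ℂ] G) : Prop where
  mem_zero : ∀ p, i p ∈ 𝒜 0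
  mem_one : ∀ p, δ p ∈ 𝒜 1
  generated : Algebra.adjoin ℂ (Set.range i ∪ Set.range δ) = ⊤
  map_zero : ∀ p, Ψ (i p) = GradedTensorProduct.of ℂ 𝒜 (grading c)
    (TensorProduct.map i (of0 c).toLinearMap (ρ p))
  map_one : ∀ p, Ψ (δ p) = GradedTensorProduct.of ℂ 𝒜 (grading c)
    (TensorProduct.map δ (of0 c).toLinearMap (ρ p) + TensorProduct.map i (d0 c) (ρ p))
  coassoc : ∀ p, comul.lTensor P (ρ p) = TensorProduct.assoc ℂ P G G (ρ.rTensor G (ρ p))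
  counit : ∀ p, TensorProduct.rid ℂ P (counit.lTensor P (ρ p)) = p

/-- Right multiplication by an element of degree zero of the coaction, as a bilinear map. -/
def mulZero (c : FODC G Γ) (i : P →ₗ[ℂ] X) :
    X ⊗[ℂ] c.Env →ₗ[ℂ] P ⊗[ℂ] G →ₗ[ℂ] X ⊗[ℂ] c.Env :=
  TensorProduct.map₂ ((LinearMap.mul ℂ X).compl₂ i)
    ((LinearMap.mul ℂ c.Env).compl₂ (of0 c).toLinearMap)

/-- Right multiplication by an element of degree one of the coaction, as a bilinear map. -/
def mulOne (c : FODC G Γ) (i δ : P →ₗ[ℂ] X) :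
    X ⊗[ℂ] c.Env →ₗ[ℂ] P ⊗[ℂ] G →ₗ[ℂ] X ⊗[ℂ] c.Env :=
  TensorProduct.map₂ ((LinearMap.mul ℂ X).compl₂ δ)
    ((LinearMap.mul ℂ c.Env).compl₁₂ (parity (grading c)) (of0 c).toLinearMap) +
  TensorProduct.map₂ ((LinearMap.mul ℂ X).compl₂ i)
    ((LinearMap.mul ℂ c.Env).compl₂ (d0 c))

theorem mulZero_tmul (i : P →ₗ[ℂ] X) (x : X) (ϑ : c.Env) (p : P) (g : G) :
    mulZero c i (x ⊗ₜ ϑ) (p ⊗ₜ g) = (x * i p) ⊗ₜ (ϑ * of0 c g) := by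
  simp [mulZero]

theorem mulOne_tmul (i δ : P →ₗ[ℂ] X) (x : X) (ϑ : c.Env) (p : P) (g : G) :
    mulOne c i δ (x ⊗ₜ ϑ) (p ⊗ₜ g) =
      (x * δ p) ⊗ₜ (parity (grading c) ϑ * of0 c g) + (x * i p) ⊗ₜ (ϑ * d0 c g) := by
  simp [mulOne]

/-- Induction on two elements of tensor products, for the equality of two bilinear maps. -/
theorem bilin_ext {M N M' N' Q : Type*} [AddCommGroup M] [Module ℂ M] [AddCommGroup N] [Module ℂ N]
    [AddCommGroup M'] [Module ℂ M'] [AddCommGroup N'] [Module ℂ N'] [AddCommGroup Q] [Module ℂ Q]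
    {S T : M ⊗[ℂ] N →ₗ[ℂ] M' ⊗[ℂ] N' →ₗ[ℂ] Q}
    (h : ∀ m n m' n', S (m ⊗ₜ n) (m' ⊗ₜ n') = T (m ⊗ₜ n) (m' ⊗ₜ n')) : S = T := by
  ext m n m' n'
  exact h m n m' n'

namespace IsDiffCoaction

variable {𝒜 : ℕ → Submodule ℂ X} [GradedAlgebra 𝒜]
  {Ψ : X →ₐ[ℂ] GradedTensorProduct ℂ 𝒜 (grading c)} {i δ : P →ₗ[ℂ] X} {ρ : P →ₗ[ℂ] P ⊗[ℂ] G}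

/-- Induction over products of generators, built up by multiplication on the right. -/
theorem induction (h : IsDiffCoaction 𝒜 Ψ i δ ρ) (S : Submodule ℂ X) (one : 1 ∈ S)
    (zero : ∀ x ∈ S, ∀ p, x * i p ∈ S) (deg_one : ∀ x ∈ S, ∀ p, x * δ p ∈ S) (x : X) : x ∈ S := by
  have hx : x ∈ Subalgebra.toSubmodule (R := ℂ) (A := X)
      (Algebra.adjoin ℂ (Set.range i ∪ Set.range δ)) := by
    rw [h.generated]; exact Algebra.mem_top (R := ℂ)
  rw [Algebra.adjoin_eq_span ℂ] at hx
  induction hx using Submodule.span_induction with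
  | zero => exact S.zero_mem
  | add x y _ _ hx hy => exact S.add_mem hx hy
  | smul a x _ hx => exact S.smul_mem a hx
  | mem x hx =>
    induction hx using Submonoid.closure_induction_right with
    | one => exact one
    | mul_right x _ y hy hx =>
      rcases hy with ⟨p, rfl⟩ | ⟨p, rfl⟩
      · exact zero x hx p
      · exact deg_one x hx p

/-- `Ψ` as a linear map into the plain tensor product. -/
abbrev lin (_h : IsDiffCoaction 𝒜 Ψ i δ ρ) : X →ₗ[ℂ] X ⊗[ℂ] c.Env :=
  (GradedTensorProduct.of ℂ 𝒜 (grading c)).symm.toLinearMap ∘ₗ Ψ.toLinearMap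

variable (h : IsDiffCoaction 𝒜 Ψ i δ ρ)
include h

theorem lin_one : h.lin 1 = 1 ⊗ₜ 1 := by simp; rfl

theorem lin_mul_zero (x : X) (p : P) : h.lin (x * i p) = mulZero c i (h.lin x) (ρ p) := by
  have key : ∀ (t : X ⊗[ℂ] c.Env) (q : P ⊗[ℂ] G),
      GradedTensorProduct.of ℂ 𝒜 (grading c) t * GradedTensorProduct.of ℂ 𝒜 (grading c)
        (TensorProduct.map i (of0 c).toLinearMap q) =
      GradedTensorProduct.of ℂ 𝒜 (grading c) (mulZero c i t q) := by
    intro t q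
    induction t using TensorProduct.induction_on with
    | zero => simp
    | add t t' ht ht' => simp only [map_add, LinearMap.add_apply, add_mul, ht, ht']
    | tmul x ϑ =>
      induction q using TensorProduct.induction_on with
      | zero => simp
      | add q q' hq hq' => simp only [map_add, mul_add, hq, hq']
      | tmul p g =>
        rw [mulZero_tmul, TensorProduct.map_tmul, tmul_mul_tmul_zero 𝒜 _ _ _ (h.mem_zero p)]
        rfl
  have := key (h.lin x) (ρ p)
  rw [← h.map_zero] at this
  simp only [LinearMap.comp_apply, AlgHom.toLinearMap_apply, LinearEquiv.coe_coe, map_mul]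
  rw [LinearEquiv.symm_apply_eq]
  exact this

theorem lin_mul_one (x : X) (p : P) : h.lin (x * δ p) = mulOne c i δ (h.lin x) (ρ p) := by
  have key : ∀ (t : X ⊗[ℂ] c.Env) (q : P ⊗[ℂ] G),
      GradedTensorProduct.of ℂ 𝒜 (grading c) t * GradedTensorProduct.of ℂ 𝒜 (grading c)
        (TensorProduct.map δ (of0 c).toLinearMap q + TensorProduct.map i (d0 c) q) =
      GradedTensorProduct.of ℂ 𝒜 (grading c) (mulOne c i δ t q) := by
    intro t q
    induction t using TensorProduct.induction_on with
    | zero => simp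
    | add t t' ht ht' => simp only [map_add, LinearMap.add_apply, add_mul] at ht ht' ⊢; rw [ht, ht']
    | tmul x ϑ =>
      induction q using TensorProduct.induction_on with
      | zero => simp
      | add q q' hq hq' =>
        simp only [map_add, mul_add] at hq hq' ⊢
        rw [← hq, ← hq']
        abel
      | tmul p g =>
        rw [mulOne_tmul, TensorProduct.map_tmul, TensorProduct.map_tmul, map_add, map_add, mul_add,
          tmul_mul_tmul_zero 𝒜 _ _ _ (h.mem_zero p), tmul_mul_tmul_one 𝒜 _ _ _ (h.mem_one p)]
        rfl
  have := key (h.lin x) (ρ p)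
  rw [← h.map_one] at this
  simp only [LinearMap.comp_apply, AlgHom.toLinearMap_apply, LinearEquiv.coe_coe, map_mul]
  rw [LinearEquiv.symm_apply_eq]
  exact this

theorem lin_parity (x : X) :
    h.lin (parity 𝒜 x) = TensorProduct.map (parity 𝒜) (parity (grading c)) (h.lin x) := by
  have zero : ∀ t q, mulZero c i (TensorProduct.map (parity 𝒜) (parity (grading c)) t) q =
      TensorProduct.map (parity 𝒜) (parity (grading c)) (mulZero c i t q) := by
    intro t q
    refine LinearMap.congr_fun₂ (f := (mulZero c i).comp (TensorProduct.map _ _))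
      (g := (mulZero c i).compr₂ (TensorProduct.map _ _)) (bilin_ext fun x ϑ p g => ?_) t q
    simp [mulZero_tmul, parity_mul, parity_of_mem_zero 𝒜 (h.mem_zero p),
      parity_of_mem_zero (grading c) (of0_mem c g)]
  have one : ∀ t q, -mulOne c i δ (TensorProduct.map (parity 𝒜) (parity (grading c)) t) q =
      TensorProduct.map (parity 𝒜) (parity (grading c)) (mulOne c i δ t q) := by
    intro t q
    refine LinearMap.congr_fun₂ (f := -(mulOne c i δ).comp (TensorProduct.map _ _))
      (g := (mulOne c i δ).compr₂ (TensorProduct.map _ _)) (bilin_ext fun x ϑ p g => ?_) t q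
    simp [mulOne_tmul, parity_mul, parity_of_mem_zero 𝒜 (h.mem_zero p),
      parity_of_mem_one 𝒜 (h.mem_one p), parity_of_mem_one (grading c) (d0_mem c g),
      parity_of_mem_zero (grading c) (of0_mem c g), TensorProduct.neg_tmul, TensorProduct.tmul_neg,
      add_comm]
  refine h.induction (LinearMap.eqLocus (h.lin ∘ₗ parity 𝒜)
    (TensorProduct.map (parity 𝒜) (parity (grading c)) ∘ₗ h.lin)) ?_ ?_ ?_ x
  · simp only [LinearMap.mem_eqLocus, LinearMap.comp_apply (h.lin),
      LinearMap.comp_apply (TensorProduct.map _ _), parity_one, h.lin_one, TensorProduct.map_tmul]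
  · intro x hx p
    simp only [LinearMap.mem_eqLocus, LinearMap.comp_apply (h.lin),
      LinearMap.comp_apply (TensorProduct.map _ _), parity_mul,
      parity_of_mem_zero 𝒜 (h.mem_zero p), h.lin_mul_zero] at hx ⊢
    rw [hx, zero]
  · intro x hx p
    simp only [LinearMap.mem_eqLocus, LinearMap.comp_apply (h.lin),
      LinearMap.comp_apply (TensorProduct.map _ _), parity_mul,
      parity_of_mem_one 𝒜 (h.mem_one p), h.lin_mul_one, mul_neg, map_neg] at hx ⊢
    rw [hx, ← one]

end IsDiffCoaction

end Comodule

/-! ### The envelope as a coalgebra -/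

section Comodule

open Coalgebra

variable {G Γ : Type*} [Ring G] [HopfAlgebra ℂ G]
  [AddCommGroup Γ] [Module ℂ Γ] [Module G Γ] [Module Gᵐᵒᵖ Γ]
  [IsScalarTower ℂ G Γ] [IsScalarTower ℂ Gᵐᵒᵖ Γ] [SMulCommClass G Gᵐᵒᵖ Γ]
  {c : FODC G Γ}

open FODC.Env

variable {P X : Type*} [AddCommGroup P] [Module ℂ P] [Ring X] [Algebra ℂ X]

/-- The coproduct of `Γ^∧` as a linear map into the plain tensor product. -/
def FODC.Env.comulLin (hc : c.IsBicovariant) : c.Env →ₗ[ℂ] c.Env ⊗[ℂ] c.Env :=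
  (gr c).symm.toLinearMap ∘ₗ (comul hc).toLinearMap

/-- The coproduct of `Γ^∧` is determined by the coproduct of `G` on the generators. -/
theorem FODC.Env.isDiffCoaction_comul (hc : c.IsBicovariant) :
    IsDiffCoaction (grading c) (comul hc) (of0 c).toLinearMap (d0 c)
      (Coalgebra.comul : G →ₗ[ℂ] G ⊗[ℂ] G) where
  mem_zero := of0_mem c
  mem_one := d0_mem c
  generated := by
    rw [eq_top_iff]
    rintro w -
    have h0 : ∀ a, of0 c a ∈ Algebra.adjoin ℂ
        (Set.range (of0 c).toLinearMap ∪ Set.range (d0 c)) :=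
      fun a => Algebra.subset_adjoin (Or.inl ⟨a, rfl⟩)
    induction w using FODC.Env.induction with
    | h0 a => exact h0 a
    | h1 ξ =>
      obtain ⟨x, rfl⟩ := c.form_surjective ξ
      rw [← mul_of0_d0]
      induction x using TensorProduct.induction_on with
      | zero => simp
      | tmul a b =>
        simpa using mul_mem (h0 a) (Algebra.subset_adjoin (Or.inr ⟨b, rfl⟩))
      | add x y hx hy => simpa using add_mem hx hy
    | hadd x y hx hy => exact add_mem hx hy
    | hmul x y hx hy => exact mul_mem hx hy
  map_zero := comul_of0 hc
  map_one := comul_d0 hc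
  coassoc := fun a => by simp
  counit := fun a => by simp

/-- Right multiplication by an element of degree zero on a triple tensor product. -/
def mulZeroLeft (c : FODC G Γ) (i : P →ₗ[ℂ] X) :
    (X ⊗[ℂ] c.Env) ⊗[ℂ] c.Env →ₗ[ℂ] (P ⊗[ℂ] G) ⊗[ℂ] G →ₗ[ℂ] (X ⊗[ℂ] c.Env) ⊗[ℂ] c.Env :=
  TensorProduct.map₂ (mulZero c i) ((LinearMap.mul ℂ c.Env).compl₂ (of0 c).toLinearMap)

/-- `mulZeroLeft`, with the brackets on the right. -/
def mulZeroRight (c : FODC G Γ) (i : P →ₗ[ℂ] X) :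
    X ⊗[ℂ] (c.Env ⊗[ℂ] c.Env) →ₗ[ℂ] P ⊗[ℂ] (G ⊗[ℂ] G) →ₗ[ℂ] X ⊗[ℂ] (c.Env ⊗[ℂ] c.Env) :=
  TensorProduct.map₂ ((LinearMap.mul ℂ X).compl₂ i) (mulZero c (of0 c).toLinearMap)

/-- Right multiplication by an element of degree one on a triple tensor product. -/
def mulOneLeft (c : FODC G Γ) (i δ : P →ₗ[ℂ] X) :
    (X ⊗[ℂ] c.Env) ⊗[ℂ] c.Env →ₗ[ℂ] (P ⊗[ℂ] G) ⊗[ℂ] G →ₗ[ℂ] (X ⊗[ℂ] c.Env) ⊗[ℂ] c.Env :=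
  TensorProduct.map₂ (mulOne c i δ)
    ((LinearMap.mul ℂ c.Env).compl₁₂ (parity (grading c)) (of0 c).toLinearMap) +
  TensorProduct.map₂ (mulZero c i) ((LinearMap.mul ℂ c.Env).compl₂ (d0 c))

/-- `mulOneLeft`, with the brackets on the right. -/
def mulOneRight (c : FODC G Γ) (i δ : P →ₗ[ℂ] X) :
    X ⊗[ℂ] (c.Env ⊗[ℂ] c.Env) →ₗ[ℂ] P ⊗[ℂ] (G ⊗[ℂ] G) →ₗ[ℂ] X ⊗[ℂ] (c.Env ⊗[ℂ] c.Env) :=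
  TensorProduct.map₂ ((LinearMap.mul ℂ X).compl₂ δ)
    ((mulZero c (of0 c).toLinearMap).comp
      (TensorProduct.map (parity (grading c)) (parity (grading c)))) +
  TensorProduct.map₂ ((LinearMap.mul ℂ X).compl₂ i) (mulOne c (of0 c).toLinearMap (d0 c))

theorem assoc_mulZeroLeft (i : P →ₗ[ℂ] X) (T) (Q) :
    TensorProduct.assoc ℂ _ _ _ (mulZeroLeft c i T Q) =
      mulZeroRight c i (TensorProduct.assoc ℂ _ _ _ T) (TensorProduct.assoc ℂ _ _ _ Q) := by
  refine LinearMap.congr_fun₂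
    (f := (mulZeroLeft c i).compr₂ (TensorProduct.assoc ℂ _ _ _).toLinearMap)
    (g := (mulZeroRight c i).compl₁₂ (TensorProduct.assoc ℂ _ _ _).toLinearMap
      (TensorProduct.assoc ℂ _ _ _).toLinearMap) ?_ T Q
  ext x ϑ η p g g'
  simp [mulZeroLeft, mulZeroRight, mulZero_tmul]

theorem assoc_mulOneLeft (i δ : P →ₗ[ℂ] X) (T) (Q) :
    TensorProduct.assoc ℂ _ _ _ (mulOneLeft c i δ T Q) =
      mulOneRight c i δ (TensorProduct.assoc ℂ _ _ _ T) (TensorProduct.assoc ℂ _ _ _ Q) := by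
  refine LinearMap.congr_fun₂
    (f := (mulOneLeft c i δ).compr₂ (TensorProduct.assoc ℂ _ _ _).toLinearMap)
    (g := (mulOneRight c i δ).compl₁₂ (TensorProduct.assoc ℂ _ _ _).toLinearMap
      (TensorProduct.assoc ℂ _ _ _).toLinearMap) ?_ T Q
  ext x ϑ η p g g'
  simp [mulOneLeft, mulOneRight, mulZero_tmul, mulOne_tmul, TensorProduct.add_tmul,
    TensorProduct.tmul_add, add_assoc]

namespace IsDiffCoaction

variable {𝒜 : ℕ → Submodule ℂ X} [GradedAlgebra 𝒜]
  {Ψ : X →ₐ[ℂ] GradedTensorProduct ℂ 𝒜 (grading c)} {i δ : P →ₗ[ℂ] X} {ρ : P →ₗ[ℂ] P ⊗[ℂ] G}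

theorem rTensor_mulZero (h : IsDiffCoaction 𝒜 Ψ i δ ρ) (t : X ⊗[ℂ] c.Env) (q : P ⊗[ℂ] G) :
    h.lin.rTensor c.Env (mulZero c i t q) =
      mulZeroLeft c i (h.lin.rTensor c.Env t) (ρ.rTensor G q) := by
  refine LinearMap.congr_fun₂ (f := (mulZero c i).compr₂ (h.lin.rTensor c.Env))
    (g := (mulZeroLeft c i).compl₁₂ (h.lin.rTensor c.Env) (ρ.rTensor G))
    (bilin_ext fun x ϑ p g => ?_) t q
  simp only [LinearMap.compr₂_apply, LinearMap.compl₁₂_apply, mulZero_tmul,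
    LinearMap.rTensor_tmul, h.lin_mul_zero, mulZeroLeft, TensorProduct.map₂_apply_tmul]
  simp

theorem rTensor_mulOne (h : IsDiffCoaction 𝒜 Ψ i δ ρ) (t : X ⊗[ℂ] c.Env) (q : P ⊗[ℂ] G) :
    h.lin.rTensor c.Env (mulOne c i δ t q) =
      mulOneLeft c i δ (h.lin.rTensor c.Env t) (ρ.rTensor G q) := by
  refine LinearMap.congr_fun₂ (f := (mulOne c i δ).compr₂ (h.lin.rTensor c.Env))
    (g := (mulOneLeft c i δ).compl₁₂ (h.lin.rTensor c.Env) (ρ.rTensor G))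
    (bilin_ext fun x ϑ p g => ?_) t q
  simp only [LinearMap.compr₂_apply, LinearMap.compl₁₂_apply, mulOne_tmul, map_add,
    LinearMap.rTensor_tmul, h.lin_mul_zero, h.lin_mul_one, mulOneLeft, LinearMap.add_apply,
    TensorProduct.map₂_apply_tmul]
  simp

theorem lTensor_mulZero (hc : c.IsBicovariant) (t : X ⊗[ℂ] c.Env) (q : P ⊗[ℂ] G) :
    (comulLin hc).lTensor X (mulZero c i t q) =
      mulZeroRight c i ((comulLin hc).lTensor X t)
        ((Coalgebra.comul : G →ₗ[ℂ] G ⊗[ℂ] G).lTensor P q) := by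
  refine LinearMap.congr_fun₂ (f := (mulZero c i).compr₂ ((comulLin hc).lTensor X))
    (g := (mulZeroRight c i).compl₁₂ ((comulLin hc).lTensor X)
      ((Coalgebra.comul : G →ₗ[ℂ] G ⊗[ℂ] G).lTensor P))
    (bilin_ext fun x ϑ p g => ?_) t q
  have := (isDiffCoaction_comul hc).lin_mul_zero ϑ g
  simp only [LinearMap.compr₂_apply, LinearMap.compl₁₂_apply, mulZero_tmul,
    LinearMap.lTensor_tmul, mulZeroRight, TensorProduct.map₂_apply_tmul]
  exact congrArg _ this

theorem lTensor_mulOne (hc : c.IsBicovariant) (t : X ⊗[ℂ] c.Env) (q : P ⊗[ℂ] G) :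
    (comulLin hc).lTensor X (mulOne c i δ t q) =
      mulOneRight c i δ ((comulLin hc).lTensor X t)
        ((Coalgebra.comul : G →ₗ[ℂ] G ⊗[ℂ] G).lTensor P q) := by
  refine LinearMap.congr_fun₂ (f := (mulOne c i δ).compr₂ ((comulLin hc).lTensor X))
    (g := (mulOneRight c i δ).compl₁₂ ((comulLin hc).lTensor X)
      ((Coalgebra.comul : G →ₗ[ℂ] G ⊗[ℂ] G).lTensor P))
    (bilin_ext fun x ϑ p g => ?_) t q
  have h0 := (isDiffCoaction_comul hc).lin_mul_zero (parity (grading c) ϑ) g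
  have h1 := (isDiffCoaction_comul hc).lin_mul_one ϑ g
  rw [lin_parity] at h0
  simp only [LinearMap.compr₂_apply, LinearMap.compl₁₂_apply, mulOne_tmul, map_add,
    LinearMap.lTensor_tmul, mulOneRight, TensorProduct.map₂_apply_tmul, LinearMap.add_apply]
  exact congrArg₂ _ (congrArg _ h0) (congrArg _ h1)

/-- The extension of a coaction of `G` to differential forms is coassociative. -/
theorem lin_coassoc (h : IsDiffCoaction 𝒜 Ψ i δ ρ) (hc : c.IsBicovariant) (x : X) :
    (comulLin hc).lTensor X (h.lin x) =
      TensorProduct.assoc ℂ X c.Env c.Env (h.lin.rTensor c.Env (h.lin x)) := by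
  refine h.induction (LinearMap.eqLocus ((comulLin hc).lTensor X ∘ₗ h.lin)
    ((TensorProduct.assoc ℂ X c.Env c.Env).toLinearMap ∘ₗ h.lin.rTensor c.Env ∘ₗ h.lin)) ?_ ?_ ?_ x
  · have : comulLin hc 1 = 1 ⊗ₜ 1 := (isDiffCoaction_comul hc).lin_one
    change (comulLin hc).lTensor X (h.lin 1) =
      TensorProduct.assoc ℂ X c.Env c.Env (h.lin.rTensor c.Env (h.lin 1))
    rw [h.lin_one, LinearMap.lTensor_tmul, LinearMap.rTensor_tmul, this, h.lin_one]
    rfl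
  · intro x hx p
    change (comulLin hc).lTensor X (h.lin x) =
      TensorProduct.assoc ℂ X c.Env c.Env (h.lin.rTensor c.Env (h.lin x)) at hx
    change (comulLin hc).lTensor X (h.lin _) =
      TensorProduct.assoc ℂ X c.Env c.Env (h.lin.rTensor c.Env (h.lin _))
    rw [h.lin_mul_zero, h.rTensor_mulZero, assoc_mulZeroLeft, ← hx, ← h.coassoc, lTensor_mulZero]
  · intro x hx p
    change (comulLin hc).lTensor X (h.lin x) =
      TensorProduct.assoc ℂ X c.Env c.Env (h.lin.rTensor c.Env (h.lin x)) at hx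
    change (comulLin hc).lTensor X (h.lin _) =
      TensorProduct.assoc ℂ X c.Env c.Env (h.lin.rTensor c.Env (h.lin _))
    rw [h.lin_mul_one, h.rTensor_mulOne, assoc_mulOneLeft, ← hx, ← h.coassoc, lTensor_mulOne]

theorem _root_.QGauge.FODC.Env.counit_d0 (a : G) : FODC.Env.counit c (d0 c a) = 0 :=
  counit_of1 c _

theorem _root_.QGauge.FODC.Env.counit_eq_zero {n : ℕ} {w : c.Env} (hw : w ∈ grading c n)
    (hn : n ≠ 0) : FODC.Env.counit c w = 0 :=
  grading_induction c (p := fun n w => n ≠ 0 → FODC.Env.counit c w = 0)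
    (fun _ h => absurd rfl h) (fun n x y hx hy h => by rw [map_add, hx h, hy h, add_zero])
    (fun n x ξ _ _ _ => by rw [map_mul, counit_of1, mul_zero]) hw hn

theorem _root_.QGauge.FODC.Env.counit_parity (ϑ : c.Env) :
    FODC.Env.counit c (parity (grading c) ϑ) = FODC.Env.counit c ϑ := by
  have : (FODC.Env.counit c).toLinearMap ∘ₗ parity (grading c) =
      (FODC.Env.counit c).toLinearMap := by
    refine linearMap_ext_homogeneous (grading c) fun n w hw => ?_
    rcases n with _ | n
    · simp [parity_of_mem_zero _ hw]
    · simp [parity_apply _ hw, counit_eq_zero hw n.succ_ne_zero]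
  exact LinearMap.congr_fun this ϑ

/-- The extension of a coaction of `G` to differential forms is counital. -/
theorem lin_counit (h : IsDiffCoaction 𝒜 Ψ i δ ρ) (x : X) :
    TensorProduct.rid ℂ X ((FODC.Env.counit c).toLinearMap.lTensor X (h.lin x)) = x := by
  have zero : ∀ (t : X ⊗[ℂ] c.Env) (q : P ⊗[ℂ] G),
      TensorProduct.rid ℂ X ((FODC.Env.counit c).toLinearMap.lTensor X (mulZero c i t q)) =
      TensorProduct.rid ℂ X ((FODC.Env.counit c).toLinearMap.lTensor X t) *
        i (TensorProduct.rid ℂ P (Coalgebra.counit.lTensor P q)) := by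
    intro t q
    refine LinearMap.congr_fun₂
      (f := (mulZero c i).compr₂ ((TensorProduct.rid ℂ X).toLinearMap ∘ₗ
        (FODC.Env.counit c).toLinearMap.lTensor X))
      (g := (LinearMap.mul ℂ X).compl₁₂ ((TensorProduct.rid ℂ X).toLinearMap ∘ₗ
        (FODC.Env.counit c).toLinearMap.lTensor X) (i ∘ₗ (TensorProduct.rid ℂ P).toLinearMap ∘ₗ
        Coalgebra.counit.lTensor P)) (bilin_ext fun x ϑ p g => ?_) t q
    simp [mulZero_tmul, counit_of0, smul_smul, mul_comm]
  have one : ∀ (t : X ⊗[ℂ] c.Env) (q : P ⊗[ℂ] G),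
      TensorProduct.rid ℂ X ((FODC.Env.counit c).toLinearMap.lTensor X (mulOne c i δ t q)) =
      TensorProduct.rid ℂ X ((FODC.Env.counit c).toLinearMap.lTensor X t) *
        δ (TensorProduct.rid ℂ P (Coalgebra.counit.lTensor P q)) := by
    intro t q
    refine LinearMap.congr_fun₂
      (f := (mulOne c i δ).compr₂ ((TensorProduct.rid ℂ X).toLinearMap ∘ₗ
        (FODC.Env.counit c).toLinearMap.lTensor X))
      (g := (LinearMap.mul ℂ X).compl₁₂ ((TensorProduct.rid ℂ X).toLinearMap ∘ₗ
        (FODC.Env.counit c).toLinearMap.lTensor X) (δ ∘ₗ (TensorProduct.rid ℂ P).toLinearMap ∘ₗ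
        Coalgebra.counit.lTensor P)) (bilin_ext fun x ϑ p g => ?_) t q
    simp [mulOne_tmul, counit_of0, counit_d0, counit_parity, smul_smul, mul_comm]
  refine h.induction (LinearMap.eqLocus ((TensorProduct.rid ℂ X).toLinearMap ∘ₗ
    (FODC.Env.counit c).toLinearMap.lTensor X ∘ₗ h.lin) LinearMap.id) ?_ ?_ ?_ x
  · change TensorProduct.rid ℂ X ((FODC.Env.counit c).toLinearMap.lTensor X (h.lin 1)) = 1
    rw [h.lin_one]
    simp
  · intro x hx p
    change TensorProduct.rid ℂ X ((FODC.Env.counit c).toLinearMap.lTensor X (h.lin x)) = x at hx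
    change TensorProduct.rid ℂ X ((FODC.Env.counit c).toLinearMap.lTensor X (h.lin _)) = _
    rw [h.lin_mul_zero, zero, hx, h.counit]
    rfl
  · intro x hx p
    change TensorProduct.rid ℂ X ((FODC.Env.counit c).toLinearMap.lTensor X (h.lin x)) = x at hx
    change TensorProduct.rid ℂ X ((FODC.Env.counit c).toLinearMap.lTensor X (h.lin _)) = _
    rw [h.lin_mul_one, one, hx, h.counit]
    rfl

end IsDiffCoaction

end Comodule

/-! ### The antipode of the envelope -/

section Coalgebra

open Coalgebra

variable {G Γ : Type*} [Ring G] [HopfAlgebra ℂ G]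
  [AddCommGroup Γ] [Module ℂ Γ] [Module G Γ] [Module Gᵐᵒᵖ Γ]
  [IsScalarTower ℂ G Γ] [IsScalarTower ℂ Gᵐᵒᵖ Γ] [SMulCommClass G Gᵐᵒᵖ Γ]
  {c : FODC G Γ}

/-- The map `m ⊗ n ↦ (x ↦ u(m) x v(n))`. -/
def sandwich {A M N : Type*} [Ring A] [Algebra ℂ A] [AddCommGroup M] [Module ℂ M]
    [AddCommGroup N] [Module ℂ N] (u : M →ₗ[ℂ] A) (v : N →ₗ[ℂ] A) :
    M ⊗[ℂ] N →ₗ[ℂ] Module.End ℂ A :=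
  LinearMap.mul' ℂ (Module.End ℂ A) ∘ₗ
    TensorProduct.map (LinearMap.mul ℂ A ∘ₗ u) ((LinearMap.mul ℂ A).flip ∘ₗ v)

section

variable {A M N : Type*} [Ring A] [Algebra ℂ A] [AddCommGroup M] [Module ℂ M]
    [AddCommGroup N] [Module ℂ N] (u : M →ₗ[ℂ] A) (v : N →ₗ[ℂ] A)

theorem sandwich_tmul (m : M) (n : N) (x : A) :
    sandwich u v (m ⊗ₜ n) x = u m * (x * v n) := rfl

theorem sandwich_one (q : M ⊗[ℂ] N) :
    sandwich u v q 1 = LinearMap.mul' ℂ A (TensorProduct.map u v q) := by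
  induction q using TensorProduct.induction_on with
  | zero => simp
  | tmul m n => simp [sandwich_tmul]
  | add q q' hq hq' => simp only [map_add, LinearMap.add_apply, hq, hq']

end

namespace FODC.Env

theorem lid_counit_comul (hc : c.IsBicovariant) (x : c.Env) :
    TensorProduct.lid ℂ c.Env ((counit c).toLinearMap.rTensor c.Env (comulLin hc x)) = x := by
  have h := isDiffCoaction_comul hc
  have zero : ∀ (t : c.Env ⊗[ℂ] c.Env) (q : G ⊗[ℂ] G),
      TensorProduct.lid ℂ c.Env ((counit c).toLinearMap.rTensor c.Env
        (mulZero c (of0 c).toLinearMap t q)) =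
      TensorProduct.lid ℂ c.Env ((counit c).toLinearMap.rTensor c.Env t) *
        of0 c (TensorProduct.lid ℂ G (Coalgebra.counit.rTensor G q)) := by
    intro t q
    refine LinearMap.congr_fun₂
      (f := (mulZero c (of0 c).toLinearMap).compr₂ ((TensorProduct.lid ℂ c.Env).toLinearMap ∘ₗ
        (counit c).toLinearMap.rTensor c.Env))
      (g := (LinearMap.mul ℂ c.Env).compl₁₂ ((TensorProduct.lid ℂ c.Env).toLinearMap ∘ₗ
        (counit c).toLinearMap.rTensor c.Env) ((of0 c).toLinearMap ∘ₗ
        (TensorProduct.lid ℂ G).toLinearMap ∘ₗ Coalgebra.counit.rTensor G))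
      (bilin_ext fun x ϑ p g => ?_) t q
    simp [mulZero_tmul, counit_of0, smul_smul, mul_comm]
  have one : ∀ (t : c.Env ⊗[ℂ] c.Env) (q : G ⊗[ℂ] G),
      TensorProduct.lid ℂ c.Env ((counit c).toLinearMap.rTensor c.Env
        (mulOne c (of0 c).toLinearMap (d0 c) t q)) =
      TensorProduct.lid ℂ c.Env ((counit c).toLinearMap.rTensor c.Env t) *
        d0 c (TensorProduct.lid ℂ G (Coalgebra.counit.rTensor G q)) := by
    intro t q
    refine LinearMap.congr_fun₂
      (f := (mulOne c (of0 c).toLinearMap (d0 c)).compr₂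
        ((TensorProduct.lid ℂ c.Env).toLinearMap ∘ₗ (counit c).toLinearMap.rTensor c.Env))
      (g := (LinearMap.mul ℂ c.Env).compl₁₂ ((TensorProduct.lid ℂ c.Env).toLinearMap ∘ₗ
        (counit c).toLinearMap.rTensor c.Env) (d0 c ∘ₗ
        (TensorProduct.lid ℂ G).toLinearMap ∘ₗ Coalgebra.counit.rTensor G))
      (bilin_ext fun x ϑ p g => ?_) t q
    simp [mulOne_tmul, counit_of0, counit_d0, smul_smul, mul_comm]
  refine h.induction (LinearMap.eqLocus ((TensorProduct.lid ℂ c.Env).toLinearMap ∘ₗ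
    (counit c).toLinearMap.rTensor c.Env ∘ₗ h.lin) LinearMap.id) ?_ ?_ ?_ x
  · change TensorProduct.lid ℂ c.Env ((counit c).toLinearMap.rTensor c.Env (h.lin 1)) = 1
    rw [h.lin_one]
    simp
  · intro x hx p
    change TensorProduct.lid ℂ c.Env ((counit c).toLinearMap.rTensor c.Env (h.lin x)) = x at hx
    change TensorProduct.lid ℂ c.Env ((counit c).toLinearMap.rTensor c.Env (h.lin _)) = _
    rw [h.lin_mul_zero, zero, hx]
    simp
  · intro x hx p
    change TensorProduct.lid ℂ c.Env ((counit c).toLinearMap.rTensor c.Env (h.lin x)) = x at hx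
    change TensorProduct.lid ℂ c.Env ((counit c).toLinearMap.rTensor c.Env (h.lin _)) = _
    rw [h.lin_mul_one, one, hx]
    simp

/-- The coalgebra structure of `Γ^∧`. It depends on the bicovariance of the calculus, so it is not
an instance. -/
@[reducible] def coalgebra (hc : c.IsBicovariant) : Coalgebra ℂ c.Env where
  comul := comulLin hc
  counit := (counit c).toLinearMap
  coassoc := LinearMap.ext fun x => ((isDiffCoaction_comul hc).lin_coassoc hc x).symm
  rTensor_counit_comp_comul := LinearMap.ext fun x =>
    (TensorProduct.lid ℂ c.Env).injective ((lid_counit_comul hc x).trans (by simp))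
  lTensor_counit_comp_comul := LinearMap.ext fun x =>
    (TensorProduct.rid ℂ c.Env).injective
      (((isDiffCoaction_comul hc).lin_counit x).trans (by simp))

theorem antipode_mul_zero (hc : c.IsBicovariant) (w : c.Env) (a : G) :
    antipode hc (w * of0 c a) = of0 c (HopfAlgebra.antipode ℂ a) * antipode hc w := by
  have : antipode hc ∘ₗ LinearMap.mulRight ℂ (of0 c a) =
      LinearMap.mulLeft ℂ (of0 c (HopfAlgebra.antipode ℂ a)) ∘ₗ antipode hc :=
    linearMap_ext_homogeneous (grading c) fun n w hw => by
      simp [antipode_mul hc hw (of0_mem c a), antipode_of0]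
  exact LinearMap.congr_fun this w

theorem antipode_mul_one (hc : c.IsBicovariant) (w : c.Env) (a : G) :
    antipode hc (w * d0 c a) =
      d0 c (HopfAlgebra.antipode ℂ a) * antipode hc (parity (grading c) w) := by
  have : antipode hc ∘ₗ LinearMap.mulRight ℂ (d0 c a) =
      LinearMap.mulLeft ℂ (d0 c (HopfAlgebra.antipode ℂ a)) ∘ₗ antipode hc ∘ₗ
        parity (grading c) :=
    linearMap_ext_homogeneous (grading c) fun n w hw => by
      simp [antipode_mul hc hw (d0_mem c a), antipode_d0, parity_apply _ hw]
  exact LinearMap.congr_fun this w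

theorem antipode_mem (hc : c.IsBicovariant) {n : ℕ} {w : c.Env} (hw : w ∈ grading c n) :
    antipode hc w ∈ grading c n := by
  rw [antipode_apply hc hw]
  exact Submodule.smul_mem _ _ (antipodeOp_mem hc hw)

theorem antipode_parity (hc : c.IsBicovariant) (w : c.Env) :
    antipode hc (parity (grading c) w) = parity (grading c) (antipode hc w) := by
  have : antipode hc ∘ₗ parity (grading c) = parity (grading c) ∘ₗ antipode hc :=
    linearMap_ext_homogeneous (grading c) fun n w hw => by
      simp [parity_apply _ hw, parity_apply _ (antipode_mem hc hw)]
  exact LinearMap.congr_fun this w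

/-- The derivation rule for `d`, for products of elements of degree zero. -/
theorem mul'_d0_add (u v : G →ₗ[ℂ] G) (q : G ⊗[ℂ] G) :
    LinearMap.mul' ℂ c.Env (TensorProduct.map (d0 c ∘ₗ u) ((of0 c).toLinearMap ∘ₗ v) q) +
      LinearMap.mul' ℂ c.Env (TensorProduct.map ((of0 c).toLinearMap ∘ₗ u) (d0 c ∘ₗ v) q) =
      d0 c (LinearMap.mul' ℂ G (TensorProduct.map u v q)) := by
  induction q using TensorProduct.induction_on with
  | zero => simp
  | tmul a b => simp [d0_mul]
  | add q q' hq hq' => simp only [map_add, ← hq, ← hq']; abel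

theorem mul'_of0 (u v : G →ₗ[ℂ] G) (q : G ⊗[ℂ] G) :
    LinearMap.mul' ℂ c.Env (TensorProduct.map ((of0 c).toLinearMap ∘ₗ u)
      ((of0 c).toLinearMap ∘ₗ v) q) = of0 c (LinearMap.mul' ℂ G (TensorProduct.map u v q)) := by
  induction q using TensorProduct.induction_on with
  | zero => simp
  | tmul a b => simp
  | add q q' hq hq' => simp only [map_add, hq, hq']

/-- The antipode is a left convolution inverse of the identity. Replacing `x` by `x g` turns the
left side into `κ(g⁽¹⁾) (…) g⁽²⁾`, and similarly for `x dg`, so the identity propagates from `G` to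
the forms that `G` generates. -/
theorem antipode_mul_id (hc : c.IsBicovariant) (x : c.Env) :
    LinearMap.mul' ℂ c.Env ((antipode hc).rTensor c.Env (comulLin hc x)) =
      algebraMap ℂ c.Env (counit c x) := by
  have h := isDiffCoaction_comul hc
  let κ : G →ₗ[ℂ] G := HopfAlgebra.antipode ℂ
  have zero : ∀ (t : c.Env ⊗[ℂ] c.Env) (q : G ⊗[ℂ] G),
      LinearMap.mul' ℂ c.Env ((antipode hc).rTensor c.Env (mulZero c (of0 c).toLinearMap t q)) =
      sandwich ((of0 c).toLinearMap ∘ₗ κ) (of0 c).toLinearMap q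
        (LinearMap.mul' ℂ c.Env ((antipode hc).rTensor c.Env t)) := by
    intro t q
    refine LinearMap.congr_fun₂ (f := (mulZero c (of0 c).toLinearMap).compr₂
        (LinearMap.mul' ℂ c.Env ∘ₗ (antipode hc).rTensor c.Env))
      (g := (sandwich ((of0 c).toLinearMap ∘ₗ κ) (of0 c).toLinearMap).flip.comp
        (LinearMap.mul' ℂ c.Env ∘ₗ (antipode hc).rTensor c.Env))
      (bilin_ext fun x ϑ p g => ?_) t q
    simp [mulZero_tmul, sandwich_tmul, antipode_mul_zero, mul_assoc, κ]
  have one : ∀ (t : c.Env ⊗[ℂ] c.Env) (q : G ⊗[ℂ] G),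
      LinearMap.mul' ℂ c.Env ((antipode hc).rTensor c.Env
        (mulOne c (of0 c).toLinearMap (d0 c) t q)) =
      sandwich (d0 c ∘ₗ κ) (of0 c).toLinearMap q (parity (grading c)
        (LinearMap.mul' ℂ c.Env ((antipode hc).rTensor c.Env t))) +
      sandwich ((of0 c).toLinearMap ∘ₗ κ) (d0 c) q
        (LinearMap.mul' ℂ c.Env ((antipode hc).rTensor c.Env t)) := by
    intro t q
    refine LinearMap.congr_fun₂ (f := (mulOne c (of0 c).toLinearMap (d0 c)).compr₂
        (LinearMap.mul' ℂ c.Env ∘ₗ (antipode hc).rTensor c.Env))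
      (g := (sandwich (d0 c ∘ₗ κ) (of0 c).toLinearMap).flip.comp
        (parity (grading c) ∘ₗ LinearMap.mul' ℂ c.Env ∘ₗ (antipode hc).rTensor c.Env) +
        (sandwich ((of0 c).toLinearMap ∘ₗ κ) (d0 c)).flip.comp
        (LinearMap.mul' ℂ c.Env ∘ₗ (antipode hc).rTensor c.Env))
      (bilin_ext fun x ϑ p g => ?_) t q
    simp [mulOne_tmul, sandwich_tmul, antipode_mul_zero, antipode_mul_one, mul_assoc, κ,
      parity_mul, antipode_parity]
  have alg : ∀ r : ℂ, algebraMap ℂ c.Env r = r • 1 := Algebra.algebraMap_eq_smul_one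
  have base : ∀ p, LinearMap.mul' ℂ G (TensorProduct.map κ LinearMap.id
      (Coalgebra.comul (R := ℂ) p)) = algebraMap ℂ G (Coalgebra.counit p) :=
    fun p => HopfAlgebra.mul_antipode_rTensor_comul_apply p
  refine h.induction (LinearMap.eqLocus (LinearMap.mul' ℂ c.Env ∘ₗ
    (antipode hc).rTensor c.Env ∘ₗ h.lin) (Algebra.linearMap ℂ c.Env ∘ₗ (counit c).toLinearMap))
    ?_ ?_ ?_ x
  · change LinearMap.mul' ℂ c.Env ((antipode hc).rTensor c.Env (h.lin 1)) =
      algebraMap ℂ c.Env (counit c 1)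
    rw [h.lin_one, LinearMap.rTensor_tmul, ← map_one (of0 c), antipode_of0]
    simp
  · intro x hx p
    change LinearMap.mul' ℂ c.Env ((antipode hc).rTensor c.Env (h.lin x)) =
      algebraMap ℂ c.Env (counit c x) at hx
    change LinearMap.mul' ℂ c.Env ((antipode hc).rTensor c.Env (h.lin _)) =
      algebraMap ℂ c.Env (counit c _)
    rw [h.lin_mul_zero, zero, hx, alg, map_smul, sandwich_one]
    have := mul'_of0 (c := c) κ LinearMap.id (Coalgebra.comul p)
    rw [LinearMap.comp_id] at this
    rw [this, base, AlgHom.commutes, AlgHom.toLinearMap_apply, map_mul, counit_of0, alg, alg,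
      smul_smul]
  · intro x hx p
    change LinearMap.mul' ℂ c.Env ((antipode hc).rTensor c.Env (h.lin x)) =
      algebraMap ℂ c.Env (counit c x) at hx
    change LinearMap.mul' ℂ c.Env ((antipode hc).rTensor c.Env (h.lin _)) =
      algebraMap ℂ c.Env (counit c _)
    rw [h.lin_mul_one, one, hx, alg, map_smul, map_smul, map_smul, parity_one, sandwich_one,
      sandwich_one, ← smul_add]
    have := mul'_d0_add (c := c) κ LinearMap.id (Coalgebra.comul p)
    rw [LinearMap.comp_id, LinearMap.comp_id] at this
    rw [this, base, map_mul, counit_d0, Algebra.algebraMap_eq_smul_one, map_smul, d0_one]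
    simp

/-- The antipode is a right convolution inverse of the identity. Here replacing `x` by `x g` inserts
`g⁽¹⁾ κ(g⁽²⁾)` between the factors `x⁽¹⁾` and `κ(x⁽²⁾)`. -/
theorem id_mul_antipode (hc : c.IsBicovariant) (x : c.Env) :
    LinearMap.mul' ℂ c.Env ((antipode hc).lTensor c.Env (comulLin hc x)) =
      algebraMap ℂ c.Env (counit c x) := by
  have h := isDiffCoaction_comul hc
  let κ : G →ₗ[ℂ] G := HopfAlgebra.antipode ℂ
  have zero : ∀ (t : c.Env ⊗[ℂ] c.Env) (q : G ⊗[ℂ] G),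
      LinearMap.mul' ℂ c.Env ((antipode hc).lTensor c.Env (mulZero c (of0 c).toLinearMap t q)) =
      sandwich LinearMap.id (antipode hc) t (LinearMap.mul' ℂ c.Env
        (TensorProduct.map (of0 c).toLinearMap ((of0 c).toLinearMap ∘ₗ κ) q)) := by
    intro t q
    have key := LinearMap.congr_fun₂ (f := (mulZero c (of0 c).toLinearMap).compr₂
        (LinearMap.mul' ℂ c.Env ∘ₗ (antipode hc).lTensor c.Env))
      (g := (sandwich LinearMap.id (antipode hc)).compl₂ (LinearMap.mul' ℂ c.Env ∘ₗ
        (TensorProduct.map (of0 c).toLinearMap ((of0 c).toLinearMap ∘ₗ κ))))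
      (bilin_ext fun x ϑ p g => by
        simp [mulZero_tmul, sandwich_tmul, antipode_mul_zero, mul_assoc, κ]) t q
    simpa only [LinearMap.compr₂_apply, LinearMap.compl₂_apply, LinearMap.comp_apply] using key
  have one : ∀ (t : c.Env ⊗[ℂ] c.Env) (q : G ⊗[ℂ] G),
      LinearMap.mul' ℂ c.Env ((antipode hc).lTensor c.Env
        (mulOne c (of0 c).toLinearMap (d0 c) t q)) =
      sandwich LinearMap.id (antipode hc ∘ₗ parity (grading c)) t
        (LinearMap.mul' ℂ c.Env
          (TensorProduct.map (d0 c) ((of0 c).toLinearMap ∘ₗ κ) q) +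
        LinearMap.mul' ℂ c.Env
          (TensorProduct.map (of0 c).toLinearMap (d0 c ∘ₗ κ) q)) := by
    intro t q
    have key := LinearMap.congr_fun₂ (f := (mulOne c (of0 c).toLinearMap (d0 c)).compr₂
        (LinearMap.mul' ℂ c.Env ∘ₗ (antipode hc).lTensor c.Env))
      (g := (sandwich LinearMap.id (antipode hc ∘ₗ parity (grading c))).compl₂
        (LinearMap.mul' ℂ c.Env ∘ₗ TensorProduct.map (d0 c) ((of0 c).toLinearMap ∘ₗ κ) +
        LinearMap.mul' ℂ c.Env ∘ₗ TensorProduct.map (of0 c).toLinearMap (d0 c ∘ₗ κ)))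
      (bilin_ext fun x ϑ p g => by
        simp [mulOne_tmul, sandwich_tmul, antipode_mul_zero, antipode_mul_one, mul_assoc, κ,
          mul_add, add_mul]) t q
    simpa only [LinearMap.compr₂_apply, LinearMap.compl₂_apply, LinearMap.comp_apply,
      LinearMap.add_apply] using key
  have alg : ∀ r : ℂ, algebraMap ℂ c.Env r = r • 1 := Algebra.algebraMap_eq_smul_one
  have base : ∀ p, LinearMap.mul' ℂ G (TensorProduct.map LinearMap.id κ
      (Coalgebra.comul (R := ℂ) p)) = algebraMap ℂ G (Coalgebra.counit p) :=
    fun p => HopfAlgebra.mul_antipode_lTensor_comul_apply p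
  refine h.induction (LinearMap.eqLocus (LinearMap.mul' ℂ c.Env ∘ₗ
    (antipode hc).lTensor c.Env ∘ₗ h.lin) (Algebra.linearMap ℂ c.Env ∘ₗ (counit c).toLinearMap))
    ?_ ?_ ?_ x
  · change LinearMap.mul' ℂ c.Env ((antipode hc).lTensor c.Env (h.lin 1)) =
      algebraMap ℂ c.Env (counit c 1)
    rw [h.lin_one, LinearMap.lTensor_tmul, ← map_one (of0 c), antipode_of0]
    simp
  · intro x hx p
    change LinearMap.mul' ℂ c.Env ((antipode hc).lTensor c.Env (h.lin x)) =
      algebraMap ℂ c.Env (counit c x) at hx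
    change LinearMap.mul' ℂ c.Env ((antipode hc).lTensor c.Env (h.lin _)) =
      algebraMap ℂ c.Env (counit c _)
    have := mul'_of0 (c := c) LinearMap.id κ (Coalgebra.comul p)
    rw [LinearMap.comp_id] at this
    rw [h.lin_mul_zero, zero, this, base, AlgHom.commutes, alg, map_smul, sandwich_one]
    change _ • LinearMap.mul' ℂ c.Env ((antipode hc).lTensor c.Env (h.lin x)) = _
    rw [hx, AlgHom.toLinearMap_apply, map_mul, counit_of0, alg, alg, smul_smul, mul_comm]
  · intro x hx p
    change LinearMap.mul' ℂ c.Env ((antipode hc).lTensor c.Env (h.lin _)) =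
      algebraMap ℂ c.Env (counit c _)
    have := mul'_d0_add (c := c) LinearMap.id κ (Coalgebra.comul p)
    rw [LinearMap.comp_id, LinearMap.comp_id] at this
    rw [h.lin_mul_one, one, this, base, map_mul, counit_d0, Algebra.algebraMap_eq_smul_one,
      map_smul, d0_one]
    simp

end FODC.Env

end Coalgebra

/-! ### Convolution and degrees -/

section ConvAction

open WithConv

variable {C X A A' : Type*} [AddCommGroup C] [Module ℂ C] [Coalgebra ℂ C] [AddCommGroup X]
  [Module ℂ X] [Ring A] [Algebra ℂ A] [Ring A'] [Algebra ℂ A'] (ρ : X →ₗ[ℂ] X ⊗[ℂ] C)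

/-- The right action `ψ ⋆ k = m ∘ (ψ ⊗ k) ∘ ρ` of the convolution algebra `Hom(C, A)` on
`Hom(X, A)`, for a right `C`-comodule `X` with coaction `ρ`. -/
def convAct (ψ : X →ₗ[ℂ] A) (k : WithConv (C →ₗ[ℂ] A)) : X →ₗ[ℂ] A :=
  LinearMap.mul' ℂ A ∘ₗ TensorProduct.map ψ k.ofConv ∘ₗ ρ

variable {ρ}

theorem convAct_convAct (hρ : ∀ x, Coalgebra.comul.lTensor X (ρ x) =
      TensorProduct.assoc ℂ X C C (ρ.rTensor C (ρ x)))
    (ψ : X →ₗ[ℂ] A) (k k' : WithConv (C →ₗ[ℂ] A)) :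
    convAct ρ (convAct ρ ψ k) k' = convAct ρ ψ (k * k') := by
  have h1 : ∀ t : (X ⊗[ℂ] C) ⊗[ℂ] C,
      LinearMap.mul' ℂ A (TensorProduct.map (LinearMap.mul' ℂ A ∘ₗ TensorProduct.map ψ k.ofConv)
        k'.ofConv t) =
      LinearMap.mul' ℂ A (TensorProduct.map ψ (LinearMap.mul' ℂ A ∘ₗ
        TensorProduct.map k.ofConv k'.ofConv) (TensorProduct.assoc ℂ X C C t)) := by
    intro t
    refine LinearMap.congr_fun (f := LinearMap.mul' ℂ A ∘ₗ TensorProduct.map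
      (LinearMap.mul' ℂ A ∘ₗ TensorProduct.map ψ k.ofConv) k'.ofConv)
      (g := LinearMap.mul' ℂ A ∘ₗ TensorProduct.map ψ (LinearMap.mul' ℂ A ∘ₗ
        TensorProduct.map k.ofConv k'.ofConv) ∘ₗ (TensorProduct.assoc ℂ X C C).toLinearMap) ?_ t
    ext x c c'
    simp [mul_assoc]
  ext x
  have := h1 (ρ.rTensor C (ρ x))
  rw [← hρ] at this
  simp only [← LinearMap.comp_apply (TensorProduct.map _ _) (LinearMap.rTensor _ _),
    ← LinearMap.comp_apply (TensorProduct.map _ _) (LinearMap.lTensor _ _),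
    LinearMap.map_comp_rTensor, LinearMap.map_comp_lTensor] at this
  exact this

theorem convAct_one (hρ : ∀ x, TensorProduct.rid ℂ X (Coalgebra.counit.lTensor X (ρ x)) = x)
    (ψ : X →ₗ[ℂ] A) : convAct ρ ψ (1 : WithConv (C →ₗ[ℂ] A)) = ψ := by
  ext x
  conv_rhs => rw [← hρ x]
  have : ∀ t : X ⊗[ℂ] C, LinearMap.mul' ℂ A (TensorProduct.map ψ
      (Algebra.linearMap ℂ A ∘ₗ Coalgebra.counit) t) =
      ψ (TensorProduct.rid ℂ X (Coalgebra.counit.lTensor X t)) := by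
    intro t
    induction t using TensorProduct.induction_on with
    | zero => simp
    | tmul x c => simp [Algebra.smul_def, Algebra.commutes]
    | add t t' ht ht' => simp only [map_add, ht, ht']
  exact this _

theorem algHom_comp_convAct (h : A →ₐ[ℂ] A') (ψ : X →ₗ[ℂ] A) (k : WithConv (C →ₗ[ℂ] A)) :
    h.toLinearMap ∘ₗ convAct ρ ψ k =
      convAct ρ (h.toLinearMap ∘ₗ ψ) (toConv (h.toLinearMap ∘ₗ k.ofConv)) := by
  rw [convAct, convAct, TensorProduct.map_comp, ← LinearMap.comp_assoc, AlgHom.comp_mul']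
  rfl

end ConvAction

section TotalDegree

variable {A B : Type*} [Ring A] [Algebra ℂ A] [Ring B] [Algebra ℂ B]
  {𝒜 : ℕ → Submodule ℂ A} {ℬ : ℕ → Submodule ℂ B}

theorem tmul_mem_totalDegree {i j n : ℕ} (h : i + j = n) {a : A} {b : B} (ha : a ∈ 𝒜 i)
    (hb : b ∈ ℬ j) : a ⊗ₜ[ℂ] b ∈ totalDegree 𝒜 ℬ n :=
  Submodule.mem_iSup_of_mem ⟨(i, j), h⟩ ⟨⟨a, ha⟩ ⊗ₜ ⟨b, hb⟩, rfl⟩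

theorem totalDegree_le {n : ℕ} {S : Submodule ℂ (A ⊗[ℂ] B)}
    (h : ∀ i j, i + j = n → ∀ a ∈ 𝒜 i, ∀ b ∈ ℬ j, a ⊗ₜ[ℂ] b ∈ S) :
    totalDegree 𝒜 ℬ n ≤ S := by
  refine iSup_le ?_
  rintro ⟨⟨i, j⟩, hij⟩ _ ⟨t, rfl⟩
  induction t using TensorProduct.induction_on with
  | zero => simp
  | tmul a b => exact h i j hij a a.2 b b.2
  | add t t' ht ht' => rw [map_add]; exact add_mem ht ht'

end TotalDegree

section Graded

variable {G Γ : Type*} [Ring G] [HopfAlgebra ℂ G]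
  [AddCommGroup Γ] [Module ℂ Γ] [Module G Γ] [Module Gᵐᵒᵖ Γ]
  [IsScalarTower ℂ G Γ] [IsScalarTower ℂ Gᵐᵒᵖ Γ] [SMulCommClass G Gᵐᵒᵖ Γ]
  {c : FODC G Γ}

namespace FODC.Env

theorem mulZero_mem {n : ℕ} {t : c.Env ⊗[ℂ] c.Env}
    (ht : t ∈ totalDegree (grading c) (grading c) n) (q : G ⊗[ℂ] G) :
    mulZero c (of0 c).toLinearMap t q ∈ totalDegree (grading c) (grading c) n := by
  refine (totalDegree_le (S := (totalDegree (grading c) (grading c) n).comap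
    ((mulZero c (of0 c).toLinearMap).flip q)) fun i j hij a ha b hb => ?_) ht
  rw [Submodule.mem_comap, LinearMap.flip_apply]
  induction q using TensorProduct.induction_on with
  | zero => simp
  | tmul g g' =>
    rw [mulZero_tmul]
    exact tmul_mem_totalDegree hij
      (by simpa using SetLike.mul_mem_graded ha (of0_mem c g))
      (by simpa using SetLike.mul_mem_graded hb (of0_mem c g'))
  | add q q' hq hq' => rw [map_add]; exact add_mem hq hq'

theorem mulOne_mem {n : ℕ} {t : c.Env ⊗[ℂ] c.Env}
    (ht : t ∈ totalDegree (grading c) (grading c) n) (q : G ⊗[ℂ] G) :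
    mulOne c (of0 c).toLinearMap (d0 c) t q ∈
      totalDegree (grading c) (grading c) (n + 1) := by
  refine (totalDegree_le (S := (totalDegree (grading c) (grading c) (n + 1)).comap
    ((mulOne c (of0 c).toLinearMap (d0 c)).flip q)) fun i j hij a ha b hb => ?_) ht
  rw [Submodule.mem_comap, LinearMap.flip_apply]
  induction q using TensorProduct.induction_on with
  | zero => simp
  | tmul g g' =>
    rw [mulOne_tmul]
    refine add_mem ?_ ?_
    · exact tmul_mem_totalDegree (i := i + 1) (j := j) (by omega)
        (SetLike.mul_mem_graded ha (d0_mem c g))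
        (by simpa using SetLike.mul_mem_graded (parity_mem _ hb) (of0_mem c g'))
    · exact tmul_mem_totalDegree (i := i) (j := j + 1) (by omega)
        (by simpa using SetLike.mul_mem_graded ha (of0_mem c g))
        (SetLike.mul_mem_graded hb (d0_mem c g'))
  | add q q' hq hq' => rw [map_add]; exact add_mem hq hq'

/-- The coproduct of `Γ^∧` preserves the degree. -/
theorem comulLin_mem (hc : c.IsBicovariant) {n : ℕ} {w : c.Env} (hw : w ∈ grading c n) :
    comulLin hc w ∈ totalDegree (grading c) (grading c) n := by
  have h := isDiffCoaction_comul hc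
  refine grading_induction c
    (p := fun n w => comulLin hc w ∈ totalDegree (grading c) (grading c) n) (fun a => ?_)
    (fun n x y hx hy => by rw [map_add]; exact add_mem hx hy) (fun n x ξ _ hx => ?_) hw
  · have e := h.lin_mul_zero 1 a
    rw [one_mul, h.lin_one] at e
    have e' : comulLin hc (of0 c a) =
        mulZero c (of0 c).toLinearMap (1 ⊗ₜ 1) (Coalgebra.comul a) := e
    rw [e']
    have one0 : (1 : c.Env) ∈ grading c 0 := SetLike.GradedOne.one_mem
    exact mulZero_mem (tmul_mem_totalDegree (i := 0) (j := 0) rfl one0 one0) _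
  · obtain ⟨u, rfl⟩ := c.form_surjective ξ
    rw [← mul_of0_d0]
    induction u using TensorProduct.induction_on with
    | zero => simp
    | tmul a b =>
      have e : comulLin hc (x * (of0 c a * d0 c b)) =
          mulOne c (of0 c).toLinearMap (d0 c) (mulZero c (of0 c).toLinearMap (comulLin hc x)
            (Coalgebra.comul a)) (Coalgebra.comul b) := by
        rw [← mul_assoc]
        exact (h.lin_mul_one _ b).trans (by rw [← AlgHom.toLinearMap_apply, h.lin_mul_zero]; rfl)
      simp only [TensorProduct.map_tmul, LinearMap.mul'_apply, AlgHom.toLinearMap_apply]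
      rw [e]
      exact mulOne_mem (mulZero_mem hx _) _
    | add u v hu hv => simp only [map_add, mul_add]; exact add_mem hu hv

/-- The coalgebra structure of `Γ^∧`, for a calculus that is known to be bicovariant. -/
instance [h : Fact c.IsBicovariant] : Coalgebra ℂ c.Env := coalgebra h.out

end FODC.Env

end Graded

namespace BundleCalculus

open FODC.Env WithConv

variable {G P : Type*} [Ring G] [HopfAlgebra ℂ G] [StarRing G] [StarModule ℂ G]
  [Ring P] [Algebra ℂ P] [StarRing P] [StarModule ℂ P]
  {Γ Ω : Type*} [AddCommGroup Γ] [Module ℂ Γ] [Module G Γ] [Module Gᵐᵒᵖ Γ]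
  [IsScalarTower ℂ G Γ] [IsScalarTower ℂ Gᵐᵒᵖ Γ] [SMulCommClass G Gᵐᵒᵖ Γ]
  [Ring Ω] [Algebra ℂ Ω]
  {B : QuantumPrincipalBundle G P} {c : FODC G Γ} {𝒜 : ℕ → Submodule ℂ Ω}
  [GradedAlgebra 𝒜] (D : BundleCalculus B c 𝒜)

theorem isDiffCoaction : IsDiffCoaction 𝒜 D.Ψ D.incl.toLinearMap (D.d ∘ₗ D.incl.toLinearMap)
    B.coact.toLinearMap where
  mem_zero := fun p => by rw [← D.incl_range]; exact ⟨p, rfl⟩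
  mem_one := fun p => D.isDifferential.mem 0 _ (by rw [← D.incl_range]; exact ⟨p, rfl⟩)
  generated := D.generated
  map_zero := fun p => by
    rw [← LinearEquiv.symm_apply_eq]
    exact D.Ψ_incl p
  map_one := fun p => by
    have key : ∀ q : P ⊗[ℂ] G, tensorDifferential 𝒜 D.d (FODC.Env.d c)
        (TensorProduct.map D.incl.toLinearMap (of0 c).toLinearMap q) =
        TensorProduct.map (D.d ∘ₗ D.incl.toLinearMap) (of0 c).toLinearMap q +
          TensorProduct.map D.incl.toLinearMap (d0 c) q := by
      intro q
      induction q using TensorProduct.induction_on with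
      | zero => simp
      | tmul p g =>
        have : parity 𝒜 (D.incl p) = D.incl p :=
          parity_of_mem_zero 𝒜 (by rw [← D.incl_range]; exact ⟨p, rfl⟩)
        rw [parity] at this
        simp [tensorDifferential, this, d0_apply]
      | add q q' hq hq' => simp only [map_add, hq, hq']; abel
    have := D.Ψ_d (D.incl p)
    rw [D.Ψ_incl, key, LinearEquiv.symm_apply_eq] at this
    exact this
  coassoc := B.coact_coassoc
  counit := B.coact_counit

theorem coact_counit (w : Ω) :
    TensorProduct.rid ℂ Ω ((FODC.Env.counit c).toLinearMap.lTensor Ω (D.coact w)) = w :=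
  D.isDiffCoaction.lin_counit w

theorem coact_coassoc (hc : c.IsBicovariant) (w : Ω) : (comulLin hc).lTensor Ω (D.coact w) =
    TensorProduct.assoc ℂ Ω c.Env c.Env (D.coact.rTensor c.Env (D.coact w)) :=
  D.isDiffCoaction.lin_coassoc hc w

theorem coact_one : D.coact 1 = 1 ⊗ₜ 1 := D.isDiffCoaction.lin_one

theorem coact_parity (w : Ω) :
    D.coact (parity 𝒜 w) = TensorProduct.map (parity 𝒜) (parity (grading c)) (D.coact w) :=
  D.isDiffCoaction.lin_parity w

end BundleCalculus

/-! ### The covariance condition and the convolution group -/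

namespace BundleCalculus

open FODC.Env WithConv

variable {G P : Type*} [Ring G] [HopfAlgebra ℂ G] [StarRing G] [StarModule ℂ G]
  [Ring P] [Algebra ℂ P] [StarRing P] [StarModule ℂ P]
  {Γ Ω : Type*} [AddCommGroup Γ] [Module ℂ Γ] [Module G Γ] [Module Gᵐᵒᵖ Γ]
  [IsScalarTower ℂ G Γ] [IsScalarTower ℂ Gᵐᵒᵖ Γ] [SMulCommClass G Gᵐᵒᵖ Γ]
  [Ring Ω] [Algebra ℂ Ω]
  {B : QuantumPrincipalBundle G P} {c : FODC G Γ} {𝒜 : ℕ → Submodule ℂ Ω}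
  [GradedAlgebra 𝒜] (D : BundleCalculus B c 𝒜)

section Covariance

variable (𝒜 c) in
/-- The graded tensor product algebra `Ω ⊗ Γ^∧`. -/
abbrev Target : Type _ := GradedTensorProduct ℂ 𝒜 (grading c)

variable (𝒜 c) in
/-- The map `w ↦ w ⊗ 1`. -/
abbrev inL : Ω →ₐ[ℂ] Target c 𝒜 := GradedTensorProduct.includeLeft 𝒜 (grading c)

variable (𝒜 c) in
/-- The map `ϑ ↦ 1 ⊗ ϑ`. -/
abbrev inR : c.Env →ₐ[ℂ] Target c 𝒜 := GradedTensorProduct.includeRight 𝒜 (grading c)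

variable (𝒜 c) in
theorem inL_mul_inR (w : Ω) (ϑ : c.Env) :
    inL c 𝒜 w * inR c 𝒜 ϑ = GradedTensorProduct.of ℂ 𝒜 (grading c) (w ⊗ₜ ϑ) :=
  GradedTensorProduct.tmul_one_mul_one_tmul 𝒜 (grading c) w ϑ

theorem of_coact (w : Ω) : GradedTensorProduct.of ℂ 𝒜 (grading c) (D.coact w) = D.Ψ w :=
  LinearEquiv.apply_symm_apply _ _

/-- Multiplication of a tensor by `1 ⊗ ϑ` from the right. -/
theorem of_mul_inR (t : Ω ⊗[ℂ] c.Env) (ϑ : c.Env) :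
    GradedTensorProduct.of ℂ 𝒜 (grading c) t * inR c 𝒜 ϑ =
      GradedTensorProduct.of ℂ 𝒜 (grading c)
        ((LinearMap.mulRight ℂ ϑ).lTensor Ω t) := by
  induction t using TensorProduct.induction_on with
  | zero => simp
  | tmul w η => rw [← inL_mul_inR, mul_assoc, ← map_mul, inL_mul_inR]; rfl
  | add t t' ht ht' => simp only [map_add, add_mul, ht, ht']

/-- Multiplication of a tensor by `w ⊗ 1` from the left. -/
theorem inL_mul_of (w : Ω) (t : Ω ⊗[ℂ] c.Env) :
    inL c 𝒜 w * GradedTensorProduct.of ℂ 𝒜 (grading c) t =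
      GradedTensorProduct.of ℂ 𝒜 (grading c)
        ((LinearMap.mulLeft ℂ w).rTensor c.Env t) := by
  induction t using TensorProduct.induction_on with
  | zero => simp
  | tmul z η => rw [← inL_mul_inR, ← mul_assoc, ← map_mul, inL_mul_inR]; rfl
  | add t t' ht ht' => simp only [map_add, mul_add, ht, ht']

theorem inR_mul_inL (f : c.Env →ₗ[ℂ] Ω) (hf : ∀ n, ∀ ϑ ∈ grading c n, f ϑ ∈ 𝒜 n)
    (ϑ η : c.Env) : inR c 𝒜 ϑ * inL c 𝒜 (f η) = GradedTensorProduct.of ℂ 𝒜 (grading c)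
      (f.rTensor c.Env ((gr c).symm (GradedTensorProduct.comm (R := ℂ) (grading c) (grading c)
        (gr c (ϑ ⊗ₜ η))))) := by
  induction ϑ using DirectSum.Decomposition.inductionOn (grading c) with
  | zero => simp only [map_zero, zero_mul, TensorProduct.zero_tmul]
  | add ϑ ϑ' h h' => simp only [map_add, add_mul, TensorProduct.add_tmul, h, h']
  | @homogeneous m ϑ =>
    induction η using DirectSum.Decomposition.inductionOn (grading c) with
    | zero => simp only [map_zero, mul_zero, TensorProduct.tmul_zero]
    | add η η' h h' => simp only [map_add, mul_add, TensorProduct.tmul_add, h, h']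
    | @homogeneous n η =>
      have h1 := of_mul_of 𝒜 (grading c) ϑ.2 (hf n η η.2) 1 1
      have h2 := GradedTensorProduct.comm_coe_tmul_coe (R := ℂ) (grading c) (grading c) ϑ η
      rw [one_mul, mul_one] at h1
      refine h1.trans ?_
      have h3 : GradedTensorProduct.comm (R := ℂ) (grading c) (grading c)
          (gr c ((ϑ : c.Env) ⊗ₜ (η : c.Env))) = (-1 : ℂ) ^ (m * n) •
            gr c ((η : c.Env) ⊗ₜ (ϑ : c.Env)) := by
        refine h2.trans ?_
        rcases Nat.even_or_odd (m * n) with e | e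
        · simp [e.neg_one_pow, mul_comm n m]
        · simp [e.neg_one_pow, mul_comm n m]
      rw [h3, map_smul, map_smul, map_smul]
      rfl

variable [h : Fact c.IsBicovariant]

theorem Ψ_eq_convAct : D.Ψ.toLinearMap =
    convAct D.coact (inL c 𝒜).toLinearMap (toConv (inR c 𝒜).toLinearMap) := by
  have key : ∀ t, GradedTensorProduct.of ℂ 𝒜 (grading c) t = LinearMap.mul' ℂ _
      (TensorProduct.map (inL c 𝒜).toLinearMap (inR c 𝒜).toLinearMap t) := by
    intro t
    induction t using TensorProduct.induction_on with
    | zero => simp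
    | tmul w ϑ => exact (inL_mul_inR c 𝒜 w ϑ).symm
    | add t t' ht ht' => simp only [map_add, ht, ht']
  ext w
  exact (D.of_coact w).symm.trans (key _)

/-- The adjoint coaction is conjugation by the canonical map `ϑ ↦ 1 ⊗ ϑ` in the convolution
algebra of maps `Γ^∧ → Ω ⊗ Γ^∧`. The sign in the definition of the adjoint coaction is the one of
the graded tensor product. -/
theorem adj_eq_conj (f : c.Env →ₗ[ℂ] Ω) (hf : ∀ n, ∀ ϑ ∈ grading c n, f ϑ ∈ 𝒜 n) :
    toConv ((GradedTensorProduct.of ℂ 𝒜 (grading c)).toLinearMap ∘ₗ f.rTensor c.Env ∘ₗ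
      adj h.out) =
    toConv ((inR c 𝒜).toLinearMap ∘ₗ antipode h.out) * toConv ((inL c 𝒜).toLinearMap ∘ₗ f) *
      toConv (inR c 𝒜).toLinearMap := by
  let Y : c.Env ⊗[ℂ] c.Env →ₗ[ℂ] c.Env ⊗[ℂ] c.Env := (gr c).symm.toLinearMap ∘ₗ
      (GradedTensorProduct.comm (R := ℂ) (grading c) (grading c)).toLinearMap ∘ₗ
      (gr c).toLinearMap ∘ₗ (antipode h.out).rTensor c.Env
  have h1 : ∀ a, (toConv ((inR c 𝒜).toLinearMap ∘ₗ antipode h.out) *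
      toConv ((inL c 𝒜).toLinearMap ∘ₗ f)) a =
      GradedTensorProduct.of ℂ 𝒜 (grading c) (f.rTensor c.Env (Y (comulLin h.out a))) := by
    intro a
    have key : ∀ t : c.Env ⊗[ℂ] c.Env, LinearMap.mul' ℂ _
        (TensorProduct.map ((inR c 𝒜).toLinearMap ∘ₗ antipode h.out)
          ((inL c 𝒜).toLinearMap ∘ₗ f) t) =
        GradedTensorProduct.of ℂ 𝒜 (grading c) (f.rTensor c.Env (Y t)) := by
      intro t
      induction t using TensorProduct.induction_on with
      | zero => simp
      | tmul ϑ η => exact inR_mul_inL f hf (antipode h.out ϑ) η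
      | add t t' ht ht' => simp only [map_add, ht, ht']
    exact key _
  have h2 : ∀ (y : c.Env ⊗[ℂ] c.Env) (b : c.Env),
      GradedTensorProduct.of ℂ 𝒜 (grading c) (f.rTensor c.Env
        ((LinearMap.mul' ℂ c.Env).lTensor c.Env (TensorProduct.assoc ℂ _ _ _ (y ⊗ₜ b)))) =
      GradedTensorProduct.of ℂ 𝒜 (grading c) (f.rTensor c.Env y) * inR c 𝒜 b := by
    intro y b
    rw [of_mul_inR]
    congr 1
    induction y using TensorProduct.induction_on with
    | zero => simp
    | tmul ϑ η => simp
    | add t t' ht ht' => simp only [map_add, TensorProduct.add_tmul, ht, ht']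
  have h3 : ∀ t : c.Env ⊗[ℂ] c.Env,
      GradedTensorProduct.of ℂ 𝒜 (grading c) (f.rTensor c.Env
        ((LinearMap.mul' ℂ c.Env).lTensor c.Env (TensorProduct.assoc ℂ _ _ _
          ((Y ∘ₗ comulLin h.out).rTensor c.Env t)))) =
      LinearMap.mul' ℂ _ (TensorProduct.map
        (toConv ((inR c 𝒜).toLinearMap ∘ₗ antipode h.out) *
          toConv ((inL c 𝒜).toLinearMap ∘ₗ f)).ofConv (inR c 𝒜).toLinearMap t) := by
    intro t
    induction t using TensorProduct.induction_on with
    | zero => simp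
    | tmul a b =>
      rw [LinearMap.rTensor_tmul, h2, TensorProduct.map_tmul, LinearMap.mul'_apply, h1]
      rfl
    | add t t' ht ht' => simp only [map_add, ht, ht']
  apply WithConv.ext
  ext ϑ
  exact h3 (comulLin h.out ϑ)

theorem antipode_conv_inR : toConv ((inR c 𝒜).toLinearMap ∘ₗ antipode h.out) *
    toConv (inR c 𝒜).toLinearMap = 1 := by
  have e : toConv (antipode h.out) * toConv (LinearMap.id : c.Env →ₗ[ℂ] c.Env) = 1 := by
    apply WithConv.ext
    ext ϑ
    exact antipode_mul_id h.out ϑ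
  have := LinearMap.algHom_comp_convMul_distrib (R := ℂ) (inR c 𝒜)
    (toConv (antipode h.out)) (toConv (LinearMap.id : c.Env →ₗ[ℂ] c.Env))
  rw [e] at this
  apply WithConv.ext
  refine this.symm.trans ?_
  ext ϑ
  exact (inR c 𝒜).commutes _

theorem inR_conv_antipode : toConv (inR c 𝒜).toLinearMap *
    toConv ((inR c 𝒜).toLinearMap ∘ₗ antipode h.out) = 1 := by
  have e : toConv (LinearMap.id : c.Env →ₗ[ℂ] c.Env) * toConv (antipode h.out) = 1 := by
    apply WithConv.ext
    ext ϑ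
    exact id_mul_antipode h.out ϑ
  have := LinearMap.algHom_comp_convMul_distrib (R := ℂ) (inR c 𝒜)
    (toConv (LinearMap.id : c.Env →ₗ[ℂ] c.Env)) (toConv (antipode h.out))
  rw [e] at this
  apply WithConv.ext
  refine this.symm.trans ?_
  ext ϑ
  exact (inR c 𝒜).commutes _

/-- Composition with an algebra map, as a map between convolution algebras. -/
def push {A A' : Type*} [Ring A] [Algebra ℂ A] [Ring A'] [Algebra ℂ A'] (k : A →ₐ[ℂ] A') :
    WithConv (c.Env →ₗ[ℂ] A) →* WithConv (c.Env →ₗ[ℂ] A') where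
  toFun f := toConv (k.toLinearMap ∘ₗ f.ofConv)
  map_one' := by
    apply WithConv.ext
    ext ϑ
    exact k.commutes _
  map_mul' f g := by
    apply WithConv.ext
    exact LinearMap.algHom_comp_convMul_distrib (R := ℂ) k f g

/-- A graded map is covariant if and only if `Ψ ∘ f` is the conjugate of `f ⊗ 1` by the canonical
map `ϑ ↦ 1 ⊗ ϑ`. -/
theorem covariant_iff (f : c.Env →ₗ[ℂ] Ω) (hf : ∀ n, ∀ ϑ ∈ grading c n, f ϑ ∈ 𝒜 n) :
    (∀ ϑ, f.rTensor c.Env (adj h.out ϑ) = D.coact (f ϑ)) ↔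
    push D.Ψ (toConv f) = toConv ((inR c 𝒜).toLinearMap ∘ₗ antipode h.out) *
      push (inL c 𝒜) (toConv f) * toConv (inR c 𝒜).toLinearMap := by
  have := adj_eq_conj (h := h) f hf
  change _ ↔ _ = toConv ((inR c 𝒜).toLinearMap ∘ₗ antipode h.out) *
    toConv ((inL c 𝒜).toLinearMap ∘ₗ f) * toConv (inR c 𝒜).toLinearMap
  rw [← this]
  constructor
  · intro e
    apply WithConv.ext
    ext ϑ
    have := congrArg (GradedTensorProduct.of ℂ 𝒜 (grading c)) (e ϑ)
    rw [of_coact] at this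
    exact this.symm
  · intro e ϑ
    apply (GradedTensorProduct.of ℂ 𝒜 (grading c)).injective
    rw [of_coact]
    exact (congrArg (fun k => k.ofConv ϑ) e).symm

theorem conv_eq (f g : c.Env →ₗ[ℂ] Ω) :
    toConv (D.conv h.out f g) = toConv f * toConv g := rfl

theorem convUnit_eq : toConv D.convUnit = (1 : WithConv (c.Env →ₗ[ℂ] Ω)) := rfl

theorem conv_mem {f g : c.Env →ₗ[ℂ] Ω} (hf : ∀ n, ∀ ϑ ∈ grading c n, f ϑ ∈ 𝒜 n)
    (hg : ∀ n, ∀ ϑ ∈ grading c n, g ϑ ∈ 𝒜 n) (n : ℕ) (ϑ : c.Env) (hϑ : ϑ ∈ grading c n) :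
    D.conv h.out f g ϑ ∈ 𝒜 n := by
  refine (totalDegree_le (S := (𝒜 n).comap (LinearMap.mul' ℂ Ω ∘ₗ TensorProduct.map f g))
    fun i j hij a ha b hb => ?_) (comulLin_mem h.out hϑ)
  subst hij
  exact SetLike.mul_mem_graded (hf _ a ha) (hg _ b hb)

theorem convUnit_mem (n : ℕ) (ϑ : c.Env) (hϑ : ϑ ∈ grading c n) :
    D.convUnit ϑ ∈ 𝒜 n := by
  change algebraMap ℂ Ω (FODC.Env.counit c ϑ) ∈ 𝒜 n
  rcases n with _ | n
  · exact SetLike.algebraMap_mem_graded 𝒜 _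
  · rw [counit_eq_zero hϑ n.succ_ne_zero, map_zero]
    exact zero_mem _

theorem conv_apply_one (f g : c.Env →ₗ[ℂ] Ω) : D.conv h.out f g 1 = f 1 * g 1 := by
  change LinearMap.mul' ℂ Ω (TensorProduct.map f g (comulLin h.out 1)) = _
  rw [show comulLin h.out (1 : c.Env) = 1 ⊗ₜ 1 from (isDiffCoaction_comul h.out).lin_one]
  simp

theorem convUnit_one : D.convUnit 1 = 1 := by
  change algebraMap ℂ Ω (FODC.Env.counit c 1) = 1
  simp

theorem isGaugeMap_conv {f g : c.Env →ₗ[ℂ] Ω} (hf : D.IsGaugeMap h.out f)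
    (hg : D.IsGaugeMap h.out g) : D.IsGaugeMap h.out (D.conv h.out f g) where
  mem := D.conv_mem hf.mem hg.mem
  map_one := by rw [conv_apply_one, hf.map_one, hg.map_one, mul_one]
  covariant := by
    rw [covariant_iff D _ (D.conv_mem hf.mem hg.mem), conv_eq, map_mul, map_mul,
      (covariant_iff D _ hf.mem).mp hf.covariant, (covariant_iff D _ hg.mem).mp hg.covariant]
    generalize push (inL c 𝒜) (toConv f) = a
    generalize push (inL c 𝒜) (toConv g) = b
    have e := inR_conv_antipode (h := h) (𝒜 := 𝒜)
    generalize toConv (inR c 𝒜).toLinearMap = i at *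
    generalize toConv ((inR c 𝒜).toLinearMap ∘ₗ antipode h.out) = k at *
    calc k * a * i * (k * b * i) = k * a * (i * k) * b * i := by simp only [mul_assoc]
      _ = _ := by rw [e]; simp only [mul_assoc, one_mul]
  invertible := by
    obtain ⟨f', hf', e1, e2⟩ := hf.invertible
    obtain ⟨g', hg', e3, e4⟩ := hg.invertible
    refine ⟨D.conv h.out g' f', D.conv_mem hg' hf', ?_, ?_⟩ <;>
    apply toConv_injective <;>
    rw [← toConv_injective.eq_iff, conv_eq, convUnit_eq] at e1 e2 e3 e4 <;>
    rw [conv_eq, conv_eq, conv_eq, convUnit_eq]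
    · calc toConv f * toConv g * (toConv g' * toConv f') =
          toConv f * (toConv g * toConv g') * toConv f' := by simp only [mul_assoc]
        _ = 1 := by rw [e3, mul_one, e1]
    · calc toConv g' * toConv f' * (toConv f * toConv g) =
          toConv g' * (toConv f' * toConv f) * toConv g := by simp only [mul_assoc]
        _ = 1 := by rw [e2, mul_one, e4]

theorem isGaugeMap_convUnit : D.IsGaugeMap h.out D.convUnit where
  mem := D.convUnit_mem
  map_one := D.convUnit_one
  covariant := by
    rw [covariant_iff D _ D.convUnit_mem, convUnit_eq, _root_.map_one, _root_.map_one, mul_one,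
      antipode_conv_inR]
  invertible := ⟨D.convUnit, D.convUnit_mem, toConv_injective (mul_one _),
    toConv_injective (mul_one _)⟩

/-- The convolution inverse of a covariant map is covariant, because conjugation is
multiplicative. -/
theorem isGaugeMap_of_inverse {f g : c.Env →ₗ[ℂ] Ω} (hf : D.IsGaugeMap h.out f)
    (hg : ∀ n, ∀ ϑ ∈ grading c n, g ϑ ∈ 𝒜 n) (e1 : D.conv h.out f g = D.convUnit)
    (e2 : D.conv h.out g f = D.convUnit) : D.IsGaugeMap h.out g where
  mem := hg
  map_one := by
    have := LinearMap.congr_fun e1 1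
    rwa [conv_apply_one, hf.map_one, one_mul, convUnit_one] at this
  covariant := by
    rw [covariant_iff D _ hg]
    have hcov := (covariant_iff D _ hf.mem).mp hf.covariant
    rw [← toConv_injective.eq_iff, conv_eq, convUnit_eq] at e1 e2
    have a1 : push D.Ψ (toConv g) * push D.Ψ (toConv f) = 1 := by rw [← map_mul, e2, _root_.map_one]
    have a2 : push (inL c 𝒜) (toConv f) * push (inL c 𝒜) (toConv g) = 1 := by
      rw [← map_mul, e1, _root_.map_one]
    refine left_inv_eq_right_inv a1 ?_
    rw [hcov]
    have e := inR_conv_antipode (h := h) (𝒜 := 𝒜)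
    have e' := antipode_conv_inR (h := h) (𝒜 := 𝒜)
    generalize push (inL c 𝒜) (toConv f) = a at *
    generalize push (inL c 𝒜) (toConv g) = b at *
    generalize toConv (inR c 𝒜).toLinearMap = i at *
    generalize toConv ((inR c 𝒜).toLinearMap ∘ₗ antipode h.out) = k at *
    calc k * a * i * (k * b * i) = k * a * (i * k) * b * i := by simp only [mul_assoc]
      _ = k * (a * b) * i := by rw [e]; simp only [mul_assoc, one_mul]
      _ = 1 := by rw [a2, mul_one, e']
  invertible := ⟨f, hf.mem, e2, e1⟩

/-- The group of convolution-invertible maps. -/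
@[reducible] def gaugeMapGroup : Group (D.GaugeMap h.out) :=
  letI : Mul (D.GaugeMap h.out) := ⟨fun f g => ⟨_, D.isGaugeMap_conv f.2 g.2⟩⟩
  letI : One (D.GaugeMap h.out) := ⟨⟨_, D.isGaugeMap_convUnit⟩⟩
  letI : Inv (D.GaugeMap h.out) := ⟨fun f => ⟨f.2.invertible.choose,
    D.isGaugeMap_of_inverse f.2 f.2.invertible.choose_spec.1 f.2.invertible.choose_spec.2.1
      f.2.invertible.choose_spec.2.2⟩⟩
  Group.ofLeftAxioms
    (fun a b c => Subtype.ext (toConv_injective (mul_assoc (toConv a.1) (toConv b.1) (toConv c.1))))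
    (fun a => Subtype.ext (toConv_injective (one_mul (toConv a.1))))
    (fun a => Subtype.ext a.2.invertible.choose_spec.2.2)

end Covariance

end BundleCalculus

/-! ### Gauge automorphisms and convolution-invertible maps -/

namespace BundleCalculus

open FODC.Env WithConv

variable {G P : Type*} [Ring G] [HopfAlgebra ℂ G] [StarRing G] [StarModule ℂ G]
  [Ring P] [Algebra ℂ P] [StarRing P] [StarModule ℂ P]
  {Γ Ω : Type*} [AddCommGroup Γ] [Module ℂ Γ] [Module G Γ] [Module Gᵐᵒᵖ Γ]
  [IsScalarTower ℂ G Γ] [IsScalarTower ℂ Gᵐᵒᵖ Γ] [SMulCommClass G Gᵐᵒᵖ Γ]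
  [Ring Ω] [Algebra ℂ Ω]
  {B : QuantumPrincipalBundle G P} {c : FODC G Γ} {𝒜 : ℕ → Submodule ℂ Ω}
  [GradedAlgebra 𝒜] (D : BundleCalculus B c 𝒜)

/-- The class of `w ⊗ z` in `Ω ⊗_{Ω(M)} Ω`. -/
abbrev bmk : Ω ⊗[ℂ] Ω →ₗ[ℂ] D.BalancedTensor := D.balancedRel.mkQ

theorem bmk_surjective : Function.Surjective D.bmk := D.balancedRel.mkQ_surjective

theorem bmk_mul (w z μ : Ω) (hμ : μ ∈ D.baseForms) :
    D.bmk ((w * μ) ⊗ₜ z) = D.bmk (w ⊗ₜ (μ * z)) := by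
  rw [← sub_eq_zero, ← map_sub]
  exact (Submodule.Quotient.mk_eq_zero _).mpr (Submodule.subset_span ⟨w, z, μ, hμ, rfl⟩)

@[elab_as_elim]
theorem bmk_induction {p : D.BalancedTensor → Prop} (tmul : ∀ w z, p (D.bmk (w ⊗ₜ z)))
    (add : ∀ x y, p x → p y → p (x + y)) (t : D.BalancedTensor) : p t := by
  obtain ⟨y, rfl⟩ := D.bmk_surjective t
  induction y using TensorProduct.induction_on with
  | zero => simpa using tmul 0 0
  | tmul w z => exact tmul w z
  | add x y hx hy => rw [map_add]; exact add _ _ hx hy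

/-- Two linear maps on `Ω ⊗_{Ω(M)} Ω` agree if they agree on the classes of the `w ⊗ z`. -/
theorem balanced_ext {N : Type*} [AddCommGroup N] [Module ℂ N] {S T : D.BalancedTensor →ₗ[ℂ] N}
    (h : ∀ w z, S (D.bmk (w ⊗ₜ z)) = T (D.bmk (w ⊗ₜ z))) : S = T := by
  ext t
  exact h _ _

/-- A linear map on `Ω ⊗ Ω` that respects the relations induces one on `Ω ⊗_{Ω(M)} Ω`. -/
def blift {N : Type*} [AddCommGroup N] [Module ℂ N] (S : Ω ⊗[ℂ] Ω →ₗ[ℂ] N)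
    (h : ∀ w z, ∀ μ ∈ D.baseForms, S ((w * μ) ⊗ₜ z) = S (w ⊗ₜ (μ * z))) :
    D.BalancedTensor →ₗ[ℂ] N :=
  D.balancedRel.liftQ S (Submodule.span_le.mpr (by
    rintro _ ⟨w, z, μ, hμ, rfl⟩
    simp [h w z μ hμ]))

/-- Left multiplication by `w` on `Ω ⊗_{Ω(M)} Ω`. -/
def leftMul (w : Ω) : Module.End ℂ D.BalancedTensor :=
  D.blift (D.bmk ∘ₗ (LinearMap.mulLeft ℂ w).rTensor Ω) (fun x z μ hμ => by
    simp only [LinearMap.comp_apply, LinearMap.rTensor_tmul, LinearMap.mulLeft_apply]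
    rw [← mul_assoc, D.bmk_mul _ _ _ hμ])

theorem leftMul_bmk (w x z : Ω) : D.leftMul w (D.bmk (x ⊗ₜ z)) = D.bmk ((w * x) ⊗ₜ z) := rfl

theorem canonical_bmk (w z : Ω) : D.canonical (D.bmk (w ⊗ₜ z)) =
    (LinearMap.mulLeft ℂ w).rTensor c.Env (D.coact z) := by
  apply (GradedTensorProduct.of ℂ 𝒜 (grading c)).injective
  rw [← inL_mul_of, of_coact]
  exact LinearEquiv.apply_symm_apply _ _

theorem canonical_leftMul (w : Ω) (t : D.BalancedTensor) :
    D.canonical (D.leftMul w t) = (LinearMap.mulLeft ℂ w).rTensor c.Env (D.canonical t) := by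
  induction t using D.bmk_induction with
  | tmul x z =>
    rw [leftMul_bmk, canonical_bmk, canonical_bmk, LinearMap.mulLeft_mul, LinearMap.rTensor_comp]
    rfl
  | add x y hx hy => simp only [map_add, hx, hy]

theorem mulMap_leftMul (F : Ω →ₗ[ℂ] Ω) (hF : ∀ μ ∈ D.baseForms, ∀ w, F (μ * w) = μ * F w)
    (w : Ω) (t : D.BalancedTensor) :
    D.mulMap F hF (D.leftMul w t) = w * D.mulMap F hF t := by
  induction t using D.bmk_induction with
  | tmul x z =>
    change LinearMap.mul' ℂ Ω (TensorProduct.map LinearMap.id F ((w * x) ⊗ₜ z)) =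
      w * LinearMap.mul' ℂ Ω (TensorProduct.map LinearMap.id F (x ⊗ₜ z))
    simp [mul_assoc]
  | add x y hx hy => simp only [map_add, mul_add, hx, hy]

theorem canonical_qtrs (hβ : Function.Bijective D.canonical) (ϑ : c.Env) :
    D.canonical (D.qtrs hβ ϑ) = 1 ⊗ₜ ϑ :=
  (LinearEquiv.ofBijective D.canonical hβ).apply_symm_apply _

theorem coact_base_mul (μ : Ω) (hμ : μ ∈ D.baseForms) (w : Ω) :
    D.coact (μ * w) = (LinearMap.mulLeft ℂ μ).rTensor c.Env (D.coact w) := by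
  apply (GradedTensorProduct.of ℂ 𝒜 (grading c)).injective
  have h : D.Ψ μ = inL c 𝒜 μ := hμ
  rw [← inL_mul_of, of_coact, of_coact, map_mul, h]

section Gauge

/-- The map `F_f = m ∘ (id ⊗ f) ∘ Ψ`. -/
def translate (f : c.Env →ₗ[ℂ] Ω) : Ω →ₗ[ℂ] Ω :=
  convAct D.coact LinearMap.id (toConv f)

/-- The map `f_F = m ∘ (id ⊗ F) ∘ qtrs`. -/
def cotranslate (hβ : Function.Bijective D.canonical) (F : Ω →ₗ[ℂ] Ω)
    (hF : ∀ μ ∈ D.baseForms, ∀ w, F (μ * w) = μ * F w) : c.Env →ₗ[ℂ] Ω :=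
  D.mulMap F hF ∘ₗ D.qtrs hβ

theorem translate_cotranslate (hβ : Function.Bijective D.canonical) (F : Ω →ₗ[ℂ] Ω)
    (hF : ∀ μ ∈ D.baseForms, ∀ w, F (μ * w) = μ * F w) :
    D.translate (D.cotranslate hβ F hF) = F := by
  have key : ∀ t : Ω ⊗[ℂ] c.Env, LinearMap.mul' ℂ Ω (TensorProduct.map LinearMap.id
      (D.cotranslate hβ F hF) t) =
      D.mulMap F hF ((LinearEquiv.ofBijective D.canonical hβ).symm t) := by
    intro t
    induction t using TensorProduct.induction_on with
    | zero => simp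
    | tmul w ϑ =>
      have : (LinearEquiv.ofBijective D.canonical hβ).symm (w ⊗ₜ ϑ) =
          D.leftMul w (D.qtrs hβ ϑ) := by
        rw [LinearEquiv.symm_apply_eq, LinearEquiv.ofBijective_apply, canonical_leftMul,
          canonical_qtrs]
        simp
      rw [this, mulMap_leftMul]
      rfl
    | add t t' ht ht' => simp only [map_add, ht, ht']
  ext w
  refine (key _).trans ?_
  have : (LinearEquiv.ofBijective D.canonical hβ).symm (D.coact w) = D.bmk (1 ⊗ₜ w) := by
    rw [LinearEquiv.symm_apply_eq, LinearEquiv.ofBijective_apply, canonical_bmk]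
    simp
  rw [this]
  change LinearMap.mul' ℂ Ω (TensorProduct.map LinearMap.id F (1 ⊗ₜ w)) = F w
  simp

/-- A map `k` on `Γ^∧` is determined by `w ↦ j(w⁽⁰⁾) k(w⁽¹⁾)`, because the canonical map is
surjective. -/
theorem convAct_cancel (hβ : Function.Surjective D.canonical) {A : Type*} [Ring A] [Algebra ℂ A]
    (j : Ω →ₐ[ℂ] A) {k k' : WithConv (c.Env →ₗ[ℂ] A)}
    (hk : convAct D.coact j.toLinearMap k = convAct D.coact j.toLinearMap k') : k = k' := by
  have key : ∀ (k : WithConv (c.Env →ₗ[ℂ] A)) (y : Ω ⊗[ℂ] Ω),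
      LinearMap.mul' ℂ A (TensorProduct.map j.toLinearMap k.ofConv (D.canonical (D.bmk y))) =
      LinearMap.mul' ℂ A (TensorProduct.map j.toLinearMap
        (convAct D.coact j.toLinearMap k) y) := by
    intro k y
    induction y using TensorProduct.induction_on with
    | zero => simp
    | add y y' hy hy' => simp only [map_add, hy, hy']
    | tmul w z =>
      have : ∀ t : Ω ⊗[ℂ] c.Env, LinearMap.mul' ℂ A (TensorProduct.map j.toLinearMap k.ofConv
          ((LinearMap.mulLeft ℂ w).rTensor c.Env t)) =
          j w * LinearMap.mul' ℂ A (TensorProduct.map j.toLinearMap k.ofConv t) := by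
        intro t
        induction t using TensorProduct.induction_on with
        | zero => simp
        | tmul x ϑ => simp [mul_assoc]
        | add t t' ht ht' => simp only [map_add, mul_add, ht, ht']
      rw [canonical_bmk, this]
      rfl
  apply WithConv.ext
  ext ϑ
  obtain ⟨t, ht⟩ := hβ (1 ⊗ₜ ϑ)
  obtain ⟨y, rfl⟩ := D.bmk_surjective t
  have e := (key k y).trans ((congrArg (fun ψ => LinearMap.mul' ℂ A
    (TensorProduct.map j.toLinearMap ψ y)) hk).trans (key k' y).symm)
  rw [ht] at e
  simpa using e

theorem mulMap_mem (F : Ω →ₗ[ℂ] Ω) (hF : ∀ μ ∈ D.baseForms, ∀ w, F (μ * w) = μ * F w)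
    (hmem : ∀ n, ∀ w ∈ 𝒜 n, F w ∈ 𝒜 n) {n : ℕ} {t : D.BalancedTensor}
    (ht : t ∈ (totalDegree 𝒜 𝒜 n).map D.bmk) : D.mulMap F hF t ∈ 𝒜 n := by
  obtain ⟨y, hy, rfl⟩ := ht
  refine (totalDegree_le (S := (𝒜 n).comap (LinearMap.mul' ℂ Ω ∘ₗ
    TensorProduct.map LinearMap.id F)) fun i j hij a ha b hb => ?_) hy
  subst hij
  exact SetLike.mul_mem_graded ha (hmem _ b hb)

theorem translate_comp (f : c.Env →ₗ[ℂ] Ω) (F : Ω →ₗ[ℂ] Ω)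
    (hF : ∀ w, F.rTensor c.Env (D.coact w) = D.coact (F w)) :
    D.translate f ∘ₗ F = convAct D.coact F (toConv f) := by
  ext w
  change LinearMap.mul' ℂ Ω (TensorProduct.map LinearMap.id f (D.coact (F w))) =
    LinearMap.mul' ℂ Ω (TensorProduct.map F f (D.coact w))
  rw [← hF, ← LinearMap.comp_apply (TensorProduct.map _ _), LinearMap.map_comp_rTensor]
  rfl

variable [h : Fact c.IsBicovariant]

theorem translate_comp_translate (f g : c.Env →ₗ[ℂ] Ω)
    (hg : ∀ w, (D.translate g).rTensor c.Env (D.coact w) = D.coact (D.translate g w)) :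
    D.translate f ∘ₗ D.translate g = D.translate (D.conv h.out g f) := by
  rw [translate_comp D f _ hg]
  exact convAct_convAct (D.coact_coassoc h.out) _ _ _

theorem translate_convUnit : D.translate D.convUnit = LinearMap.id :=
  convAct_one D.coact_counit _

/-- `F ⊗ id` composed with the coaction, in the convolution calculus. -/
theorem of_rTensor_coact (F : Ω →ₗ[ℂ] Ω) :
    (GradedTensorProduct.of ℂ 𝒜 (grading c)).toLinearMap ∘ₗ F.rTensor c.Env ∘ₗ D.coact =
      convAct D.coact ((inL c 𝒜).toLinearMap ∘ₗ F) (toConv (inR c 𝒜).toLinearMap) := by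
  have key : ∀ t, GradedTensorProduct.of ℂ 𝒜 (grading c) (F.rTensor c.Env t) =
      LinearMap.mul' ℂ _ (TensorProduct.map ((inL c 𝒜).toLinearMap ∘ₗ F)
        (inR c 𝒜).toLinearMap t) := by
    intro t
    induction t using TensorProduct.induction_on with
    | zero => simp
    | tmul w ϑ => exact (inL_mul_inR c 𝒜 (F w) ϑ).symm
    | add t t' ht ht' => simp only [map_add, ht, ht']
  ext w
  exact key _

/-- The map `F_f` commutes with the coaction if and only if `Ψ ∘ f` is intertwined with `f ⊗ 1`
by the canonical map `ϑ ↦ 1 ⊗ ϑ`. -/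
theorem translate_colinear_iff (f : c.Env →ₗ[ℂ] Ω) :
    (∀ w, (D.translate f).rTensor c.Env (D.coact w) = D.coact (D.translate f w)) ↔
    convAct D.coact (inL c 𝒜).toLinearMap
      (push (inL c 𝒜) (toConv f) * toConv (inR c 𝒜).toLinearMap) =
    convAct D.coact (inL c 𝒜).toLinearMap
      (toConv (inR c 𝒜).toLinearMap * push D.Ψ (toConv f)) := by
  have e1 : D.Ψ.toLinearMap ∘ₗ D.translate f = convAct D.coact (inL c 𝒜).toLinearMap
      (toConv (inR c 𝒜).toLinearMap * push D.Ψ (toConv f)) := by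
    rw [← convAct_convAct (D.coact_coassoc h.out), ← Ψ_eq_convAct]
    exact algHom_comp_convAct _ _ _
  have e2 : (GradedTensorProduct.of ℂ 𝒜 (grading c)).toLinearMap ∘ₗ
      (D.translate f).rTensor c.Env ∘ₗ D.coact = convAct D.coact (inL c 𝒜).toLinearMap
      (push (inL c 𝒜) (toConv f) * toConv (inR c 𝒜).toLinearMap) := by
    rw [of_rTensor_coact, ← convAct_convAct (D.coact_coassoc h.out)]
    congr 1
    exact algHom_comp_convAct _ _ _
  rw [← e1, ← e2]
  constructor
  · intro e
    ext w
    have := congrArg (GradedTensorProduct.of ℂ 𝒜 (grading c)) (e w)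
    rw [of_coact] at this
    exact this
  · intro e w
    apply (GradedTensorProduct.of ℂ 𝒜 (grading c)).injective
    rw [of_coact]
    exact LinearMap.congr_fun e w

theorem translate_colinear {f : c.Env →ₗ[ℂ] Ω} (hf : D.IsGaugeMap h.out f) (w : Ω) :
    (D.translate f).rTensor c.Env (D.coact w) = D.coact (D.translate f w) := by
  refine (D.translate_colinear_iff f).mpr ?_ w
  rw [(covariant_iff D _ hf.mem).mp hf.covariant, ← mul_assoc, ← mul_assoc, inR_conv_antipode,
    one_mul]

theorem isGaugeAut_translate {f : c.Env →ₗ[ℂ] Ω} (hf : D.IsGaugeMap h.out f) :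
    D.IsGaugeAut (D.translate f) where
  mem := fun n w hw => by
    refine (totalDegree_le (S := (𝒜 n).comap (LinearMap.mul' ℂ Ω ∘ₗ
      TensorProduct.map LinearMap.id f)) fun i j hij a ha b hb => ?_) (D.Ψ_mem n w hw)
    subst hij
    exact SetLike.mul_mem_graded ha (hf.mem _ b hb)
  map_base_mul := fun μ hμ w => by
    change LinearMap.mul' ℂ Ω (TensorProduct.map LinearMap.id f (D.coact (μ * w))) =
      μ * LinearMap.mul' ℂ Ω (TensorProduct.map LinearMap.id f (D.coact w))
    rw [D.coact_base_mul μ hμ]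
    generalize D.coact w = t
    induction t using TensorProduct.induction_on with
    | zero => simp
    | tmul x ϑ => simp [mul_assoc]
    | add t t' ht ht' => simp only [map_add, mul_add, ht, ht']
  map_one := by
    change LinearMap.mul' ℂ Ω (TensorProduct.map LinearMap.id f (D.coact 1)) = 1
    rw [coact_one]
    simp [hf.map_one]
  coact := D.translate_colinear hf

/-- The automorphism `F_f`, with inverse `F_g` for the convolution inverse `g` of `f`. -/
def translateEquiv {f : c.Env →ₗ[ℂ] Ω} (hf : D.IsGaugeMap h.out f) : Ω ≃ₗ[ℂ] Ω :=
  LinearEquiv.ofLinearMap (D.translate f) (D.translate hf.invertible.choose)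
    (by
      obtain ⟨hg, e1, e2⟩ := hf.invertible.choose_spec
      rw [translate_comp_translate D _ _
        (D.translate_colinear (D.isGaugeMap_of_inverse hf hg e1 e2)), e2, translate_convUnit])
    (by
      obtain ⟨hg, e1, e2⟩ := hf.invertible.choose_spec
      rw [translate_comp_translate D _ _ (D.translate_colinear hf), e1, translate_convUnit])

variable (hβ : Function.Bijective D.canonical)
  (hτ : ∀ n, ∀ ϑ ∈ grading c n, D.qtrs hβ ϑ ∈ (totalDegree 𝒜 𝒜 n).map D.bmk)

include hβ in
theorem translate_injective {f g : c.Env →ₗ[ℂ] Ω} (e : D.translate f = D.translate g) : f = g :=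
  toConv_injective (D.convAct_cancel hβ.surjective (AlgHom.id ℂ Ω) e)

theorem cotranslate_conv (F F' : D.gaugeAut) :
    D.cotranslate hβ (F' * F).1.toLinearMap (F' * F).2.map_base_mul =
      D.conv h.out (D.cotranslate hβ F.1.toLinearMap F.2.map_base_mul)
        (D.cotranslate hβ F'.1.toLinearMap F'.2.map_base_mul) := by
  apply D.translate_injective hβ
  rw [translate_cotranslate, ← translate_comp_translate, translate_cotranslate,
    translate_cotranslate]
  · rfl
  · rw [translate_cotranslate]
    exact F.2.coact

theorem cotranslate_one :
    D.cotranslate hβ (1 : D.gaugeAut).1.toLinearMap (1 : D.gaugeAut).2.map_base_mul =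
      D.convUnit := by
  apply D.translate_injective hβ
  rw [translate_cotranslate, translate_convUnit]
  rfl

include hτ in
theorem cotranslate_mem (F : D.gaugeAut) (n : ℕ) (ϑ : c.Env) (hϑ : ϑ ∈ grading c n) :
    D.cotranslate hβ F.1.toLinearMap F.2.map_base_mul ϑ ∈ 𝒜 n :=
  D.mulMap_mem _ F.2.map_base_mul F.2.mem (hτ n ϑ hϑ)

include hτ in
theorem isGaugeMap_cotranslate (F : D.gaugeAut) :
    D.IsGaugeMap h.out (D.cotranslate hβ F.1.toLinearMap F.2.map_base_mul) where
  mem := D.cotranslate_mem hβ hτ F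
  map_one := by
    have : D.qtrs hβ 1 = D.bmk (1 ⊗ₜ 1) := by
      apply hβ.injective
      rw [canonical_qtrs, canonical_bmk, coact_one]
      simp
    change D.mulMap F.1.toLinearMap F.2.map_base_mul (D.qtrs hβ 1) = 1
    rw [this]
    change LinearMap.mul' ℂ Ω (TensorProduct.map LinearMap.id F.1.toLinearMap (1 ⊗ₜ 1)) = 1
    have h1 := F.2.map_one
    simpa using h1
  covariant := by
    rw [covariant_iff D _ (D.cotranslate_mem hβ hτ F), mul_assoc,
      D.convAct_cancel hβ.surjective _ ((D.translate_colinear_iff _).mp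
        (by rw [translate_cotranslate]; exact F.2.coact)), ← mul_assoc, antipode_conv_inR, one_mul]
  invertible := ⟨D.cotranslate hβ (F⁻¹).1.toLinearMap (F⁻¹).2.map_base_mul,
    D.cotranslate_mem hβ hτ F⁻¹, by
      rw [← cotranslate_conv, ← D.cotranslate_one hβ]
      simp only [inv_mul_cancel], by
      rw [← cotranslate_conv, ← D.cotranslate_one hβ]
      simp only [mul_inv_cancel]⟩

/-- The bijection between automorphisms and convolution-invertible maps. -/
def gaugeEquiv : (D.gaugeAut)ᵐᵒᵖ ≃ D.GaugeMap h.out where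
  toFun F := ⟨_, D.isGaugeMap_cotranslate hβ hτ F.unop⟩
  invFun f := op ⟨D.translateEquiv f.2, D.isGaugeAut_translate f.2⟩
  left_inv F := by
    apply MulOpposite.unop_injective
    apply Subtype.ext
    apply LinearEquiv.toLinearMap_injective
    exact D.translate_cotranslate hβ _ _
  right_inv f := by
    apply Subtype.ext
    apply D.translate_injective hβ
    exact D.translate_cotranslate hβ _ _

end Gauge

end BundleCalculus

/-! ### Cosemisimplicity -/

section Cosemisimple

open WithConv

/-- A right coaction of a coalgebra `G` on a vector space `V`. -/
structure Coaction (G V : Type*) [AddCommGroup G] [Module ℂ G] [Coalgebra ℂ G]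
    [AddCommGroup V] [Module ℂ V] where
  map : V →ₗ[ℂ] V ⊗[ℂ] G
  coassoc : ∀ v, Coalgebra.comul.lTensor V (map v) =
    TensorProduct.assoc ℂ V G G (map.rTensor G (map v))
  counit : ∀ v, TensorProduct.rid ℂ V (Coalgebra.counit.lTensor V (map v)) = v

/-- The dual algebra of the coalgebra `G`, with the convolution product. -/
abbrev DualAlgebra (G : Type*) [AddCommGroup G] [Module ℂ G] [Coalgebra ℂ G] : Type _ :=
  WithConv (G →ₗ[ℂ] ℂ)

/-- Evaluation of the second factor of a tensor product at a functional. -/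
def evalRight {G V : Type*} [AddCommGroup G] [Module ℂ G] [AddCommGroup V] [Module ℂ V]
    (f : G →ₗ[ℂ] ℂ) : V ⊗[ℂ] G →ₗ[ℂ] V :=
  (TensorProduct.rid ℂ V).toLinearMap ∘ₗ f.lTensor V

section Eval

variable {G V W : Type*} [AddCommGroup G] [Module ℂ G] [AddCommGroup V] [Module ℂ V]
  [AddCommGroup W] [Module ℂ W]

@[simp] theorem evalRight_tmul (f : G →ₗ[ℂ] ℂ) (v : V) (g : G) :
    evalRight f (v ⊗ₜ g) = f g • v := by
  simp [evalRight]

theorem evalRight_rTensor (f : G →ₗ[ℂ] ℂ) (T : V →ₗ[ℂ] W) (t : V ⊗[ℂ] G) :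
    evalRight f (T.rTensor G t) = T (evalRight f t) := by
  induction t using TensorProduct.induction_on with
  | zero => simp
  | tmul v g => simp
  | add t t' ht ht' => simp only [map_add, ht, ht']

theorem eq_zero_of_evalRight {t : V ⊗[ℂ] G} (h : ∀ f : G →ₗ[ℂ] ℂ, evalRight f t = 0) : t = 0 := by
  let b := Module.Free.chooseBasis ℂ G
  have key : ∀ (t : V ⊗[ℂ] G) i, TensorProduct.equivFinsuppOfBasisRight b t i =
      evalRight (b.coord i) t := by
    intro t i
    induction t using TensorProduct.induction_on with
    | zero => simp
    | tmul v g => simp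
    | add t t' ht ht' => simp only [map_add, Finsupp.add_apply, ht, ht']
  apply (TensorProduct.equivFinsuppOfBasisRight b).injective
  ext i
  rw [key, h, map_zero]
  rfl

theorem eq_of_evalRight {t t' : V ⊗[ℂ] G}
    (h : ∀ f : G →ₗ[ℂ] ℂ, evalRight f t = evalRight f t') : t = t' :=
  sub_eq_zero.mp (eq_zero_of_evalRight fun f => by rw [map_sub, h, sub_self])

end Eval

namespace Coaction

variable {G V W : Type*} [AddCommGroup G] [Module ℂ G] [Coalgebra ℂ G]
  [AddCommGroup V] [Module ℂ V] [AddCommGroup W] [Module ℂ W]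

/-- The vector space of a comodule, as a module over the dual algebra. -/
def Carrier (_ρ : Coaction G V) : Type _ := V

variable (ρ : Coaction G V) (ρ' : Coaction G W)

instance : AddCommGroup ρ.Carrier := inferInstanceAs (AddCommGroup V)
instance : Module ℂ ρ.Carrier := inferInstanceAs (Module ℂ V)

/-- The action `f • v = v⁽⁰⁾ f(v⁽¹⁾)` of the dual algebra. -/
def act (f : DualAlgebra G) : V →ₗ[ℂ] V := evalRight f.ofConv ∘ₗ ρ.map

theorem act_one (v : V) : ρ.act 1 v = v := by
  conv_rhs => rw [← ρ.counit v]
  rfl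

theorem act_mul (f g : DualAlgebra G) (v : V) : ρ.act (f * g) v = ρ.act f (ρ.act g v) := by
  have h1 : ∀ t : V ⊗[ℂ] G, ρ.act f (evalRight g.ofConv t) =
      evalRight f.ofConv (evalRight g.ofConv (ρ.map.rTensor G t)) := by
    intro t
    rw [evalRight_rTensor]
    rfl
  have h2 : ∀ t : (V ⊗[ℂ] G) ⊗[ℂ] G, evalRight f.ofConv (evalRight g.ofConv t) =
      evalRight (LinearMap.mul' ℂ ℂ ∘ₗ TensorProduct.map f.ofConv g.ofConv)
        (TensorProduct.assoc ℂ V G G t) := by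
    intro t
    refine LinearMap.congr_fun (f := evalRight f.ofConv ∘ₗ evalRight g.ofConv)
      (g := evalRight (LinearMap.mul' ℂ ℂ ∘ₗ TensorProduct.map f.ofConv g.ofConv) ∘ₗ
        (TensorProduct.assoc ℂ V G G).toLinearMap) ?_ t
    ext v a b
    simp [smul_smul, mul_comm]
  have h3 : ∀ t : V ⊗[ℂ] G, evalRight (LinearMap.mul' ℂ ℂ ∘ₗ TensorProduct.map f.ofConv g.ofConv)
      (Coalgebra.comul.lTensor V t) = evalRight (f * g).ofConv t := by
    intro t
    induction t using TensorProduct.induction_on with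
    | zero => simp
    | tmul v a => simp [LinearMap.convMul_def]
    | add t t' ht ht' => simp only [map_add, ht, ht']
  change evalRight (f * g).ofConv (ρ.map v) = ρ.act f (evalRight g.ofConv (ρ.map v))
  rw [h1, h2, ← ρ.coassoc, h3]

instance : Module (DualAlgebra G) ρ.Carrier where
  smul f v := ρ.act f v
  one_smul v := ρ.act_one v
  mul_smul f g v := ρ.act_mul f g v
  smul_zero f := map_zero (ρ.act f)
  smul_add f v w := map_add (ρ.act f) v w
  add_smul f g v := by
    have : ∀ t : V ⊗[ℂ] G, evalRight (f + g).ofConv t =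
        evalRight f.ofConv t + evalRight g.ofConv t := by
      intro t
      induction t using TensorProduct.induction_on with
      | zero => simp
      | tmul v a => simp [add_smul]
      | add t t' ht ht' => simp only [map_add, ht, ht']; abel
    exact this (ρ.map v)
  zero_smul v := by
    have : ∀ t : V ⊗[ℂ] G, evalRight (0 : DualAlgebra G).ofConv t = 0 := by
      intro t
      induction t using TensorProduct.induction_on with
      | zero => simp
      | tmul v a => simp
      | add t t' ht ht' => simp only [map_add, ht, ht', add_zero]
    exact this (ρ.map v)

instance : IsScalarTower ℂ (DualAlgebra G) ρ.Carrier where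
  smul_assoc r f v := by
    have : ∀ t : V ⊗[ℂ] G, evalRight (r • f).ofConv t = r • evalRight f.ofConv t := by
      intro t
      induction t using TensorProduct.induction_on with
      | zero => simp
      | tmul v a => simp [mul_smul]
      | add t t' ht ht' => simp only [map_add, ht, ht', smul_add]
    exact this (ρ.map v)

variable {ρ ρ'}

/-- A colinear map, as a module map over the dual algebra. -/
def ofColinear (T : V →ₗ[ℂ] W) (hT : ∀ v, ρ'.map (T v) = T.rTensor G (ρ.map v)) :
    ρ.Carrier →ₗ[DualAlgebra G] ρ'.Carrier where
  toFun := T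
  map_add' := map_add T
  map_smul' f v := by
    have h : ∀ v : V, T (evalRight f.ofConv (ρ.map v)) = evalRight f.ofConv (ρ'.map (T v)) :=
      fun v => by rw [hT, evalRight_rTensor]
    exact h v

/-- A module map over the dual algebra, as a linear map. -/
def toLin (T : ρ.Carrier →ₗ[DualAlgebra G] ρ'.Carrier) : V →ₗ[ℂ] W := T.restrictScalars ℂ

theorem toLin_colinear (T : ρ.Carrier →ₗ[DualAlgebra G] ρ'.Carrier) (v : V) :
    ρ'.map (toLin T v) = (toLin T).rTensor G (ρ.map v) := by
  refine eq_of_evalRight fun f => ?_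
  rw [evalRight_rTensor]
  exact (T.map_smul (toConv f) v).symm

/-- A subspace is stable under the dual algebra if and only if it is a subcomodule. -/
theorem mem_range_rTensor (L : Submodule (DualAlgebra G) ρ.Carrier) {v : V}
    (hv : (show ρ.Carrier from v) ∈ L) :
    ρ.map v ∈ LinearMap.range
      (LinearMap.rTensor G (show Submodule ℂ V from L.restrictScalars ℂ).subtype) := by
  set L' : Submodule ℂ V := L.restrictScalars ℂ with hL'
  have ex := rTensor_exact G (LinearMap.exact_subtype_mkQ L') L'.mkQ_surjective
  refine (ex (ρ.map v)).mp (eq_zero_of_evalRight fun f => ?_)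
  rw [evalRight_rTensor]
  exact (Submodule.Quotient.mk_eq_zero L').mpr (L.smul_mem (toConv f) hv)

variable (V) in
/-- The coaction on `V ⊗ W` through the second factor. -/
def tensorLeft (ρ' : Coaction G W) : Coaction G (V ⊗[ℂ] W) where
  map := (TensorProduct.assoc ℂ V W G).symm.toLinearMap ∘ₗ ρ'.map.lTensor V
  coassoc := by
    intro t
    induction t using TensorProduct.induction_on with
    | zero => simp
    | add t t' ht ht' => simp only [map_add, ht, ht']
    | tmul v w =>
      have h1 : ∀ s : W ⊗[ℂ] G, Coalgebra.comul.lTensor (V ⊗[ℂ] W)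
          ((TensorProduct.assoc ℂ V W G).symm (v ⊗ₜ s)) =
          (TensorProduct.mk ℂ V W v).rTensor (G ⊗[ℂ] G) (Coalgebra.comul.lTensor W s) := by
        intro s
        induction s using TensorProduct.induction_on with
        | zero => simp
        | tmul w g => simp
        | add s s' hs hs' => simp only [map_add, TensorProduct.tmul_add, hs, hs']
      have h2 : ∀ s : W ⊗[ℂ] G, TensorProduct.assoc ℂ (V ⊗[ℂ] W) G G
          (((TensorProduct.assoc ℂ V W G).symm.toLinearMap ∘ₗ ρ'.map.lTensor V).rTensor G
            ((TensorProduct.assoc ℂ V W G).symm (v ⊗ₜ s))) =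
          (TensorProduct.mk ℂ V W v).rTensor (G ⊗[ℂ] G)
            (TensorProduct.assoc ℂ W G G (ρ'.map.rTensor G s)) := by
        intro s
        induction s using TensorProduct.induction_on with
        | zero => simp
        | tmul w g =>
          simp only [TensorProduct.assoc_symm_tmul, LinearMap.rTensor_tmul, LinearMap.comp_apply,
            LinearMap.lTensor_tmul, LinearEquiv.coe_coe]
          generalize ρ'.map w = y
          induction y using TensorProduct.induction_on with
          | zero => simp
          | tmul w g => simp
          | add s s' hs hs' =>
            simp only [map_add, TensorProduct.tmul_add, TensorProduct.add_tmul, hs, hs']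
        | add s s' hs hs' => simp only [map_add, TensorProduct.tmul_add, hs, hs']
      simp only [LinearMap.comp_apply, LinearMap.lTensor_tmul, LinearEquiv.coe_coe] at h2 ⊢
      rw [h1, h2, ρ'.coassoc]
  counit := by
    intro t
    induction t using TensorProduct.induction_on with
    | zero => simp
    | add t t' ht ht' => simp only [map_add, ht, ht']
    | tmul v w =>
      have h1 : ∀ s : W ⊗[ℂ] G, TensorProduct.rid ℂ (V ⊗[ℂ] W)
          (Coalgebra.counit.lTensor (V ⊗[ℂ] W) ((TensorProduct.assoc ℂ V W G).symm (v ⊗ₜ s))) =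
          v ⊗ₜ TensorProduct.rid ℂ W (Coalgebra.counit.lTensor W s) := by
        intro s
        induction s using TensorProduct.induction_on with
        | zero => simp
        | tmul w g => simp
        | add s s' hs hs' => simp only [map_add, TensorProduct.tmul_add, hs, hs']
      simp only [LinearMap.comp_apply, LinearMap.lTensor_tmul, LinearEquiv.coe_coe]
      rw [h1, ρ'.counit]

theorem tensorLeft_map_tmul (ρ' : Coaction G W) (v : V) (w : W) :
    (tensorLeft V ρ').map (v ⊗ₜ w) = (TensorProduct.assoc ℂ V W G).symm (v ⊗ₜ ρ'.map w) := rfl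

variable (G) in
/-- The coalgebra `G` as a comodule over itself. -/
def self : Coaction G G where
  map := Coalgebra.comul
  coassoc v := by simp
  counit v := by simp

/-- The coaction as a colinear map into a cofree comodule. -/
theorem map_colinear (ρ : Coaction G V) (v : V) :
    (tensorLeft V (self G)).map (ρ.map v) = ρ.map.rTensor G (ρ.map v) := by
  apply (TensorProduct.assoc ℂ V G G).injective
  rw [← ρ.coassoc]
  exact LinearEquiv.apply_symm_apply _ _

theorem map_injective (ρ : Coaction G V) : Function.Injective ρ.map :=
  Function.LeftInverse.injective (g := fun t => TensorProduct.rid ℂ V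
    (Coalgebra.counit.lTensor V t)) ρ.counit

end Coaction

section Quantum

variable {G : Type*} [Ring G] [HopfAlgebra ℂ G] [StarRing G] [StarModule ℂ G]
  {V W : Type*} [AddCommGroup V] [Module ℂ V] [AddCommGroup W] [Module ℂ W]

theorem repMap_single {n : ℕ} (u : Matrix (Fin n) (Fin n) G) (i : Fin n) :
    repMap u (Pi.single i 1) = ∑ j, Pi.single j 1 ⊗ₜ[ℂ] u j i := by
  have := (Pi.basisFun ℂ (Fin n)).constr_basis ℂ
    (fun i => ∑ j, (Pi.single j 1 : Fin n → ℂ) ⊗ₜ[ℂ] u j i) i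
  rwa [Pi.basisFun_apply] at this

/-- Two linear maps on `ℂⁿ` agree if they agree on the standard basis. -/
theorem pi_ext {n : ℕ} {S T : (Fin n → ℂ) →ₗ[ℂ] V}
    (h : ∀ i, S (Pi.single i 1) = T (Pi.single i 1)) (v : Fin n → ℂ) : S v = T v := by
  refine LinearMap.congr_fun ((Pi.basisFun ℂ (Fin n)).ext fun i => ?_) v
  rw [Pi.basisFun_apply]
  exact h i

/-- The comodule `ℂⁿ` with the coaction given by the matrix of a representation. -/
def IsUnitaryRep.coaction {n : ℕ} {u : Matrix (Fin n) (Fin n) G} (hu : IsUnitaryRep u) :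
    Coaction G (Fin n → ℂ) where
  map := repMap u
  coassoc v := by
    refine pi_ext (S := Coalgebra.comul.lTensor _ ∘ₗ repMap u)
      (T := (TensorProduct.assoc ℂ _ G G).toLinearMap ∘ₗ (repMap u).rTensor G ∘ₗ repMap u)
      (fun i => ?_) v
    simp only [LinearMap.comp_apply, repMap_single, map_sum, LinearMap.lTensor_tmul,
      LinearMap.rTensor_tmul, LinearEquiv.coe_coe, hu.comul, TensorProduct.tmul_sum,
      TensorProduct.sum_tmul, TensorProduct.assoc_tmul]
    exact Finset.sum_comm
  counit v := by
    refine pi_ext (S := (TensorProduct.rid ℂ _).toLinearMap ∘ₗ Coalgebra.counit.lTensor _ ∘ₗ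
      repMap u) (T := LinearMap.id) (fun i => ?_) v
    simp [repMap_single, hu.counit]

theorem isSimpleModule_rep {n : ℕ} {u : Matrix (Fin n) (Fin n) G} (hu : IsUnitaryRep u)
    (hirr : IsIrreducibleRep u) : IsSimpleModule (DualAlgebra G) hu.coaction.Carrier := by
  have : Nontrivial hu.coaction.Carrier := by
    have : Nonempty (Fin n) := ⟨⟨0, hirr.1⟩⟩
    exact inferInstanceAs (Nontrivial (Fin n → ℂ))
  rw [isSimpleModule_iff]
  refine { eq_bot_or_eq_top := fun L => ?_ }
  rcases hirr.2 (L.restrictScalars ℂ) (fun v hv => Coaction.mem_range_rTensor L hv) with h | h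
  · left
    ext v
    exact (SetLike.ext_iff.mp h v).trans Iff.rfl
  · right
    ext v
    exact (SetLike.ext_iff.mp h v).trans Iff.rfl

/-- The colinear map `ℂⁿ → V ⊗ G`, `eⱼ ↦ v ⊗ uᵢⱼ`. -/
def rowMap {n : ℕ} {u : Matrix (Fin n) (Fin n) G} (hu : IsUnitaryRep u) (v : V) (i : Fin n) :
    hu.coaction.Carrier →ₗ[DualAlgebra G] (Coaction.tensorLeft V (Coaction.self G)).Carrier :=
  Coaction.ofColinear ((Pi.basisFun ℂ (Fin n)).constr ℂ fun j => v ⊗ₜ[ℂ] u i j) (fun w => by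
    have h : ∀ j, (Pi.basisFun ℂ (Fin n)).constr ℂ (fun j => v ⊗ₜ[ℂ] u i j) (Pi.single j 1) =
        v ⊗ₜ[ℂ] u i j := fun j => by
      have := (Pi.basisFun ℂ (Fin n)).constr_basis ℂ (fun j => v ⊗ₜ[ℂ] u i j) j
      rwa [Pi.basisFun_apply] at this
    refine pi_ext (S := (Coaction.tensorLeft V (Coaction.self G)).map ∘ₗ
      (Pi.basisFun ℂ (Fin n)).constr ℂ (fun j => v ⊗ₜ[ℂ] u i j))
      (T := LinearMap.rTensor G ((Pi.basisFun ℂ (Fin n)).constr ℂ (fun j => v ⊗ₜ[ℂ] u i j)) ∘ₗ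
        repMap u) (fun j => ?_) w
    simp only [LinearMap.comp_apply, repMap_single, h, map_sum, LinearMap.rTensor_tmul,
      Coaction.tensorLeft_map_tmul]
    change (TensorProduct.assoc ℂ V G G).symm (v ⊗ₜ Coalgebra.comul (u i j)) = _
    simp [hu.comul, TensorProduct.tmul_sum])

theorem rowMap_single {n : ℕ} {u : Matrix (Fin n) (Fin n) G} (hu : IsUnitaryRep u) (v : V)
    (i j : Fin n) :
    rowMap hu v i (show hu.coaction.Carrier from (Pi.single j 1 : Fin n → ℂ)) =
      v ⊗ₜ[ℂ] u i j := by
  have := (Pi.basisFun ℂ (Fin n)).constr_basis ℂ (fun j => v ⊗ₜ[ℂ] u i j) j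
  rw [Pi.basisFun_apply] at this
  exact this

/-- The pure tensors whose second factor is a coefficient of an irreducible unitary
representation span `V ⊗ G`. -/
theorem tensor_mem_of_coeff (hG : IsCompactMatrixQuantumGroup G) (S : Submodule ℂ (V ⊗[ℂ] G))
    (h : ∀ (v : V) (n : ℕ) (u : Matrix (Fin n) (Fin n) G), IsUnitaryRep u → IsIrreducibleRep u →
      ∀ i j, v ⊗ₜ u i j ∈ S) (t : V ⊗[ℂ] G) : t ∈ S := by
  induction t using TensorProduct.induction_on with
  | zero => exact S.zero_mem
  | add t t' ht ht' => exact S.add_mem ht ht'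
  | tmul v g =>
    have hg : g ∈ (⊤ : Submodule ℂ G) := Submodule.mem_top
    rw [← hG.span_coeff] at hg
    induction hg using Submodule.span_induction with
    | mem g hg => obtain ⟨n, u, hu, hirr, i, j, rfl⟩ := hg; exact h v n u hu hirr i j
    | zero => simp
    | add g g' _ _ hg hg' => rw [TensorProduct.tmul_add]; exact S.add_mem hg hg'
    | smul r g _ hg => rw [TensorProduct.tmul_smul]; exact S.smul_mem r hg

theorem isSemisimpleModule_cofree (hG : IsCompactMatrixQuantumGroup G) :
    IsSemisimpleModule (DualAlgebra G) (Coaction.tensorLeft V (Coaction.self G)).Carrier := by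
  let ι := {x : (n : ℕ) × Matrix (Fin n) (Fin n) G × V × Fin n //
    IsUnitaryRep x.2.1 ∧ IsIrreducibleRep x.2.1}
  refine isSemisimpleModule_of_isSemisimpleModule_submodule' (ι := ι)
    (p := fun x => LinearMap.range (rowMap x.2.1 x.1.2.2.1 x.1.2.2.2)) (fun x => ?_) ?_
  · have := isSimpleModule_rep x.2.1 x.2.2
    exact IsSemisimpleModule.range _
  · rw [eq_top_iff]
    rintro t -
    refine tensor_mem_of_coeff hG (V := V)
      (S := (⨆ x : ι, LinearMap.range (rowMap x.2.1 x.1.2.2.1 x.1.2.2.2)).restrictScalars ℂ)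
      (fun v n u hu hirr i j => ?_) t
    have h : (show (Coaction.tensorLeft V (Coaction.self G)).Carrier from v ⊗ₜ u i j) ∈
        LinearMap.range (rowMap hu v i) :=
      LinearMap.mem_range.mpr ⟨_, rowMap_single hu v i j⟩
    exact Submodule.mem_iSup_of_mem (p := fun x : ι => LinearMap.range
      (rowMap x.2.1 x.1.2.2.1 x.1.2.2.2)) ⟨⟨n, u, v, i⟩, hu, hirr⟩ h

/-- Every comodule of a compact quantum group is semisimple: it embeds into a cofree one. -/
theorem isSemisimpleModule_carrier (hG : IsCompactMatrixQuantumGroup G) (ρ : Coaction G V) :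
    IsSemisimpleModule (DualAlgebra G) ρ.Carrier :=
  haveI := isSemisimpleModule_cofree (V := V) hG
  IsSemisimpleModule.of_injective (R := DualAlgebra G) (Coaction.ofColinear (ρ := ρ)
    (ρ' := Coaction.tensorLeft V (Coaction.self G)) ρ.map ρ.map_colinear) ρ.map_injective

/-- Every subcomodule is spanned by vectors that belong to bases on which the coaction is given by
the matrix of an irreducible unitary representation. -/
theorem mem_span_of_irreducible (hG : IsCompactMatrixQuantumGroup G) (ρ : Coaction G V)
    (L : Submodule (DualAlgebra G) ρ.Carrier) {w : V} (hw : (show ρ.Carrier from w) ∈ L) :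
    w ∈ Submodule.span ℂ {z : V | ∃ (n : ℕ) (u : Matrix (Fin n) (Fin n) G) (x : Fin n → V),
      IsUnitaryRep u ∧ IsIrreducibleRep u ∧ (∀ i, (show ρ.Carrier from x i) ∈ L) ∧
      (∀ i, ρ.map (x i) = ∑ j, x j ⊗ₜ u j i) ∧ ∃ i, x i = z} := by
  have := isSemisimpleModule_cofree (V := V) hG
  let ι : ρ.Carrier →ₗ[DualAlgebra G] (Coaction.tensorLeft V (Coaction.self G)).Carrier :=
    Coaction.ofColinear ρ.map ρ.map_colinear
  obtain ⟨π, hπ⟩ := IsSemisimpleModule.extension_property (R := DualAlgebra G) (P := L)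
    (ι ∘ₗ L.subtype) (ρ.map_injective.comp L.subtype_injective) LinearMap.id
  let q := L.subtype ∘ₗ π
  have hq : w = Coaction.toLin q (ρ.map w) :=
    (congrArg L.subtype (LinearMap.congr_fun hπ ⟨w, hw⟩)).symm
  rw [hq]
  refine tensor_mem_of_coeff hG (V := V) (S := (Submodule.span ℂ _).comap (Coaction.toLin q))
    (fun v n u hu hirr i j => ?_) (ρ.map w)
  refine Submodule.subset_span ⟨n, u, fun j => Coaction.toLin q (v ⊗ₜ u i j), hu, hirr,
    fun j => (π _).2, fun j => ?_, j, rfl⟩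
  rw [Coaction.toLin_colinear, Coaction.tensorLeft_map_tmul]
  change (Coaction.toLin q).rTensor G
    ((TensorProduct.assoc ℂ V G G).symm (v ⊗ₜ Coalgebra.comul (u i j))) = _
  simp [hu.comul, TensorProduct.tmul_sum]

/-- A surjective colinear map has a colinear section. -/
theorem exists_colinear_section (hG : IsCompactMatrixQuantumGroup G) {ρ : Coaction G V}
    {ρ' : Coaction G W} (T : V →ₗ[ℂ] W) (hT : ∀ v, ρ'.map (T v) = T.rTensor G (ρ.map v))
    (hs : Function.Surjective T) : ∃ S : W →ₗ[ℂ] V, (∀ w, T (S w) = w) ∧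
      ∀ w, ρ.map (S w) = S.rTensor G (ρ'.map w) := by
  have := isSemisimpleModule_carrier hG ρ
  have := isSemisimpleModule_carrier hG ρ'
  obtain ⟨S, hS⟩ := IsSemisimpleModule.lifting_property (R := DualAlgebra G)
    (Coaction.ofColinear (ρ := ρ) (ρ' := ρ') T hT) hs
    (LinearMap.id : ρ'.Carrier →ₗ[DualAlgebra G] ρ'.Carrier)
  exact ⟨Coaction.toLin S, fun w => LinearMap.congr_fun hS w, Coaction.toLin_colinear S⟩

end Quantum

end Cosemisimple

/-! ### Maurer–Cartan forms and left covariance -/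

section MaurerCartan

open HopfAlgebra WithConv FODC.Env

variable {G Γ : Type*} [Ring G] [HopfAlgebra ℂ G]
  [AddCommGroup Γ] [Module ℂ Γ] [Module G Γ] [Module Gᵐᵒᵖ Γ]
  [IsScalarTower ℂ G Γ] [IsScalarTower ℂ Gᵐᵒᵖ Γ] [SMulCommClass G Gᵐᵒᵖ Γ]
  {c : FODC G Γ}

theorem algHom_antipode_conv {E : Type*} [Ring E] [Algebra ℂ E] (f : G →ₐ[ℂ] E) :
    toConv (f.toLinearMap ∘ₗ antipode ℂ) * toConv f.toLinearMap = 1 := by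
  have := LinearMap.algHom_comp_convMul_distrib (R := ℂ) f
    (toConv (antipode ℂ : G →ₗ[ℂ] G)) (toConv LinearMap.id)
  rw [LinearMap.antipode_mul_id] at this
  rw [← WithConv.ofConv_injective.eq_iff]
  refine Eq.trans this.symm ?_
  ext a
  simp

theorem algHom_conv_antipode {E : Type*} [Ring E] [Algebra ℂ E] (f : G →ₐ[ℂ] E) :
    toConv f.toLinearMap * toConv (f.toLinearMap ∘ₗ antipode ℂ) = 1 := by
  have := LinearMap.algHom_comp_convMul_distrib (R := ℂ) f
    (toConv LinearMap.id) (toConv (antipode ℂ : G →ₗ[ℂ] G))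
  rw [LinearMap.id_mul_antipode] at this
  rw [← WithConv.ofConv_injective.eq_iff]
  refine Eq.trans this.symm ?_
  ext a
  simp

/-- The Maurer–Cartan form `κ(h⁽¹⁾) δ(h⁽²⁾)` of a linear map `δ` along an algebra map `f`; for the
canonical maps into `Γ^∧` it is `κ(h⁽¹⁾) dh⁽²⁾`. -/
def maurerCartan {E : Type*} [Ring E] [Algebra ℂ E] (f : G →ₐ[ℂ] E) (δ : G →ₗ[ℂ] E) : G →ₗ[ℂ] E :=
  (toConv (f.toLinearMap ∘ₗ antipode ℂ) * toConv δ).ofConv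

theorem maurerCartan_apply {E : Type*} [Ring E] [Algebra ℂ E] (f : G →ₐ[ℂ] E) (δ : G →ₗ[ℂ] E)
    (h : G) : maurerCartan f δ h = LinearMap.mul' ℂ E (TensorProduct.map
      (f.toLinearMap ∘ₗ antipode ℂ) δ (Coalgebra.comul h)) := rfl

/-- The map `g ⊗ h ↦ g h⁽¹⁾ ⊗ h⁽²⁾`. -/
def galoisMap (G : Type*) [Ring G] [HopfAlgebra ℂ G] : G ⊗[ℂ] G →ₗ[ℂ] G ⊗[ℂ] G :=
  TensorProduct.lift (((Algebra.lmul ℂ (G ⊗[ℂ] G)).toLinearMap ∘ₗ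
    Algebra.TensorProduct.includeLeft.toLinearMap).compl₂ Coalgebra.comul)

theorem galoisMap_tmul (g h : G) :
    galoisMap G (g ⊗ₜ h) = (g ⊗ₜ 1) * (Coalgebra.comul (R := ℂ) h) := rfl

/-- Left multiplication of `h⁽¹⁾ ⊗ h⁽²⁾` by `g`, after applying an algebra map to the first factor. -/
theorem mul'_map_galoisMap {E : Type*} [Ring E] [Algebra ℂ E] (f : G →ₐ[ℂ] E) (k : G →ₗ[ℂ] E)
    (x : G ⊗[ℂ] G) : LinearMap.mul' ℂ E (TensorProduct.map f.toLinearMap k (galoisMap G x)) =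
      LinearMap.mul' ℂ E (TensorProduct.map f.toLinearMap
        (toConv f.toLinearMap * toConv k).ofConv x) := by
  have key : ∀ (g : G) (y : G ⊗[ℂ] G),
      LinearMap.mul' ℂ E (TensorProduct.map f.toLinearMap k ((g ⊗ₜ 1) * y)) =
      f g * LinearMap.mul' ℂ E (TensorProduct.map f.toLinearMap k y) := by
    intro g y
    induction y using TensorProduct.induction_on with
    | zero => simp
    | tmul a b => simp [mul_assoc]
    | add y y' hy hy' => simp only [map_add, mul_add, hy, hy']
  induction x using TensorProduct.induction_on with
  | zero => simp
  | tmul g h => rw [galoisMap_tmul, key]; rfl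
  | add y y' hy hy' => simp only [map_add, hy, hy']

theorem mul'_map_maurerCartan {E : Type*} [Ring E] [Algebra ℂ E] (f : G →ₐ[ℂ] E) (δ : G →ₗ[ℂ] E)
    (x : G ⊗[ℂ] G) :
    LinearMap.mul' ℂ E (TensorProduct.map f.toLinearMap (maurerCartan f δ) (galoisMap G x)) =
      LinearMap.mul' ℂ E (TensorProduct.map f.toLinearMap δ x) := by
  rw [mul'_map_galoisMap, maurerCartan, toConv_ofConv, ← mul_assoc, algHom_conv_antipode, one_mul,
    ofConv_toConv]

/-- The left covariance of the calculus: `∑ g dh = 0` implies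
`∑ g h⁽¹⁾ ⊗ κ(h⁽²⁾) dh⁽³⁾ = 0`, because the latter is the image of `∑ g⁽¹⁾h⁽¹⁾ ⊗ g⁽²⁾dh⁽²⁾` under
`a ⊗ γ ↦ a⁽¹⁾ ⊗ κ(a⁽²⁾) γ`. -/
theorem lTensor_maurerCartan_galoisMap (hc : c.IsBicovariant) (x : G ⊗[ℂ] G) (hx : c.form x = 0) :
    (maurerCartan (of0 c) (d0 c)).lTensor G (galoisMap G x) = 0 := by
  let i1 : G →ₐ[ℂ] G ⊗[ℂ] c.Env := Algebra.TensorProduct.includeLeft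
  let iR : c.Env →ₐ[ℂ] G ⊗[ℂ] c.Env := Algebra.TensorProduct.includeRight
  let i2 : G →ₐ[ℂ] G ⊗[ℂ] c.Env := iR.comp (of0 c)
  let k2 : G →ₗ[ℂ] G ⊗[ℂ] c.Env := i2.toLinearMap ∘ₗ antipode ℂ
  let d2 : G →ₗ[ℂ] G ⊗[ℂ] c.Env := iR.toLinearMap ∘ₗ d0 c
  let p0 := (toConv i1.toLinearMap * toConv k2).ofConv
  have hR : toConv (iR.toLinearMap ∘ₗ maurerCartan (of0 c) (d0 c)) = toConv k2 * toConv d2 := by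
    rw [← WithConv.ofConv_injective.eq_iff]
    exact LinearMap.algHom_comp_convMul_distrib (R := ℂ) iR
      (toConv ((of0 c).toLinearMap ∘ₗ antipode ℂ)) (toConv (d0 c))
  have hY : ∀ y, (maurerCartan (of0 c) (d0 c)).lTensor G y = LinearMap.mul' ℂ _
      (TensorProduct.map i1.toLinearMap (iR.toLinearMap ∘ₗ maurerCartan (of0 c) (d0 c)) y) := by
    intro y
    induction y using TensorProduct.induction_on with
    | zero => simp
    | tmul g h => simp [i1, iR]
    | add y y' hy hy' => simp only [map_add, hy, hy']
  have h1 : toConv (i1.toLinearMap ∘ₗ LinearMap.mul' ℂ G) =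
      toConv (i1.toLinearMap ∘ₗ (prL G).toLinearMap) *
        toConv (i1.toLinearMap ∘ₗ (prR G).toLinearMap) := by
    rw [conv_LR]
    congr 1
    ext a b
    simp
  have h2 : toConv (k2 ∘ₗ LinearMap.mul' ℂ G) =
      toConv (k2 ∘ₗ (prR G).toLinearMap) * toConv (k2 ∘ₗ (prL G).toLinearMap) := by
    rw [conv_RL]
    congr 1
    ext a b
    simp [k2, antipode_mul_antidistrib]
  have h3 : toConv (iR.toLinearMap ∘ₗ of1 c ∘ₗ c.form) =
      toConv (i2.toLinearMap ∘ₗ (prL G).toLinearMap) * toConv (d2 ∘ₗ (prR G).toLinearMap) := by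
    rw [conv_LR]
    congr 1
    ext a b
    simp [i2, d2, d0_apply, ← map_mul, of0_mul_of1]
  have h4 : toConv (p0 ∘ₗ LinearMap.mul' ℂ G) = toConv (i1.toLinearMap ∘ₗ LinearMap.mul' ℂ G) *
      toConv (k2 ∘ₗ LinearMap.mul' ℂ G) :=
    congrArg toConv (LinearMap.convMul_comp_coalgHom_distrib (toConv i1.toLinearMap) (toConv k2)
      (Bialgebra.mulCoalgHom ℂ G))
  have main : toConv (p0 ∘ₗ LinearMap.mul' ℂ G) * toConv (iR.toLinearMap ∘ₗ of1 c ∘ₗ c.form) =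
      toConv (LinearMap.mul' ℂ _ ∘ₗ TensorProduct.map i1.toLinearMap
        (toConv i1.toLinearMap * (toConv k2 * toConv d2)).ofConv) := by
    rw [h4, h1, h2, h3, ← conv_LR, ← conv_RR, ← ofConv_toConv (toConv k2 * toConv d2).ofConv,
      toConv_ofConv, ← conv_RR]
    calc _ = toConv (i1.toLinearMap ∘ₗ (prL G).toLinearMap) *
          (toConv (i1.toLinearMap ∘ₗ (prR G).toLinearMap) * toConv (k2 ∘ₗ (prR G).toLinearMap)) *
          (toConv (k2 ∘ₗ (prL G).toLinearMap) * toConv (i2.toLinearMap ∘ₗ (prL G).toLinearMap)) *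
          toConv (d2 ∘ₗ (prR G).toLinearMap) := by simp only [mul_assoc]
      _ = _ := by
        rw [conv_LL, algHom_antipode_conv, conv_one_L]
        simp only [mul_one, mul_assoc]
  rw [hY, mul'_map_galoisMap, hR]
  have := congrArg (fun f => f.ofConv x) main
  refine this.symm.trans ?_
  change LinearMap.mul' ℂ _ (TensorProduct.map (p0 ∘ₗ LinearMap.mul' ℂ G)
    ((iR.toLinearMap ∘ₗ of1 c) ∘ₗ c.form) (Coalgebra.comul x)) = 0
  rw [TensorProduct.map_comp]
  have hl := hc.left x hx
  rw [FODC.leftMap, LinearMap.comp_apply] at hl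
  rw [LinearMap.comp_apply, hl, map_zero, map_zero]

/-- To check that an algebra map `f` and a linear map `δ` respect the relations `∑ g dh = 0` of a
left covariant calculus, it suffices to look at their Maurer–Cartan form. -/
theorem mul'_map_eq_zero_of_maurerCartan (hc : c.IsBicovariant) {E : Type*} [Ring E] [Algebra ℂ E]
    (f : G →ₐ[ℂ] E) (δ : G →ₗ[ℂ] E)
    (hν : ∀ h, maurerCartan (of0 c) (d0 c) h = 0 → maurerCartan f δ h = 0)
    (x : G ⊗[ℂ] G) (hx : c.form x = 0) :
    LinearMap.mul' ℂ E (TensorProduct.map f.toLinearMap δ x) = 0 := by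
  rw [← mul'_map_maurerCartan]
  obtain ⟨y, hy⟩ := (Module.Flat.lTensor_exact G
    (LinearMap.exact_subtype_ker_map (maurerCartan (of0 c) (d0 c))) (galoisMap G x)).mp
      (lTensor_maurerCartan_galoisMap hc x hx)
  rw [← hy]
  clear hy
  induction y using TensorProduct.induction_on with
  | zero => simp
  | tmul g h => simp [hν h.1 h.2]
  | add y y' hy hy' => simp only [map_add, hy, hy', add_zero]

end MaurerCartan

/-! ### Horizontal forms -/

section Push

variable {C G V W : Type*} [AddCommGroup C] [Module ℂ C] [Coalgebra ℂ C]
  [AddCommGroup G] [Module ℂ G] [Coalgebra ℂ G]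
  [AddCommGroup V] [Module ℂ V] [AddCommGroup W] [Module ℂ W]

/-- The coaction of `G` that a coaction of `C` induces along a coalgebra map `C → G`. -/
def Coaction.push (π : C →ₗc[ℂ] G) (ρ : Coaction C V) : Coaction G V where
  map := π.toLinearMap.lTensor V ∘ₗ ρ.map
  coassoc v := by
    have h1 : ∀ t : V ⊗[ℂ] C, Coalgebra.comul.lTensor V (π.toLinearMap.lTensor V t) =
        (TensorProduct.map π.toLinearMap π.toLinearMap).lTensor V
          (Coalgebra.comul.lTensor V t) := by
      intro t
      rw [← LinearMap.comp_apply, ← LinearMap.comp_apply, ← LinearMap.lTensor_comp,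
        ← LinearMap.lTensor_comp, π.map_comp_comul]
    have h2 : ∀ t : V ⊗[ℂ] C, (TensorProduct.map π.toLinearMap π.toLinearMap).lTensor V
        (TensorProduct.assoc ℂ V C C (ρ.map.rTensor C t)) =
        TensorProduct.assoc ℂ V G G ((π.toLinearMap.lTensor V ∘ₗ ρ.map).rTensor G
          (π.toLinearMap.lTensor V t)) := by
      intro t
      induction t using TensorProduct.induction_on with
      | zero => simp
      | add t t' ht ht' => simp only [map_add, ht, ht']
      | tmul v g =>
        simp only [LinearMap.rTensor_tmul, LinearMap.lTensor_tmul, LinearMap.comp_apply]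
        generalize ρ.map v = s
        induction s using TensorProduct.induction_on with
        | zero => simp
        | add t t' ht ht' => simp only [map_add, TensorProduct.add_tmul, ht, ht']
        | tmul v g => simp
    rw [LinearMap.comp_apply, h1, ρ.coassoc, h2]
  counit v := by
    conv_rhs => rw [← ρ.counit v]
    rw [LinearMap.comp_apply, ← LinearMap.comp_apply, ← LinearMap.lTensor_comp, π.counit_comp]

theorem Coaction.push_colinear (π : C →ₗc[ℂ] G) {ρ : Coaction C V} {ρ' : Coaction C W}
    (T : V →ₗ[ℂ] W) (hT : ∀ v, ρ'.map (T v) = T.rTensor C (ρ.map v)) (v : V) :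
    (ρ'.push π).map (T v) = T.rTensor G ((ρ.push π).map v) := by
  change π.toLinearMap.lTensor W (ρ'.map (T v)) = T.rTensor G (π.toLinearMap.lTensor V (ρ.map v))
  rw [hT]
  exact LinearMap.congr_fun ((LinearMap.lTensor_comp_rTensor ..).trans
    (LinearMap.rTensor_comp_lTensor ..).symm) (ρ.map v)

end Push

section DegreeZero

open FODC.Env

variable {G Γ : Type*} [Ring G] [HopfAlgebra ℂ G]
  [AddCommGroup Γ] [Module ℂ Γ] [Module G Γ] [Module Gᵐᵒᵖ Γ]
  [IsScalarTower ℂ G Γ] [IsScalarTower ℂ Gᵐᵒᵖ Γ] [SMulCommClass G Gᵐᵒᵖ Γ]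
  (c : FODC G Γ)

/-- The projection `Γ^∧ → G` onto the elements of degree zero. -/
def FODC.Env.toZero : c.Env →ₐ[ℂ] G := lift c (AlgHom.id ℂ G) 0 (by simp) (by simp) (by simp)

@[simp] theorem FODC.Env.toZero_of0 (a : G) : toZero c (of0 c a) = a := lift_of0 c _ _ _ _ _ a

@[simp] theorem FODC.Env.toZero_d0 (a : G) : toZero c (d0 c a) = 0 := lift_d0 c _ _ _ _ _ a

variable {c}

theorem FODC.Env.comulLin_of0 (hc : c.IsBicovariant) (a : G) : comulLin hc (of0 c a) =
    TensorProduct.map (of0 c).toLinearMap (of0 c).toLinearMap (Coalgebra.comul a) := by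
  change (gr c).symm (comul hc (of0 c a)) = _
  rw [comul_of0, LinearEquiv.symm_apply_eq]
  generalize Coalgebra.comul (R := ℂ) a = t
  induction t using TensorProduct.induction_on with
  | zero => simp
  | tmul a b => simp [comulP_tmul]
  | add t t' ht ht' => simp only [map_add, ht, ht']

theorem FODC.Env.map_toZero_comulLin (hc : c.IsBicovariant) (x : c.Env) :
    TensorProduct.map (toZero c).toLinearMap (toZero c).toLinearMap (comulLin hc x) =
      Coalgebra.comul (toZero c x) := by
  have h := isDiffCoaction_comul hc
  have zero : ∀ t q, TensorProduct.map (toZero c).toLinearMap (toZero c).toLinearMap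
      (mulZero c (of0 c).toLinearMap t q) =
      TensorProduct.map (toZero c).toLinearMap (toZero c).toLinearMap t * q := by
    intro t q
    induction t using TensorProduct.induction_on with
    | zero => simp
    | add t t' ht ht' => simp only [map_add, LinearMap.add_apply, add_mul, ht, ht']
    | tmul x ϑ =>
      induction q using TensorProduct.induction_on with
      | zero => simp
      | add q q' hq hq' => simp only [map_add, mul_add, hq, hq']
      | tmul p g => simp [mulZero_tmul]
  have one : ∀ t q, TensorProduct.map (toZero c).toLinearMap (toZero c).toLinearMap
      (mulOne c (of0 c).toLinearMap (d0 c) t q) = 0 := by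
    intro t q
    induction t using TensorProduct.induction_on with
    | zero => simp
    | add t t' ht ht' => simp only [map_add, LinearMap.add_apply, ht, ht', add_zero]
    | tmul x ϑ =>
      induction q using TensorProduct.induction_on with
      | zero => simp
      | add q q' hq hq' => simp only [map_add, hq, hq', add_zero]
      | tmul p g => simp [mulOne_tmul]
  refine h.induction (LinearMap.eqLocus (TensorProduct.map (toZero c).toLinearMap
    (toZero c).toLinearMap ∘ₗ comulLin hc) (Coalgebra.comul ∘ₗ (toZero c).toLinearMap))
    ?_ (fun x hx p => ?_) (fun x hx p => ?_) x
  · change TensorProduct.map _ _ (h.lin 1) = Coalgebra.comul (toZero c 1)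
    rw [h.lin_one]
    simp [Algebra.TensorProduct.one_def]
  · change TensorProduct.map _ _ (h.lin (x * (of0 c).toLinearMap p)) = Coalgebra.comul (toZero c _)
    have hx' : TensorProduct.map (toZero c).toLinearMap (toZero c).toLinearMap (h.lin x) =
      Coalgebra.comul (toZero c x) := hx
    rw [h.lin_mul_zero, zero, hx']
    simp
  · change TensorProduct.map _ _ (h.lin (x * d0 c p)) = Coalgebra.comul (toZero c _)
    rw [h.lin_mul_one, one]
    simp

/-- The projection onto the elements of degree zero is a coalgebra map. -/
def FODC.Env.toZeroCoalgHom [h : Fact c.IsBicovariant] : c.Env →ₗc[ℂ] G where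
  __ := (toZero c).toLinearMap
  counit_comp := by
    ext x
    refine (isDiffCoaction_comul h.out).induction (LinearMap.eqLocus (Coalgebra.counit ∘ₗ
      (toZero c).toLinearMap) (counit c).toLinearMap) ?_ (fun x hx p => ?_) (fun x hx p => ?_) x
    · simp
    · have hx' : Coalgebra.counit (R := ℂ) (toZero c x) = counit c x := hx
      simp [hx', counit_of0]
    · simp [counit_d0]
  map_comp_comul := LinearMap.ext (map_toZero_comulLin h.out)

end DegreeZero

namespace BundleCalculus

open FODC.Env WithConv

variable {G P : Type*} [Ring G] [HopfAlgebra ℂ G] [StarRing G] [StarModule ℂ G]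
  [Ring P] [Algebra ℂ P] [StarRing P] [StarModule ℂ P]
  {Γ Ω : Type*} [AddCommGroup Γ] [Module ℂ Γ] [Module G Γ] [Module Gᵐᵒᵖ Γ]
  [IsScalarTower ℂ G Γ] [IsScalarTower ℂ Gᵐᵒᵖ Γ] [SMulCommClass G Gᵐᵒᵖ Γ]
  [Ring Ω] [Algebra ℂ Ω]
  {B : QuantumPrincipalBundle G P} {c : FODC G Γ} {𝒜 : ℕ → Submodule ℂ Ω}
  [GradedAlgebra 𝒜] (D : BundleCalculus B c 𝒜)

theorem mem_baseForms_iff {μ : Ω} : μ ∈ D.baseForms ↔ D.coact μ = μ ⊗ₜ 1 := by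
  constructor
  · intro h
    have h' : D.Ψ μ = inL c 𝒜 μ := h
    apply (GradedTensorProduct.of ℂ 𝒜 (grading c)).injective
    rw [of_coact, h', ← inL_mul_inR, map_one, mul_one]
  · intro h
    change D.Ψ μ = inL c 𝒜 μ
    rw [← of_coact, h, ← inL_mul_inR, map_one, mul_one]

theorem coact_mul_incl (w : Ω) (p : P) :
    D.coact (w * D.incl p) = mulZero c D.incl.toLinearMap (D.coact w) (B.coact p) :=
  D.isDiffCoaction.lin_mul_zero w p

theorem coact_mul_d_incl (w : Ω) (p : P) : D.coact (w * D.d (D.incl p)) =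
    mulOne c D.incl.toLinearMap (D.d ∘ₗ D.incl.toLinearMap) (D.coact w) (B.coact p) :=
  D.isDiffCoaction.lin_mul_one w p

theorem coact_incl (p : P) : D.coact (D.incl p) =
    TensorProduct.map D.incl.toLinearMap (of0 c).toLinearMap (B.coact p) := D.Ψ_incl p

/-- Right multiplication by `z` on `Ω ⊗_{Ω(M)} Ω`. -/
def rightMul (z : Ω) : Module.End ℂ D.BalancedTensor :=
  D.blift (D.bmk ∘ₗ (LinearMap.mulRight ℂ z).lTensor Ω) (fun x y μ hμ => by
    simp only [LinearMap.comp_apply, LinearMap.lTensor_tmul, LinearMap.mulRight_apply]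
    rw [D.bmk_mul _ _ _ hμ, mul_assoc])

theorem rightMul_bmk (w x z : Ω) : D.rightMul z (D.bmk (w ⊗ₜ x)) = D.bmk (w ⊗ₜ (x * z)) := rfl

theorem leftMul_rightMul (w z : Ω) (t : D.BalancedTensor) :
    D.leftMul w (D.rightMul z t) = D.rightMul z (D.leftMul w t) := by
  induction t using D.bmk_induction with
  | tmul x y => rfl
  | add t t' ht ht' => simp only [map_add, ht, ht']

theorem leftMul_mul (w w' : Ω) (t : D.BalancedTensor) :
    D.leftMul (w * w') t = D.leftMul w (D.leftMul w' t) := by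
  induction t using D.bmk_induction with
  | tmul x y => simp only [leftMul_bmk, mul_assoc]
  | add t t' ht ht' => simp only [map_add, ht, ht']

theorem rightMul_mul (z z' : Ω) (t : D.BalancedTensor) :
    D.rightMul (z * z') t = D.rightMul z' (D.rightMul z t) := by
  induction t using D.bmk_induction with
  | tmul x y => simp only [rightMul_bmk, mul_assoc]
  | add t t' ht ht' => simp only [map_add, ht, ht']

/-- Left multiplication, as a linear map into the operators. -/
def leftMulₗ : Ω →ₗ[ℂ] Module.End ℂ D.BalancedTensor where
  toFun := D.leftMul
  map_add' w w' := D.balanced_ext fun x z => by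
    simp only [LinearMap.add_apply, leftMul_bmk, add_mul, TensorProduct.add_tmul, map_add]
  map_smul' r w := D.balanced_ext fun x z => by
    simp only [LinearMap.smul_apply, leftMul_bmk, smul_mul_assoc, ← TensorProduct.smul_tmul',
      map_smul, RingHom.id_apply]

theorem leftMulₗ_apply (w : Ω) : D.leftMulₗ w = D.leftMul w := rfl

/-- Right multiplication, as a linear map into the operators. -/
def rightMulₗ : Ω →ₗ[ℂ] Module.End ℂ D.BalancedTensor where
  toFun := D.rightMul
  map_add' w w' := D.balanced_ext fun x z => by
    simp only [LinearMap.add_apply, rightMul_bmk, mul_add, TensorProduct.tmul_add, map_add]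
  map_smul' r w := D.balanced_ext fun x z => by
    simp only [LinearMap.smul_apply, rightMul_bmk, mul_smul_comm, TensorProduct.tmul_smul,
      map_smul, RingHom.id_apply]

theorem leftMul_one (t : D.BalancedTensor) : D.leftMul 1 t = t := by
  induction t using D.bmk_induction with
  | tmul x y => rw [leftMul_bmk, one_mul]
  | add t t' ht ht' => simp only [map_add, ht, ht']

theorem canonical_rightMul (z : Ω) (t : D.BalancedTensor) :
    GradedTensorProduct.of ℂ 𝒜 (grading c) (D.canonical (D.rightMul z t)) =
      GradedTensorProduct.of ℂ 𝒜 (grading c) (D.canonical t) * D.Ψ z := by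
  induction t using D.bmk_induction with
  | tmul x y =>
    rw [rightMul_bmk, canonical_bmk, canonical_bmk, ← inL_mul_of, ← inL_mul_of, of_coact, of_coact,
      map_mul, mul_assoc]
  | add t t' ht ht' => simp only [map_add, add_mul, ht, ht']

section Horizontal

variable [h : Fact c.IsBicovariant]

/-- `Ω` as a comodule over `Γ^∧`. -/
def coaction : Coaction c.Env Ω where
  map := D.coact
  coassoc := D.coact_coassoc h.out
  counit := D.coact_counit

/-- `Ω` as a comodule over `G`, through the part of `Ψ` of degree zero in the second factor. -/
def zeroCoaction : Coaction G Ω := D.coaction.push toZeroCoalgHom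

theorem zeroCoaction_map (w : Ω) :
    D.zeroCoaction.map w = (toZero c).toLinearMap.lTensor Ω (D.coact w) := rfl

/-- The space of horizontal forms `{w | Ψ(w) ∈ Ω ⊗ G}`. -/
def horizontal : Submodule ℂ Ω :=
  LinearMap.eqLocus D.coact ((of0 c).toLinearMap.lTensor Ω ∘ₗ D.zeroCoaction.map)

theorem mem_horizontal_iff {w : Ω} :
    w ∈ D.horizontal ↔ D.coact w = (of0 c).toLinearMap.lTensor Ω (D.zeroCoaction.map w) := Iff.rfl

theorem mem_horizontal_of_range {w : Ω}
    (hw : D.coact w ∈ LinearMap.range ((of0 c).toLinearMap.lTensor Ω)) : w ∈ D.horizontal := by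
  obtain ⟨t, ht⟩ := hw
  rw [mem_horizontal_iff, zeroCoaction_map, ← ht, ← LinearMap.comp_apply (LinearMap.lTensor _ _)
    (LinearMap.lTensor _ _) t, ← LinearMap.lTensor_comp]
  have : (toZero c).toLinearMap ∘ₗ (of0 c).toLinearMap = LinearMap.id := by ext; simp
  rw [this, LinearMap.lTensor_id, LinearMap.id_apply]

theorem incl_mem_horizontal (p : P) : D.incl p ∈ D.horizontal := by
  refine D.mem_horizontal_of_range ⟨D.incl.toLinearMap.rTensor G (B.coact p), ?_⟩
  rw [coact_incl, ← LinearMap.comp_apply, LinearMap.lTensor_comp_rTensor]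

theorem one_mem_horizontal : (1 : Ω) ∈ D.horizontal := by
  simpa using D.incl_mem_horizontal 1

theorem baseForms_mem_horizontal {μ : Ω} (hμ : μ ∈ D.baseForms) : μ ∈ D.horizontal :=
  D.mem_horizontal_of_range ⟨μ ⊗ₜ 1, by rw [D.mem_baseForms_iff.mp hμ]; simp⟩

theorem mul_mem_horizontal {w z : Ω} (hw : w ∈ D.horizontal) (hz : z ∈ D.horizontal) :
    w * z ∈ D.horizontal := by
  have key : ∀ t t' : Ω ⊗[ℂ] G, GradedTensorProduct.of ℂ 𝒜 (grading c)
      ((of0 c).toLinearMap.lTensor Ω t) * GradedTensorProduct.of ℂ 𝒜 (grading c)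
      ((of0 c).toLinearMap.lTensor Ω t') = GradedTensorProduct.of ℂ 𝒜 (grading c)
      ((of0 c).toLinearMap.lTensor Ω (t * t')) := by
    intro t t'
    induction t using TensorProduct.induction_on with
    | zero => simp
    | add t t' ht ht' => simp only [map_add, add_mul, ht, ht']
    | tmul x a =>
      induction t' using TensorProduct.induction_on with
      | zero => simp
      | add t t' ht ht' => simp only [map_add, mul_add, ht, ht']
      | tmul y b =>
        simp only [LinearMap.lTensor_tmul, Algebra.TensorProduct.tmul_mul_tmul,
          AlgHom.toLinearMap_apply]
        rw [tmul_mul_tmul_left_zero 𝒜 (grading c) _ (of0_mem c a), map_mul]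
  refine D.mem_horizontal_of_range ⟨D.zeroCoaction.map w * D.zeroCoaction.map z, ?_⟩
  apply (GradedTensorProduct.of ℂ 𝒜 (grading c)).injective
  rw [← key, ← D.mem_horizontal_iff.mp hw, ← D.mem_horizontal_iff.mp hz, of_coact, of_coact,
    of_coact, map_mul]

/-- The horizontal forms are a subcomodule. -/
def horizontalComodule : Submodule (DualAlgebra G) D.zeroCoaction.Carrier :=
  LinearMap.ker (Coaction.ofColinear (ρ := D.zeroCoaction)
    (ρ' := (Coaction.tensorLeft Ω (Coaction.self c.Env)).push toZeroCoalgHom)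
    (D.coact - (of0 c).toLinearMap.lTensor Ω ∘ₗ D.zeroCoaction.map) (fun v => by
      have h1 := Coaction.push_colinear (toZeroCoalgHom (c := c)) (ρ := D.coaction) D.coact
        (D.coaction.map_colinear) v
      have h2 : ∀ t : Ω ⊗[ℂ] G,
          ((Coaction.tensorLeft Ω (Coaction.self c.Env)).push toZeroCoalgHom).map
            ((of0 c).toLinearMap.lTensor Ω t) = ((of0 c).toLinearMap.lTensor Ω).rTensor G
              ((Coaction.tensorLeft Ω (Coaction.self G)).map t) := by
        intro t
        induction t using TensorProduct.induction_on with
        | zero => simp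
        | add t t' ht ht' => simp only [map_add, ht, ht']
        | tmul w g =>
          change (toZero c).toLinearMap.lTensor (Ω ⊗[ℂ] c.Env)
            ((TensorProduct.assoc ℂ Ω c.Env c.Env).symm (w ⊗ₜ comulLin h.out (of0 c g))) =
            ((of0 c).toLinearMap.lTensor Ω).rTensor G ((TensorProduct.assoc ℂ Ω G G).symm
              (w ⊗ₜ Coalgebra.comul g))
          rw [comulLin_of0]
          generalize Coalgebra.comul (R := ℂ) g = q
          induction q using TensorProduct.induction_on with
          | zero => simp
          | add t t' ht ht' => simp only [map_add, TensorProduct.tmul_add, ht, ht']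
          | tmul a b => simp
      rw [LinearMap.sub_apply, map_sub, LinearMap.rTensor_sub]
      refine congrArg₂ (fun x y => x - y) h1 ?_
      rw [LinearMap.comp_apply, h2, Coaction.map_colinear, LinearMap.rTensor_comp,
        LinearMap.comp_apply]))

theorem mem_horizontalComodule_iff {w : Ω} :
    (show D.zeroCoaction.Carrier from w) ∈ D.horizontalComodule ↔ w ∈ D.horizontal := by
  refine Iff.trans ?_ sub_eq_zero
  exact LinearMap.mem_ker

end Horizontal

end BundleCalculus

/-! ### Frames and the translation map on the group -/

section Frames

variable {G P : Type*} [Ring G] [HopfAlgebra ℂ G] [StarRing G] [StarModule ℂ G]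
  [Ring P] [Algebra ℂ P] [StarRing P] [StarModule ℂ P]

namespace IsUnitaryRep

variable {n : ℕ} {u : Matrix (Fin n) (Fin n) G} (hu : IsUnitaryRep u)
include hu

theorem mul_star (i j : Fin n) : ∑ k, u i k * star (u j k) = if i = j then 1 else 0 := by
  have h : u * star u = 1 := Unitary.mul_star_self_of_mem hu.unitary
  have := congrFun (congrFun h i) j
  simpa [Matrix.mul_apply, Matrix.star_apply, Matrix.one_apply] using this

/-- The inverse of a unitary matrix of coefficients is given by the antipode. -/
theorem antipode_apply (i j : Fin n) : HopfAlgebra.antipode ℂ (u i j) = star (u j i) := by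
  have h1 : u.map (HopfAlgebra.antipode ℂ) * u = 1 := by
    ext i j
    have := HopfAlgebra.mul_antipode_rTensor_comul_apply (R := ℂ) (u i j)
    rw [hu.comul, hu.counit] at this
    rw [Matrix.mul_apply, Matrix.one_apply]
    simpa [apply_ite] using this
  have h2 := left_inv_eq_right_inv h1 (Unitary.mul_star_self_of_mem hu.unitary)
  exact congrFun (congrFun h2 i) j

end IsUnitaryRep

/-- The linear span of the coefficients of the irreducible unitary representations is `G`. -/
theorem mem_of_coeff (hG : IsCompactMatrixQuantumGroup G) (S : Submodule ℂ G)
    (h : ∀ (n : ℕ) (u : Matrix (Fin n) (Fin n) G), IsUnitaryRep u → IsIrreducibleRep u →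
      ∀ i j, u i j ∈ S) (g : G) : g ∈ S := by
  have hg : g ∈ (⊤ : Submodule ℂ G) := Submodule.mem_top
  rw [← hG.span_coeff] at hg
  refine Submodule.span_le.mpr ?_ hg
  rintro _ ⟨n, u, hu, hirr, i, j, rfl⟩
  exact h n u hu hirr i j

namespace QuantumPrincipalBundle

variable (B : QuantumPrincipalBundle G P)

/-- The total space as a comodule. -/
def coaction : Coaction G P where
  map := B.coact.toLinearMap
  coassoc := B.coact_coassoc
  counit := B.coact_counit

/-- `x` is a frame for the representation with matrix `u`. -/
structure IsFrame {m n : ℕ} (u : Matrix (Fin n) (Fin n) G) (x : Matrix (Fin m) (Fin n) P) :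
    Prop where
  coact : ∀ k i, B.coact (x k i) = ∑ j, x k j ⊗ₜ[ℂ] u j i
  orthonormal : ∀ i j, ∑ k, star (x k i) * x k j = if i = j then 1 else 0

variable {B}

theorem IsFrame.coact_star {m n : ℕ} {u : Matrix (Fin n) (Fin n) G}
    {x : Matrix (Fin m) (Fin n) P} (hx : B.IsFrame u x) (k : Fin m) (i : Fin n) :
    B.coact (star (x k i)) = ∑ j, star (x k j) ⊗ₜ[ℂ] star (u j i) := by
  rw [B.coact_star, hx.coact, star_sum]
  simp

variable (B)

/-- The map `x ⊗ y ↦ (x ⊗ 1) Φ(y)`. -/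
abbrev canonicalMap : P ⊗[ℂ] P →ₗ[ℂ] P ⊗[ℂ] G :=
  LinearMap.mul' ℂ (P ⊗[ℂ] G) ∘ₗ
    TensorProduct.map Algebra.TensorProduct.includeLeft.toLinearMap B.coact.toLinearMap

theorem canonicalMap_tmul (p q : P) : B.canonicalMap (p ⊗ₜ q) = (p ⊗ₜ 1) * B.coact q := rfl

theorem canonicalMap_colinear (t : P ⊗[ℂ] P) :
    (Coaction.tensorLeft P (Coaction.self G)).map (B.canonicalMap t) =
      B.canonicalMap.rTensor G ((Coaction.tensorLeft P B.coaction).map t) := by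
  have h1 : ∀ (p : P) (s : P ⊗[ℂ] G), (Coaction.tensorLeft P (Coaction.self G)).map
      ((p ⊗ₜ 1) * s) = (LinearMap.mulLeft ℂ (p ⊗ₜ[ℂ] (1 : G))).rTensor G
        ((Coaction.tensorLeft P (Coaction.self G)).map s) := by
    intro p s
    induction s using TensorProduct.induction_on with
    | zero => simp
    | add s s' hs hs' => simp only [mul_add, map_add, hs, hs']
    | tmul q g =>
      rw [Algebra.TensorProduct.tmul_mul_tmul, one_mul, Coaction.tensorLeft_map_tmul,
        Coaction.tensorLeft_map_tmul]
      generalize (Coaction.self G).map g = y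
      induction y using TensorProduct.induction_on with
      | zero => simp
      | add s s' hs hs' => simp only [TensorProduct.tmul_add, map_add, hs, hs']
      | tmul a b => simp
  have h2 : ∀ (p : P) (s : P ⊗[ℂ] G), (LinearMap.mulLeft ℂ (p ⊗ₜ[ℂ] (1 : G))).rTensor G
      (B.coact.toLinearMap.rTensor G s) =
      B.canonicalMap.rTensor G ((TensorProduct.assoc ℂ P P G).symm (p ⊗ₜ s)) := by
    intro p s
    induction s using TensorProduct.induction_on with
    | zero => simp
    | add s s' hs hs' => simp only [TensorProduct.tmul_add, map_add, hs, hs']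
    | tmul q g => simp
  induction t using TensorProduct.induction_on with
  | zero => simp
  | add s s' hs hs' => simp only [map_add, hs, hs']
  | tmul p q =>
    rw [canonicalMap_tmul, h1, Coaction.tensorLeft_map_tmul]
    exact (congrArg _ (B.coaction.map_colinear q)).trans (h2 p (B.coact q))

/-- A colinear lift `s : G → P ⊗ P` of the translation map. -/
theorem exists_translation_lift (hG : IsCompactMatrixQuantumGroup G) :
    ∃ s : G →ₗ[ℂ] P ⊗[ℂ] P, (∀ g, B.canonicalMap (s g) = 1 ⊗ₜ g) ∧
      ∀ g, B.coact.toLinearMap.lTensor P (s g) =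
        TensorProduct.assoc ℂ P P G (s.rTensor G (Coalgebra.comul g)) := by
  obtain ⟨S, h1, h2⟩ := exists_colinear_section hG (ρ := Coaction.tensorLeft P B.coaction)
    (ρ' := Coaction.tensorLeft P (Coaction.self G)) B.canonicalMap B.canonicalMap_colinear
    B.canonical_surjective
  refine ⟨S ∘ₗ TensorProduct.mk ℂ P G 1, fun g => h1 _, fun g => ?_⟩
  have h3 := h2 (1 ⊗ₜ g)
  rw [Coaction.tensorLeft_map_tmul] at h3
  rw [← LinearEquiv.symm_apply_eq]
  refine Eq.trans h3 ?_
  change S.rTensor G ((TensorProduct.assoc ℂ P G G).symm (1 ⊗ₜ Coalgebra.comul g)) = _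
  generalize Coalgebra.comul (R := ℂ) g = y
  induction y using TensorProduct.induction_on with
  | zero => simp
  | add s s' hs hs' => simp only [TensorProduct.tmul_add, map_add, hs, hs']
  | tmul a b => simp

theorem mul'_eq_counit_canonicalMap (t : P ⊗[ℂ] P) : LinearMap.mul' ℂ P t =
    TensorProduct.rid ℂ P (Coalgebra.counit.lTensor P (B.canonicalMap t)) := by
  have h1 : ∀ (p : P) (s : P ⊗[ℂ] G), TensorProduct.rid ℂ P (Coalgebra.counit.lTensor P
      ((p ⊗ₜ 1) * s)) = p * TensorProduct.rid ℂ P (Coalgebra.counit.lTensor P s) := by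
    intro p s
    induction s using TensorProduct.induction_on with
    | zero => simp
    | add s s' hs hs' => simp only [mul_add, map_add, hs, hs']
    | tmul q g => simp
  induction t using TensorProduct.induction_on with
  | zero => simp
  | add s s' hs hs' => simp only [map_add, hs, hs']
  | tmul p q => rw [canonicalMap_tmul, h1, B.coact_counit]; rfl

/-- Contraction of the lift with a frame gives elements of `P ⊗ M`. -/
theorem contraction_mem {s : G →ₗ[ℂ] P ⊗[ℂ] P}
    (hs : ∀ g, B.coact.toLinearMap.lTensor P (s g) =
        TensorProduct.assoc ℂ P P G (s.rTensor G (Coalgebra.comul g)))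
    {m n : ℕ} {u : Matrix (Fin n) (Fin n) G} (hu : IsUnitaryRep u) {x : Matrix (Fin m) (Fin n) P}
    (hx : B.IsFrame u x) (i : Fin n) (k : Fin m) :
    ∑ b, (LinearMap.mulRight ℂ (star (x k b))).lTensor P (s (u i b)) ∈
      LinearMap.range (LinearMap.lTensor P (Subalgebra.toSubmodule B.base).subtype) := by
  have ex : Function.Exact (Subalgebra.toSubmodule B.base).subtype (B.coact.toLinearMap -
      (Algebra.TensorProduct.includeLeft : P →ₐ[ℂ] P ⊗[ℂ] G).toLinearMap) := by
    intro y
    rw [LinearMap.sub_apply, sub_eq_zero]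
    constructor
    · intro hy; exact ⟨⟨y, hy⟩, rfl⟩
    · rintro ⟨y, rfl⟩; exact y.2
  refine (Module.Flat.lTensor_exact P ex _).mp ?_
  have h1 : ∀ (y : P) (t : P ⊗[ℂ] P), B.coact.toLinearMap.lTensor P
      ((LinearMap.mulRight ℂ y).lTensor P t) =
      (LinearMap.mulRight ℂ (B.coact y)).lTensor P (B.coact.toLinearMap.lTensor P t) := by
    intro y t
    induction t using TensorProduct.induction_on with
    | zero => simp
    | add s s' hs hs' => simp only [map_add, hs, hs']
    | tmul p q => simp
  have h2 : ∀ (y : P) (g g' : G) (t : P ⊗[ℂ] P), (LinearMap.mulRight ℂ (y ⊗ₜ[ℂ] g)).lTensor P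
      (TensorProduct.assoc ℂ P P G (t ⊗ₜ g')) =
      TensorProduct.assoc ℂ P P G ((LinearMap.mulRight ℂ y).lTensor P t ⊗ₜ (g' * g)) := by
    intro y g g' t
    induction t using TensorProduct.induction_on with
    | zero => simp
    | add s s' hs hs' => simp only [map_add, TensorProduct.add_tmul, hs, hs']
    | tmul p q => simp
  have h3 : ∀ t : P ⊗[ℂ] P, (Algebra.TensorProduct.includeLeft :
      P →ₐ[ℂ] P ⊗[ℂ] G).toLinearMap.lTensor P t = TensorProduct.assoc ℂ P P G (t ⊗ₜ 1) := by
    intro t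
    induction t using TensorProduct.induction_on with
    | zero => simp
    | add s s' hs hs' => simp only [map_add, TensorProduct.add_tmul, hs, hs']
    | tmul p q => simp
  have h4 : ∀ (t : Fin n → P ⊗[ℂ] G) (w : P ⊗[ℂ] (P ⊗[ℂ] G)),
      (LinearMap.mulRight ℂ (∑ a, t a)).lTensor P w =
        ∑ a, (LinearMap.mulRight ℂ (t a)).lTensor P w := by
    intro t w
    have : LinearMap.mulRight ℂ (∑ a, t a) = ∑ a, LinearMap.mulRight ℂ (t a) := by
      ext; simp [Finset.mul_sum]
    rw [this, ← LinearMap.coe_lTensorHom]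
    simp
  rw [LinearMap.lTensor_sub, LinearMap.sub_apply, sub_eq_zero, h3, map_sum]
  simp only [h1, hs, hu.comul, hx.coact_star, map_sum, LinearMap.rTensor_tmul, h2, h4]
  -- the sum over `b` of `u l b * star (u a b)` is `1` for `l = a` and `0` otherwise
  have h5 : ∀ l a, ∑ b, TensorProduct.assoc ℂ P P G ((LinearMap.mulRight ℂ (star (x k a))).lTensor P
      (s (u i l)) ⊗ₜ (u l b * star (u a b))) = if l = a then TensorProduct.assoc ℂ P P G
        ((LinearMap.mulRight ℂ (star (x k a))).lTensor P (s (u i l)) ⊗ₜ 1) else 0 := by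
    intro l a
    rw [← map_sum, ← TensorProduct.tmul_sum, hu.mul_star]
    split_ifs <;> simp
  calc _ = ∑ l, ∑ a, ∑ b, TensorProduct.assoc ℂ P P G
        ((LinearMap.mulRight ℂ (star (x k a))).lTensor P
          (s (u i l)) ⊗ₜ (u l b * star (u a b))) := by
        rw [Finset.sum_comm]
        refine (Finset.sum_congr rfl fun a _ => Finset.sum_comm).trans ?_
        exact Finset.sum_comm
    _ = _ := by
      simp only [h5, Finset.sum_ite_eq, Finset.mem_univ, if_true]
      rw [TensorProduct.sum_tmul, map_sum]

/-- The colinear lift expressed by a frame, in `P ⊗ M P`: it is the sum of `c_k (1 ⊗ x k j)` with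
`c_k ∈ P ⊗ M` such that `m(c_k) = star (x k i)`. -/
theorem lift_eq_sum {s : G →ₗ[ℂ] P ⊗[ℂ] P}
    {m n : ℕ} {u : Matrix (Fin n) (Fin n) G} {x : Matrix (Fin m) (Fin n) P}
    (hx : B.IsFrame u x) (i j : Fin n) :
    s (u i j) = ∑ k, (LinearMap.mulRight ℂ (x k j)).lTensor P
      (∑ b, (LinearMap.mulRight ℂ (star (x k b))).lTensor P (s (u i b))) := by
  have h1 : ∀ (y z : P) (t : P ⊗[ℂ] P), (LinearMap.mulRight ℂ z).lTensor P
      ((LinearMap.mulRight ℂ y).lTensor P t) = (LinearMap.mulRight ℂ (y * z)).lTensor P t := by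
    intro y z t
    rw [← LinearMap.comp_apply, ← LinearMap.lTensor_comp, LinearMap.mulRight_mul]
  have h2 : ∀ (b : Fin n) (t : P ⊗[ℂ] P), ∑ k, (LinearMap.mulRight ℂ
      (star (x k b) * x k j)).lTensor P t = if b = j then t else 0 := by
    intro b t
    have : ∑ k, LinearMap.mulRight ℂ (star (x k b) * x k j) =
        if b = j then LinearMap.id else 0 := by
      ext y
      rw [LinearMap.sum_apply]
      simp only [LinearMap.mulRight_apply, ← Finset.mul_sum, hx.orthonormal]
      split_ifs <;> simp
    calc _ = (∑ k, LinearMap.mulRight ℂ (star (x k b) * x k j)).lTensor P t := by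
          rw [← LinearMap.coe_lTensorHom]
          simp
      _ = _ := by
          rw [this]
          split_ifs <;> simp
  simp only [map_sum, h1]
  rw [Finset.sum_comm]
  simp only [h2, Finset.sum_ite_eq', Finset.mem_univ, if_true]

theorem mul'_contraction {s : G →ₗ[ℂ] P ⊗[ℂ] P} (hs : ∀ g, B.canonicalMap (s g) = 1 ⊗ₜ g)
    {m n : ℕ} {u : Matrix (Fin n) (Fin n) G} (hu : IsUnitaryRep u) (x : Matrix (Fin m) (Fin n) P)
    (i : Fin n) (k : Fin m) :
    LinearMap.mul' ℂ P (∑ b, (LinearMap.mulRight ℂ (star (x k b))).lTensor P (s (u i b))) =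
      star (x k i) := by
  have h1 : ∀ (y : P) (t : P ⊗[ℂ] P), LinearMap.mul' ℂ P ((LinearMap.mulRight ℂ y).lTensor P t) =
      LinearMap.mul' ℂ P t * y := by
    intro y t
    induction t using TensorProduct.induction_on with
    | zero => simp
    | add s s' hs hs' => simp only [map_add, add_mul, hs, hs']
    | tmul p q => simp [mul_assoc]
  rw [map_sum]
  simp only [h1, B.mul'_eq_counit_canonicalMap, hs, LinearMap.lTensor_tmul, hu.counit]
  simp

end QuantumPrincipalBundle

end Frames

/-! ### The action of the group algebra on the balanced tensor product -/

namespace BundleCalculus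

open FODC.Env WithConv

variable {G P : Type*} [Ring G] [HopfAlgebra ℂ G] [StarRing G] [StarModule ℂ G]
  [Ring P] [Algebra ℂ P] [StarRing P] [StarModule ℂ P]
  {Γ Ω : Type*} [AddCommGroup Γ] [Module ℂ Γ] [Module G Γ] [Module Gᵐᵒᵖ Γ]
  [IsScalarTower ℂ G Γ] [IsScalarTower ℂ Gᵐᵒᵖ Γ] [SMulCommClass G Gᵐᵒᵖ Γ]
  [Ring Ω] [Algebra ℂ Ω]
  {B : QuantumPrincipalBundle G P} {c : FODC G Γ} {𝒜 : ℕ → Submodule ℂ Ω}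
  [GradedAlgebra 𝒜] (D : BundleCalculus B c 𝒜)

/-- The values of the translation map on `G`, given on the coefficients of an irreducible unitary
representation by a frame `x` as `u i j ↦ ∑ₖ (x k i)* ⊗ x k j`. -/
def IsGroupTranslation (s : G →ₗ[ℂ] D.BalancedTensor) : Prop :=
  ∀ (n : ℕ) (u : Matrix (Fin n) (Fin n) G), IsUnitaryRep u → IsIrreducibleRep u →
    ∃ (m : ℕ) (x : Matrix (Fin m) (Fin n) P), B.IsFrame u x ∧
      ∀ i j, s (u i j) = ∑ k, D.bmk (D.incl (star (x k i)) ⊗ₜ D.incl (x k j))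

theorem incl_mem_baseForms {p : P} (hp : p ∈ B.base) : D.incl p ∈ D.baseForms := by
  rw [mem_baseForms_iff, coact_incl]
  have : B.coact p = p ⊗ₜ 1 := hp
  rw [this]
  simp

/-- The frame formula depends only on the representation, because a colinear lift
`G → P ⊗ P` of the translation map satisfies it for every frame. -/
theorem exists_isGroupTranslation (hG : IsCompactMatrixQuantumGroup G) (hB : B.HasFrames) :
    ∃ s, D.IsGroupTranslation s := by
  obtain ⟨s, hs1, hs2⟩ := B.exists_translation_lift hG
  let J : P ⊗[ℂ] P →ₗ[ℂ] D.BalancedTensor :=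
    D.bmk ∘ₗ TensorProduct.map D.incl.toLinearMap D.incl.toLinearMap
  refine ⟨J ∘ₗ s, fun n u hu hirr => ?_⟩
  obtain ⟨m, x, hx1, hx2⟩ := hB n u hu hirr
  have hx : B.IsFrame u x := ⟨hx1, hx2⟩
  refine ⟨m, x, hx, fun i j => ?_⟩
  have key : ∀ (y : P) (t : P ⊗[ℂ] P), t ∈ LinearMap.range (LinearMap.lTensor P
      (Subalgebra.toSubmodule B.base).subtype) → J ((LinearMap.mulRight ℂ y).lTensor P t) =
        D.bmk (D.incl (LinearMap.mul' ℂ P t) ⊗ₜ D.incl y) := by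
    rintro y _ ⟨t, rfl⟩
    induction t using TensorProduct.induction_on with
    | zero => simp
    | add t t' ht ht' => simp only [map_add, TensorProduct.add_tmul, ht, ht']
    | tmul p q =>
      have := D.bmk_mul (D.incl p) (D.incl y) (D.incl q) (D.incl_mem_baseForms q.2)
      rw [← map_mul, ← map_mul] at this
      exact this.symm
  rw [LinearMap.comp_apply, B.lift_eq_sum hx, map_sum]
  refine Finset.sum_congr rfl fun k _ => ?_
  rw [key _ _ (B.contraction_mem hs2 hu hx i k), B.mul'_contraction hs1 hu]

/-- The left `Ω`-linear extension `w ⊗ g ↦ w s(g)`. -/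
def extend (s : G →ₗ[ℂ] D.BalancedTensor) : Ω ⊗[ℂ] G →ₗ[ℂ] D.BalancedTensor :=
  TensorProduct.lift (LinearMap.compl₂ D.leftMulₗ s)

theorem extend_tmul (s : G →ₗ[ℂ] D.BalancedTensor) (w : Ω) (g : G) :
    D.extend s (w ⊗ₜ g) = D.leftMul w (s g) := rfl

/-- The part of `Ω ⊗_{Ω(M)} Ω` on which the canonical map is inverted by the extension of `s`. -/
def horizontalPart (s : G →ₗ[ℂ] D.BalancedTensor) : Submodule ℂ D.BalancedTensor :=
  LinearMap.eqLocus (D.extend s ∘ₗ (toZero c).toLinearMap.lTensor Ω ∘ₗ D.canonical) LinearMap.id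

theorem eq_of_mem_horizontalPart {s : G →ₗ[ℂ] D.BalancedTensor} {t t' : D.BalancedTensor}
    (ht : t ∈ D.horizontalPart s) (ht' : t' ∈ D.horizontalPart s)
    (e : D.canonical t = D.canonical t') : t = t' := by
  have h1 : D.extend s ((toZero c).toLinearMap.lTensor Ω (D.canonical t)) = t := ht
  have h2 : D.extend s ((toZero c).toLinearMap.lTensor Ω (D.canonical t')) = t' := ht'
  rw [← h1, ← h2, e]

theorem extend_mulLeft (s : G →ₗ[ℂ] D.BalancedTensor) (w : Ω) (t : Ω ⊗[ℂ] c.Env) :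
    D.extend s ((toZero c).toLinearMap.lTensor Ω ((LinearMap.mulLeft ℂ w).rTensor c.Env t)) =
      D.leftMul w (D.extend s ((toZero c).toLinearMap.lTensor Ω t)) := by
  induction t using TensorProduct.induction_on with
  | zero => simp
  | add t t' ht ht' => simp only [map_add, ht, ht']
  | tmul z ϑ => simp [extend_tmul, leftMul_mul]

theorem leftMul_mem_horizontalPart {s : G →ₗ[ℂ] D.BalancedTensor} (w : Ω) {t : D.BalancedTensor}
    (ht : t ∈ D.horizontalPart s) : D.leftMul w t ∈ D.horizontalPart s := by
  have h1 : D.extend s ((toZero c).toLinearMap.lTensor Ω (D.canonical t)) = t := ht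
  change D.extend s ((toZero c).toLinearMap.lTensor Ω (D.canonical (D.leftMul w t))) = _
  rw [canonical_leftMul, extend_mulLeft, h1]
  rfl

theorem inR_of0_mul_inL (g : G) (w : Ω) : inR c 𝒜 (of0 c g) * inL c 𝒜 w =
    inL c 𝒜 w * inR c 𝒜 (of0 c g) := by
  rw [inL_mul_inR]
  refine (tmul_mul_tmul_left_zero 𝒜 (grading c) 1 (of0_mem c g) w 1).trans ?_
  rw [one_mul, mul_one]

variable (hG : IsCompactMatrixQuantumGroup G) {s : G →ₗ[ℂ] D.BalancedTensor}
  (hs : D.IsGroupTranslation s)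

include hG hs

theorem canonical_translation (g : G) : D.canonical (s g) = 1 ⊗ₜ of0 c g := by
  refine mem_of_coeff hG (LinearMap.eqLocus (D.canonical ∘ₗ s)
    (TensorProduct.mk ℂ Ω c.Env 1 ∘ₗ (of0 c).toLinearMap)) (fun n u hu hirr i j => ?_) g
  obtain ⟨m, x, hx, e⟩ := hs n u hu hirr
  change D.canonical (s (u i j)) = 1 ⊗ₜ of0 c (u i j)
  rw [e, map_sum]
  have h1 : ∀ k, D.canonical (D.bmk (D.incl (star (x k i)) ⊗ₜ D.incl (x k j))) =
      ∑ l, D.incl (star (x k i) * x k l) ⊗ₜ of0 c (u l j) := by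
    intro k
    rw [canonical_bmk, coact_incl, hx.coact]
    simp
  simp only [h1]
  rw [Finset.sum_comm]
  simp only [← TensorProduct.sum_tmul, ← map_sum, hx.orthonormal]
  simp [apply_ite, TensorProduct.ite_tmul]

variable [h : Fact c.IsBicovariant]

/-- The translation map on `G` splits the coaction on horizontal forms: if `z` belongs to a basis
`zᵢ` of an irreducible representation, then the `∑ᵢ zᵢ (x k i)*` are base forms. -/
theorem extend_zeroCoaction {z : Ω} (hz : z ∈ D.horizontal) :
    D.extend s (D.zeroCoaction.map z) = D.bmk (1 ⊗ₜ z) := by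
  have hspan := mem_span_of_irreducible hG D.zeroCoaction D.horizontalComodule
    (D.mem_horizontalComodule_iff.mpr hz)
  have hle := Submodule.span_le (p := LinearMap.eqLocus (D.extend s ∘ₗ D.zeroCoaction.map)
    (D.bmk ∘ₗ TensorProduct.mk ℂ Ω Ω 1)) |>.mpr ?_ hspan
  · exact hle
  rintro _ ⟨n, u, z, hu, hirr, hL, hco, i, rfl⟩
  obtain ⟨m, x, hx, e⟩ := hs n u hu hirr
  change D.extend s (D.zeroCoaction.map (z i)) = D.bmk (1 ⊗ₜ z i)
  have hb : ∀ k, ∑ l, z l * D.incl (star (x k l)) ∈ D.baseForms := by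
    intro k
    rw [mem_baseForms_iff, map_sum]
    have h1 : ∀ l, D.coact (z l * D.incl (star (x k l))) =
        ∑ a, ∑ b, (z a * D.incl (star (x k b))) ⊗ₜ of0 c (u a l * star (u b l)) := by
      intro l
      rw [coact_mul_incl, D.mem_horizontal_iff.mp (D.mem_horizontalComodule_iff.mp (hL l)), hco,
        hx.coact_star]
      simp only [map_sum, LinearMap.lTensor_tmul, LinearMap.sum_apply, mulZero_tmul,
        AlgHom.toLinearMap_apply, map_mul]
      exact Finset.sum_comm
    simp only [h1]
    calc _ = ∑ a, ∑ b, ∑ l, (z a * D.incl (star (x k b))) ⊗ₜ of0 c (u a l * star (u b l)) := by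
          rw [Finset.sum_comm]
          exact Finset.sum_congr rfl fun a _ => Finset.sum_comm
      _ = _ := by
          simp only [← TensorProduct.tmul_sum, ← map_sum, hu.mul_star]
          simp [apply_ite, TensorProduct.sum_tmul]
  have h2 : ∀ l, D.extend s (z l ⊗ₜ u l i) =
      ∑ k, D.bmk ((z l * D.incl (star (x k l))) ⊗ₜ D.incl (x k i)) := by
    intro l
    rw [extend_tmul, e, map_sum]
    rfl
  calc D.extend s (D.zeroCoaction.map (z i))
      = ∑ k, D.bmk ((1 * ∑ l, z l * D.incl (star (x k l))) ⊗ₜ D.incl (x k i)) := by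
        rw [hco, map_sum]
        simp only [h2, one_mul, TensorProduct.sum_tmul, map_sum]
        exact Finset.sum_comm
    _ = D.bmk (1 ⊗ₜ ∑ l, z l * D.incl (∑ k, star (x k l) * x k i)) := by
        simp only [D.bmk_mul _ _ _ (hb _), ← map_sum, ← TensorProduct.tmul_sum]
        congr 2
        simp only [Finset.sum_mul, map_sum, map_mul, Finset.mul_sum, mul_assoc]
        exact Finset.sum_comm
    _ = _ := by
        simp [hx.orthonormal, apply_ite]

theorem bmk_mem_horizontalPart (w : Ω) {z : Ω} (hz : z ∈ D.horizontal) :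
    D.bmk (w ⊗ₜ z) ∈ D.horizontalPart s := by
  have : D.bmk (w ⊗ₜ z) = D.leftMul w (D.bmk (1 ⊗ₜ z)) := by rw [leftMul_bmk, mul_one]
  rw [this]
  refine D.leftMul_mem_horizontalPart w ?_
  change D.extend s ((toZero c).toLinearMap.lTensor Ω (D.canonical (D.bmk (1 ⊗ₜ z)))) = _
  rw [canonical_bmk, LinearMap.mulLeft_one, LinearMap.rTensor_id]
  exact D.extend_zeroCoaction hG hs hz

theorem rightMul_translation_mem {z : Ω} (hz : z ∈ D.horizontal) (g : G) :
    D.rightMul z (s g) ∈ D.horizontalPart s := by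
  refine mem_of_coeff hG ((D.horizontalPart s).comap (D.rightMul z ∘ₗ s))
    (fun n u hu hirr i j => ?_) g
  obtain ⟨m, x, hx, e⟩ := hs n u hu hirr
  rw [Submodule.mem_comap, LinearMap.comp_apply, e, map_sum]
  exact Submodule.sum_mem _ fun k _ => D.bmk_mem_horizontalPart hG hs _
    (D.mul_mem_horizontal (D.incl_mem_horizontal _) hz)

theorem translation_mem (g : G) : s g ∈ D.horizontalPart s := by
  have := D.rightMul_translation_mem hG hs D.one_mem_horizontal g
  have e : D.rightMul 1 (s g) = s g := by
    generalize s g = t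
    induction t using D.bmk_induction with
    | tmul w z => rw [rightMul_bmk, mul_one]
    | add t t' ht ht' => rw [map_add, ht, ht']
  rwa [e] at this

theorem translation_one : s 1 = D.bmk (1 ⊗ₜ 1) := by
  refine D.eq_of_mem_horizontalPart (D.translation_mem hG hs 1)
    (D.bmk_mem_horizontalPart hG hs 1 D.one_mem_horizontal) ?_
  rw [D.canonical_translation hG hs, canonical_bmk, coact_one]
  simp

/-- The values of the translation map commute with base forms. -/
theorem leftMul_translation {μ : Ω} (hμ : μ ∈ D.baseForms) (g : G) :
    D.leftMul μ (s g) = D.rightMul μ (s g) := by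
  refine D.eq_of_mem_horizontalPart (D.leftMul_mem_horizontalPart μ (D.translation_mem hG hs g))
    (D.rightMul_translation_mem hG hs (D.baseForms_mem_horizontal hμ) g) ?_
  apply (GradedTensorProduct.of ℂ 𝒜 (grading c)).injective
  have h1 : D.Ψ μ = inL c 𝒜 μ := hμ
  rw [canonical_rightMul, canonical_leftMul, ← inL_mul_of, D.canonical_translation hG hs, h1,
    ← inL_mul_inR, map_one, one_mul, inR_of0_mul_inL]

/-- The operator `w ⊗ z ↦ w s(g) z`. -/
def fiberAct (g : G) : Module.End ℂ D.BalancedTensor :=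
  D.blift (TensorProduct.lift (LinearMap.compl₂ D.leftMulₗ (D.rightMulₗ.flip (s g))))
    (fun w z μ hμ => by
      change D.leftMul (w * μ) (D.rightMul z (s g)) = D.leftMul w (D.rightMul (μ * z) (s g))
      rw [leftMul_mul, leftMul_rightMul, D.leftMul_translation hG hs hμ, rightMul_mul])

theorem fiberAct_bmk (g : G) (w z : Ω) :
    D.fiberAct hG hs g (D.bmk (w ⊗ₜ z)) = D.leftMul w (D.rightMul z (s g)) := rfl

theorem fiberAct_leftMul (g : G) (w : Ω) (t : D.BalancedTensor) :
    D.fiberAct hG hs g (D.leftMul w t) = D.leftMul w (D.fiberAct hG hs g t) := by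
  induction t using D.bmk_induction with
  | tmul x z => rw [leftMul_bmk, fiberAct_bmk, fiberAct_bmk, leftMul_mul]
  | add t t' ht ht' => simp only [map_add, ht, ht']

theorem fiberAct_rightMul (g : G) (w : Ω) (t : D.BalancedTensor) :
    D.fiberAct hG hs g (D.rightMul w t) = D.rightMul w (D.fiberAct hG hs g t) := by
  induction t using D.bmk_induction with
  | tmul x z => rw [rightMul_bmk, fiberAct_bmk, fiberAct_bmk, rightMul_mul, leftMul_rightMul]
  | add t t' ht ht' => simp only [map_add, ht, ht']

theorem canonical_fiberAct (g : G) (t : D.BalancedTensor) :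
    GradedTensorProduct.of ℂ 𝒜 (grading c) (D.canonical (D.fiberAct hG hs g t)) =
      inR c 𝒜 (of0 c g) * GradedTensorProduct.of ℂ 𝒜 (grading c) (D.canonical t) := by
  induction t using D.bmk_induction with
  | tmul w z =>
    rw [fiberAct_bmk, canonical_leftMul, ← inL_mul_of, canonical_rightMul,
      D.canonical_translation hG hs, canonical_bmk, ← inL_mul_of, of_coact, ← inL_mul_inR c 𝒜 1,
      map_one, one_mul, ← mul_assoc, ← mul_assoc, inR_of0_mul_inL]
  | add t t' ht ht' => simp only [map_add, mul_add, ht, ht']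

theorem fiberAct_translation (g g' : G) : D.fiberAct hG hs g (s g') = s (g * g') := by
  refine D.eq_of_mem_horizontalPart ?_ (D.translation_mem hG hs _) ?_
  · refine mem_of_coeff hG ((D.horizontalPart s).comap (D.fiberAct hG hs g ∘ₗ s))
      (fun n u hu hirr i j => ?_) g'
    obtain ⟨m, x, hx, e⟩ := hs n u hu hirr
    rw [Submodule.mem_comap, LinearMap.comp_apply, e, map_sum]
    exact Submodule.sum_mem _ fun k _ => D.leftMul_mem_horizontalPart _
      (D.rightMul_translation_mem hG hs (D.incl_mem_horizontal _) g)
  · apply (GradedTensorProduct.of ℂ 𝒜 (grading c)).injective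
    rw [canonical_fiberAct, D.canonical_translation hG hs, D.canonical_translation hG hs,
      ← inL_mul_inR, ← inL_mul_inR, map_one, one_mul, one_mul, ← map_mul, ← map_mul]

/-- The operators `w ⊗ z ↦ w s(g) z`, as a representation of the algebra `G`. -/
def fiberHom : G →ₐ[ℂ] Module.End ℂ D.BalancedTensor :=
  AlgHom.ofLinearMap
    { toFun := D.fiberAct hG hs
      map_add' := fun g g' => D.balanced_ext fun w z => by
        rw [LinearMap.add_apply, fiberAct_bmk, fiberAct_bmk, fiberAct_bmk, map_add, map_add,
          map_add]
      map_smul' := fun r g => D.balanced_ext fun w z => by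
        rw [LinearMap.smul_apply, fiberAct_bmk, fiberAct_bmk, map_smul, map_smul, map_smul]
        rfl }
    (D.balanced_ext fun w z => by
      change D.fiberAct hG hs 1 (D.bmk (w ⊗ₜ z)) = D.bmk (w ⊗ₜ z)
      rw [fiberAct_bmk, D.translation_one hG hs, rightMul_bmk, leftMul_bmk, one_mul, mul_one])
    (fun g g' => D.balanced_ext fun w z => by
      change D.fiberAct hG hs (g * g') (D.bmk (w ⊗ₜ z)) =
        D.fiberAct hG hs g (D.fiberAct hG hs g' (D.bmk (w ⊗ₜ z)))
      rw [fiberAct_bmk, fiberAct_bmk, fiberAct_leftMul, fiberAct_rightMul, fiberAct_translation])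

theorem fiberHom_apply (g : G) (t : D.BalancedTensor) :
    D.fiberHom hG hs g t = D.fiberAct hG hs g t := rfl

end BundleCalculus

/-! ### The differential on the balanced tensor product -/

section Parity

variable {A : Type*} [Ring A] [Algebra ℂ A] {𝒜 : ℕ → Submodule ℂ A} [GradedAlgebra 𝒜]
  {d : A →ₗ[ℂ] A} (hd : IsDifferential 𝒜 d)
include hd

theorem IsDifferential.map_mul (w z : A) : d (w * z) = d w * z + parity 𝒜 w * d z := by
  have : d ∘ₗ (LinearMap.mulRight ℂ z) =
      LinearMap.mulRight ℂ z ∘ₗ d + LinearMap.mulRight ℂ (d z) ∘ₗ parity 𝒜 := by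
    refine linearMap_ext_homogeneous 𝒜 fun n w hw => ?_
    simp [hd.leibniz n w hw, parity_apply 𝒜 hw]
  exact LinearMap.congr_fun this w

theorem IsDifferential.map_one : d 1 = 0 := by
  have := hd.map_mul 1 1
  simpa [parity_one] using this

theorem IsDifferential.map_parity (w : A) : d (parity 𝒜 w) = - parity 𝒜 (d w) := by
  have : d ∘ₗ parity 𝒜 = - (parity 𝒜 ∘ₗ d) := by
    refine linearMap_ext_homogeneous 𝒜 fun n w hw => ?_
    simp [parity_apply 𝒜 hw, parity_apply 𝒜 (hd.mem n w hw), pow_succ]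
  exact LinearMap.congr_fun this w

end Parity

namespace BundleCalculus

open FODC.Env WithConv

variable {G P : Type*} [Ring G] [HopfAlgebra ℂ G] [StarRing G] [StarModule ℂ G]
  [Ring P] [Algebra ℂ P] [StarRing P] [StarModule ℂ P]
  {Γ Ω : Type*} [AddCommGroup Γ] [Module ℂ Γ] [Module G Γ] [Module Gᵐᵒᵖ Γ]
  [IsScalarTower ℂ G Γ] [IsScalarTower ℂ Gᵐᵒᵖ Γ] [SMulCommClass G Gᵐᵒᵖ Γ]
  [Ring Ω] [Algebra ℂ Ω]
  {B : QuantumPrincipalBundle G P} {c : FODC G Γ} {𝒜 : ℕ → Submodule ℂ Ω}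
  [GradedAlgebra 𝒜] (D : BundleCalculus B c 𝒜)

theorem coact_d (w : Ω) : D.coact (D.d w) = TensorProduct.map D.d LinearMap.id (D.coact w) +
    TensorProduct.map (parity 𝒜) (FODC.Env.d c) (D.coact w) := D.Ψ_d w

theorem d_mem_baseForms {μ : Ω} (hμ : μ ∈ D.baseForms) : D.d μ ∈ D.baseForms := by
  rw [mem_baseForms_iff] at hμ ⊢
  rw [coact_d, hμ, TensorProduct.map_tmul, TensorProduct.map_tmul,
    (FODC.Env.isDifferential c).map_one, TensorProduct.tmul_zero, add_zero]
  rfl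

theorem parity_mem_baseForms {μ : Ω} (hμ : μ ∈ D.baseForms) : parity 𝒜 μ ∈ D.baseForms := by
  rw [mem_baseForms_iff] at hμ ⊢
  rw [coact_parity, hμ, TensorProduct.map_tmul, parity_one]

theorem parity_incl (p : P) : parity 𝒜 (D.incl p) = D.incl p :=
  parity_of_mem_zero 𝒜 (D.isDiffCoaction.mem_zero p)

/-- The differential `w ⊗ z ↦ dw ⊗ z + (-1)^k w ⊗ dz` on `Ω ⊗_{Ω(M)} Ω`. -/
def dif : Module.End ℂ D.BalancedTensor :=
  D.blift (D.bmk ∘ₗ (TensorProduct.map D.d LinearMap.id + TensorProduct.map (parity 𝒜) D.d))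
    (fun w z μ hμ => by
      simp only [LinearMap.comp_apply, LinearMap.add_apply, TensorProduct.map_tmul,
        D.isDifferential.map_mul, parity_mul, LinearMap.id_apply, TensorProduct.add_tmul,
        TensorProduct.tmul_add, map_add, D.bmk_mul _ _ _ hμ,
        D.bmk_mul _ _ _ (D.d_mem_baseForms hμ), D.bmk_mul _ _ _ (D.parity_mem_baseForms hμ)]
      abel)

theorem dif_bmk (w z : Ω) : D.dif (D.bmk (w ⊗ₜ z)) =
    D.bmk (D.d w ⊗ₜ z) + D.bmk (parity 𝒜 w ⊗ₜ D.d z) := rfl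

/-- The parity operator of the total degree on `Ω ⊗_{Ω(M)} Ω`. -/
def twist : Module.End ℂ D.BalancedTensor :=
  D.blift (D.bmk ∘ₗ TensorProduct.map (parity 𝒜) (parity 𝒜)) (fun w z μ hμ => by
    simp only [LinearMap.comp_apply, TensorProduct.map_tmul, parity_mul,
      D.bmk_mul _ _ _ (D.parity_mem_baseForms hμ)])

theorem twist_bmk (w z : Ω) :
    D.twist (D.bmk (w ⊗ₜ z)) = D.bmk (parity 𝒜 w ⊗ₜ parity 𝒜 z) := rfl

theorem dif_dif (t : D.BalancedTensor) : D.dif (D.dif t) = 0 := by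
  induction t using D.bmk_induction with
  | tmul w z =>
    simp only [dif_bmk, map_add, D.isDifferential.sq, D.isDifferential.map_parity,
      TensorProduct.zero_tmul, TensorProduct.tmul_zero, map_zero, TensorProduct.neg_tmul, map_neg]
    abel
  | add t t' ht ht' => simp only [map_add, ht, ht', add_zero]

theorem dif_one : D.dif (D.bmk (1 ⊗ₜ 1)) = 0 := by
  rw [dif_bmk, D.isDifferential.map_one]
  simp

theorem dif_leftMul (w : Ω) (t : D.BalancedTensor) : D.dif (D.leftMul w t) =
    D.leftMul (D.d w) t + D.leftMul (parity 𝒜 w) (D.dif t) := by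
  induction t using D.bmk_induction with
  | tmul x z =>
    simp only [leftMul_bmk, dif_bmk, D.isDifferential.map_mul, parity_mul, map_add,
      TensorProduct.add_tmul, add_assoc]
  | add t t' ht ht' => simp only [map_add, ht, ht']; abel

theorem dif_rightMul (w : Ω) (t : D.BalancedTensor) : D.dif (D.rightMul w t) =
    D.rightMul w (D.dif t) + D.rightMul (D.d w) (D.twist t) := by
  induction t using D.bmk_induction with
  | tmul x z =>
    simp only [rightMul_bmk, dif_bmk, twist_bmk, D.isDifferential.map_mul, map_add,
      TensorProduct.tmul_add, add_assoc]
  | add t t' ht ht' => simp only [map_add, ht, ht']; abel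

theorem twist_leftMul (w : Ω) (t : D.BalancedTensor) :
    D.twist (D.leftMul w t) = D.leftMul (parity 𝒜 w) (D.twist t) := by
  induction t using D.bmk_induction with
  | tmul x z => simp only [leftMul_bmk, twist_bmk, parity_mul]
  | add t t' ht ht' => simp only [map_add, ht, ht']

theorem twist_rightMul (w : Ω) (t : D.BalancedTensor) :
    D.twist (D.rightMul w t) = D.rightMul (parity 𝒜 w) (D.twist t) := by
  induction t using D.bmk_induction with
  | tmul x z => simp only [rightMul_bmk, twist_bmk, parity_mul]
  | add t t' ht ht' => simp only [map_add, ht, ht']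

variable (c 𝒜) in
theorem inR_of0_mul_of (g : G) (t : Ω ⊗[ℂ] c.Env) :
    inR c 𝒜 (of0 c g) * GradedTensorProduct.of ℂ 𝒜 (grading c) t =
      GradedTensorProduct.of ℂ 𝒜 (grading c)
        (TensorProduct.map LinearMap.id (LinearMap.mulLeft ℂ (of0 c g)) t) := by
  induction t using TensorProduct.induction_on with
  | zero => simp
  | add t t' ht ht' => simp only [map_add, mul_add, ht, ht']
  | tmul w ϑ =>
    refine (tmul_mul_tmul_left_zero 𝒜 (grading c) 1 (of0_mem c g) w ϑ).trans ?_
    rw [one_mul]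
    rfl

variable (c 𝒜) in
theorem inR_d0_mul_of (g : G) (t : Ω ⊗[ℂ] c.Env) :
    inR c 𝒜 (d0 c g) * GradedTensorProduct.of ℂ 𝒜 (grading c) t =
      GradedTensorProduct.of ℂ 𝒜 (grading c)
        (TensorProduct.map (parity 𝒜) (LinearMap.mulLeft ℂ (d0 c g)) t) := by
  induction t using TensorProduct.induction_on with
  | zero => simp
  | add t t' ht ht' => simp only [map_add, mul_add, ht, ht']
  | tmul w ϑ =>
    refine (tmul_mul_tmul_left_one 𝒜 (grading c) 1 (d0_mem c g) w ϑ).trans ?_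
    rw [one_mul]
    rfl

theorem canonical_dif (t : D.BalancedTensor) : D.canonical (D.dif t) =
    TensorProduct.map D.d LinearMap.id (D.canonical t) +
      TensorProduct.map (parity 𝒜) (FODC.Env.d c) (D.canonical t) := by
  have key : ∀ (w : Ω) (y : Ω ⊗[ℂ] c.Env), (LinearMap.mulLeft ℂ (D.d w)).rTensor c.Env y +
      (LinearMap.mulLeft ℂ (parity 𝒜 w)).rTensor c.Env (TensorProduct.map D.d LinearMap.id y +
        TensorProduct.map (parity 𝒜) (FODC.Env.d c) y) =
      TensorProduct.map D.d LinearMap.id ((LinearMap.mulLeft ℂ w).rTensor c.Env y) +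
      TensorProduct.map (parity 𝒜) (FODC.Env.d c) ((LinearMap.mulLeft ℂ w).rTensor c.Env y) := by
    intro w y
    induction y using TensorProduct.induction_on with
    | zero => simp
    | add t t' ht ht' => 
      have e := congrArg₂ HAdd.hAdd ht ht'
      simp only [map_add] at e ⊢
      refine Eq.trans ?_ (e.trans ?_) <;> abel
    | tmul x ϑ =>
      simp [D.isDifferential.map_mul, parity_mul, TensorProduct.add_tmul, add_assoc]
  induction t using D.bmk_induction with
  | tmul w z => rw [dif_bmk, map_add, canonical_bmk, canonical_bmk, canonical_bmk, coact_d, key]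
  | add t t' ht ht' => simp only [map_add, ht, ht']; abel

section Operators

variable [h : Fact c.IsBicovariant] (hG : IsCompactMatrixQuantumGroup G)
  {s : G →ₗ[ℂ] D.BalancedTensor} (hs : D.IsGroupTranslation s)

include hG hs in
theorem twist_translation (g : G) : D.twist (s g) = s g := by
  refine mem_of_coeff hG (LinearMap.eqLocus (D.twist ∘ₗ s) s) (fun n u hu hirr i j => ?_) g
  obtain ⟨m, x, hx, e⟩ := hs n u hu hirr
  change D.twist (s (u i j)) = s (u i j)
  rw [e, map_sum]
  simp only [twist_bmk, parity_incl]

theorem twist_fiberHom (g : G) (t : D.BalancedTensor) :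
    D.twist (D.fiberHom hG hs g t) = D.fiberHom hG hs g (D.twist t) := by
  induction t using D.bmk_induction with
  | tmul x z =>
    rw [fiberHom_apply, fiberHom_apply, twist_bmk, fiberAct_bmk, fiberAct_bmk, twist_leftMul,
      twist_rightMul, D.twist_translation hG hs]
  | add t t' ht ht' => simp only [map_add, ht, ht']

/-- The commutators of the operators `w ⊗ z ↦ w s(g) z` with the differential. -/
def fiberDer : G →ₗ[ℂ] Module.End ℂ D.BalancedTensor :=
  (LinearMap.mulLeft ℂ D.dif - LinearMap.mulRight ℂ D.dif) ∘ₗ (D.fiberHom hG hs).toLinearMap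

theorem fiberDer_eq (g : G) : D.fiberDer hG hs g =
    D.dif * D.fiberHom hG hs g - D.fiberHom hG hs g * D.dif := rfl

theorem fiberDer_apply (g : G) (t : D.BalancedTensor) : D.fiberDer hG hs g t =
    D.dif (D.fiberHom hG hs g t) - D.fiberHom hG hs g (D.dif t) := rfl

theorem fiberDer_mul (g g' : G) : D.fiberDer hG hs (g * g') =
    D.fiberDer hG hs g * D.fiberHom hG hs g' + D.fiberHom hG hs g * D.fiberDer hG hs g' := by
  simp only [fiberDer_eq, map_mul, sub_mul, mul_sub, mul_assoc]
  abel

theorem fiberHom_leftMul (g : G) (w : Ω) (t : D.BalancedTensor) :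
    D.fiberHom hG hs g (D.leftMul w t) = D.leftMul w (D.fiberHom hG hs g t) :=
  D.fiberAct_leftMul hG hs g w t

theorem fiberHom_rightMul (g : G) (w : Ω) (t : D.BalancedTensor) :
    D.fiberHom hG hs g (D.rightMul w t) = D.rightMul w (D.fiberHom hG hs g t) :=
  D.fiberAct_rightMul hG hs g w t

theorem fiberHom_one (g : G) : D.fiberHom hG hs g (D.bmk (1 ⊗ₜ 1)) = s g := by
  have : D.bmk (1 ⊗ₜ 1) = s 1 := (D.translation_one hG hs).symm
  rw [this, fiberHom_apply, fiberAct_translation, mul_one]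

theorem fiberDer_leftMul (g : G) (w : Ω) (t : D.BalancedTensor) :
    D.fiberDer hG hs g (D.leftMul w t) =
      D.leftMul (parity 𝒜 w) (D.fiberDer hG hs g t) := by
  simp only [fiberDer_apply, fiberHom_leftMul, dif_leftMul, map_add, map_sub]
  abel

theorem fiberDer_rightMul (g : G) (w : Ω) (t : D.BalancedTensor) :
    D.fiberDer hG hs g (D.rightMul w t) = D.rightMul w (D.fiberDer hG hs g t) := by
  simp only [fiberDer_apply, fiberHom_rightMul, dif_rightMul, map_add, map_sub, twist_fiberHom]
  abel

theorem canonical_fiberDer (g : G) (t : D.BalancedTensor) :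
    GradedTensorProduct.of ℂ 𝒜 (grading c) (D.canonical (D.fiberDer hG hs g t)) =
      inR c 𝒜 (d0 c g) * GradedTensorProduct.of ℂ 𝒜 (grading c) (D.canonical t) := by
  have hf : ∀ t, D.canonical (D.fiberHom hG hs g t) =
      TensorProduct.map LinearMap.id (LinearMap.mulLeft ℂ (of0 c g)) (D.canonical t) := by
    intro t
    apply (GradedTensorProduct.of ℂ 𝒜 (grading c)).injective
    rw [fiberHom_apply, canonical_fiberAct, inR_of0_mul_of]
  have key : ∀ y : Ω ⊗[ℂ] c.Env,
      (TensorProduct.map D.d LinearMap.id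
          (TensorProduct.map LinearMap.id (LinearMap.mulLeft ℂ (of0 c g)) y) +
        TensorProduct.map (parity 𝒜) (FODC.Env.d c)
          (TensorProduct.map LinearMap.id (LinearMap.mulLeft ℂ (of0 c g)) y)) -
      TensorProduct.map LinearMap.id (LinearMap.mulLeft ℂ (of0 c g))
        (TensorProduct.map D.d LinearMap.id y + TensorProduct.map (parity 𝒜) (FODC.Env.d c) y) =
      TensorProduct.map (parity 𝒜) (LinearMap.mulLeft ℂ (d0 c g)) y := by
    intro y
    induction y using TensorProduct.induction_on with
    | zero => simp
    | add t t' ht ht' => simp only [map_add] at ht ht' ⊢; rw [← ht, ← ht']; abel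
    | tmul x ϑ =>
      have e : FODC.Env.d c (of0 c g * ϑ) = d0 c g * ϑ + of0 c g * FODC.Env.d c ϑ := by
        rw [(FODC.Env.isDifferential c).map_mul, parity_of_mem_zero _ (of0_mem c g), d_of0]
        rfl
      simp [e, TensorProduct.tmul_add]
  rw [inR_d0_mul_of, fiberDer_apply, map_sub, canonical_dif, hf, hf, canonical_dif, key]

theorem dif_mul_fiberDer (g : G) :
    D.dif * D.fiberDer hG hs g = - (D.fiberDer hG hs g * D.dif) := by
  have h2 : D.dif * D.dif = 0 := LinearMap.ext D.dif_dif
  rw [fiberDer_eq, mul_sub, sub_mul, ← mul_assoc, h2, mul_assoc _ D.dif D.dif, h2]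
  simp [mul_assoc]

/-- The quadratic relations of the envelope follow from the linear ones by applying the
differential. -/
theorem mul'_fiberDer_fiberDer (y : G ⊗[ℂ] G) :
    LinearMap.mul' ℂ _ (TensorProduct.map (D.fiberDer hG hs) (D.fiberDer hG hs) y) =
      D.dif * LinearMap.mul' ℂ _ (TensorProduct.map (D.fiberHom hG hs).toLinearMap
        (D.fiberDer hG hs) y) + LinearMap.mul' ℂ _ (TensorProduct.map
          (D.fiberHom hG hs).toLinearMap (D.fiberDer hG hs) y) * D.dif := by
  induction y using TensorProduct.induction_on with
  | zero => simp
  | add t t' ht ht' => simp only [map_add, mul_add, add_mul, ht, ht']; abel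
  | tmul a b =>
    simp only [TensorProduct.map_tmul, LinearMap.mul'_apply, AlgHom.toLinearMap_apply]
    rw [mul_assoc _ _ D.dif, ← neg_eq_iff_eq_neg.mpr (D.dif_mul_fiberDer hG hs b),
      D.fiberDer_eq hG hs a, sub_mul, mul_neg, mul_assoc, mul_assoc, sub_eq_add_neg]

end Operators

end BundleCalculus

/-! ### The action of the envelope and the inverse of the canonical map -/

namespace BundleCalculus

open FODC.Env WithConv

variable {G P : Type*} [Ring G] [HopfAlgebra ℂ G] [StarRing G] [StarModule ℂ G]
  [Ring P] [Algebra ℂ P] [StarRing P] [StarModule ℂ P]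
  {Γ Ω : Type*} [AddCommGroup Γ] [Module ℂ Γ] [Module G Γ] [Module Gᵐᵒᵖ Γ]
  [IsScalarTower ℂ G Γ] [IsScalarTower ℂ Gᵐᵒᵖ Γ] [SMulCommClass G Gᵐᵒᵖ Γ]
  [Ring Ω] [Algebra ℂ Ω]
  {B : QuantumPrincipalBundle G P} {c : FODC G Γ} {𝒜 : ℕ → Submodule ℂ Ω}
  [GradedAlgebra 𝒜] (D : BundleCalculus B c 𝒜)

theorem bmk_eq_leftMul_rightMul (w z : Ω) :
    D.bmk (w ⊗ₜ z) = D.leftMul w (D.rightMul z (D.bmk (1 ⊗ₜ 1))) := by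
  rw [rightMul_bmk, leftMul_bmk, one_mul, mul_one]

/-- The operators of odd degree that commute with the two multiplications, in the graded sense
for the left one. -/
def oddOperators : Submodule ℂ (Module.End ℂ D.BalancedTensor) where
  carrier := {T | (∀ w t, T (D.leftMul w t) = D.leftMul (parity 𝒜 w) (T t)) ∧
    ∀ z t, T (D.rightMul z t) = D.rightMul z (T t)}
  zero_mem' := by simp
  add_mem' := fun hS hT => ⟨fun w t => by simp [hS.1, hT.1], fun z t => by simp [hS.2, hT.2]⟩
  smul_mem' := fun r T hT => ⟨fun w t => by simp [hT.1], fun z t => by simp [hT.2]⟩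

theorem eq_zero_of_mem_oddOperators {T : Module.End ℂ D.BalancedTensor}
    (hT : T ∈ D.oddOperators) (h1 : T (D.bmk (1 ⊗ₜ 1)) = 0) : T = 0 :=
  D.balanced_ext fun w z => by
    rw [bmk_eq_leftMul_rightMul, hT.1, hT.2, h1, map_zero, map_zero, LinearMap.zero_apply]

section Envelope

variable [h : Fact c.IsBicovariant] (hG : IsCompactMatrixQuantumGroup G)
  {s : G →ₗ[ℂ] D.BalancedTensor} (hs : D.IsGroupTranslation s)

theorem zeroCoaction_incl (p : P) :
    D.zeroCoaction.map (D.incl p) = D.incl.toLinearMap.rTensor G (B.coact p) := by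
  rw [zeroCoaction_map, coact_incl]
  generalize B.coact p = t
  induction t using TensorProduct.induction_on with
  | zero => simp
  | add t t' ht ht' => simp only [map_add, ht, ht']
  | tmul p g => simp

theorem maurerCartan_mem_oddOperators (g : G) :
    maurerCartan (D.fiberHom hG hs) (D.fiberDer hG hs) g ∈ D.oddOperators := by
  rw [maurerCartan_apply]
  generalize Coalgebra.comul (R := ℂ) g = y
  induction y using TensorProduct.induction_on with
  | zero => simp
  | add t t' ht ht' => simp only [map_add]; exact add_mem ht ht'
  | tmul a b =>
    constructor <;> intro w t <;>
      simp only [TensorProduct.map_tmul, LinearMap.mul'_apply, LinearMap.comp_apply,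
        Module.End.mul_apply, AlgHom.toLinearMap_apply, fiberDer_leftMul, fiberHom_leftMul,
        fiberDer_rightMul, fiberHom_rightMul]

theorem canonical_maurerCartan (g : G) (t : D.BalancedTensor) :
    GradedTensorProduct.of ℂ 𝒜 (grading c) (D.canonical
      (maurerCartan (D.fiberHom hG hs) (D.fiberDer hG hs) g t)) =
      inR c 𝒜 (maurerCartan (of0 c) (d0 c) g) *
        GradedTensorProduct.of ℂ 𝒜 (grading c) (D.canonical t) := by
  rw [maurerCartan_apply, maurerCartan_apply]
  generalize Coalgebra.comul (R := ℂ) g = y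
  induction y using TensorProduct.induction_on with
  | zero => simp only [map_zero, LinearMap.zero_apply, zero_mul]
  | add t t' ht ht' => simp only [map_add, LinearMap.add_apply, add_mul, ht, ht']
  | tmul a b =>
    simp only [TensorProduct.map_tmul, LinearMap.mul'_apply, LinearMap.comp_apply,
      Module.End.mul_apply, AlgHom.toLinearMap_apply, map_mul, mul_assoc]
    rw [fiberHom_apply, canonical_fiberAct, canonical_fiberDer]

include hG hs in
/-- For a frame `x`, the forms `∑ₖ (x k i)* d(x k j)` represent the Maurer–Cartan form modulo
horizontal terms, both for the operators and in `Ω ⊗ Γ^∧`. -/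
theorem exists_maurerCartan_representative (g : G) : ∃ A : Ω,
    maurerCartan (D.fiberHom hG hs) (D.fiberDer hG hs) g (D.bmk (1 ⊗ₜ 1)) - D.bmk (1 ⊗ₜ A) ∈
      D.horizontalPart s ∧
    D.coact A - 1 ⊗ₜ maurerCartan (of0 c) (d0 c) g ∈
      LinearMap.range ((of0 c).toLinearMap.lTensor Ω) := by
  let S : Submodule ℂ G :=
    { carrier := {g | ∃ A : Ω, maurerCartan (D.fiberHom hG hs) (D.fiberDer hG hs) g
          (D.bmk (1 ⊗ₜ 1)) - D.bmk (1 ⊗ₜ A) ∈ D.horizontalPart s ∧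
        D.coact A - 1 ⊗ₜ maurerCartan (of0 c) (d0 c) g ∈
          LinearMap.range ((of0 c).toLinearMap.lTensor Ω)}
      zero_mem' := ⟨0, by simp, by simp⟩
      add_mem' := by
        rintro g g' ⟨A, h1, h2⟩ ⟨A', h1', h2'⟩
        refine ⟨A + A', ?_, ?_⟩
        · convert add_mem h1 h1' using 1
          simp only [map_add, LinearMap.add_apply, TensorProduct.tmul_add]
          abel
        · convert add_mem h2 h2' using 1
          simp only [map_add, TensorProduct.tmul_add]
          abel
      smul_mem' := by
        rintro r g ⟨A, h1, h2⟩
        refine ⟨r • A, ?_, ?_⟩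
        · convert Submodule.smul_mem _ r h1 using 1
          simp only [map_smul, LinearMap.smul_apply, TensorProduct.tmul_smul, smul_sub]
        · convert Submodule.smul_mem _ r h2 using 1
          simp only [map_smul, TensorProduct.tmul_smul, smul_sub] }
  refine mem_of_coeff hG S (fun n u hu hirr i j => ?_) g
  obtain ⟨m, x, hx, e⟩ := hs n u hu hirr
  refine ⟨∑ k, D.incl (star (x k i)) * D.d (D.incl (x k j)), ?_, ?_⟩
  · have h1 : ∀ l, D.fiberDer hG hs (u l j) (D.bmk (1 ⊗ₜ 1)) =
        ∑ k, (D.bmk (D.d (D.incl (star (x k l))) ⊗ₜ D.incl (x k j)) +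
          D.bmk (D.incl (star (x k l)) ⊗ₜ D.d (D.incl (x k j)))) := by
      intro l
      rw [fiberDer_apply, fiberHom_one, dif_one, map_zero, sub_zero, e, map_sum]
      simp only [dif_bmk, parity_incl]
    have h2 : ∀ k, ∑ l, D.leftMul (D.incl (star (x k l))) (D.rightMul (D.d (D.incl (x k j)))
        (s (star (u l i)))) = D.bmk (1 ⊗ₜ (D.incl (star (x k i)) * D.d (D.incl (x k j)))) := by
      intro k
      have h3 := D.extend_zeroCoaction hG hs (D.incl_mem_horizontal (star (x k i)))
      rw [zeroCoaction_incl, hx.coact_star] at h3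
      simp only [map_sum, LinearMap.rTensor_tmul, AlgHom.toLinearMap_apply, extend_tmul] at h3
      simp only [leftMul_rightMul, ← map_sum]
      rw [h3, rightMul_bmk]
    have h4 : maurerCartan (D.fiberHom hG hs) (D.fiberDer hG hs) (u i j) (D.bmk (1 ⊗ₜ 1)) =
        ∑ l, ∑ k, (D.leftMul (D.d (D.incl (star (x k l)))) (D.rightMul (D.incl (x k j))
          (s (star (u l i)))) + D.leftMul (D.incl (star (x k l)))
            (D.rightMul (D.d (D.incl (x k j))) (s (star (u l i))))) := by
      rw [maurerCartan_apply, hu.comul]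
      simp only [map_sum, TensorProduct.map_tmul, LinearMap.mul'_apply, LinearMap.comp_apply,
        AlgHom.toLinearMap_apply, LinearMap.sum_apply, Module.End.mul_apply, h1, map_add,
        fiberHom_apply, fiberAct_bmk, hu.antipode_apply]
    rw [h4, TensorProduct.tmul_sum, map_sum]
    simp only [← h2, Finset.sum_add_distrib]
    rw [Finset.sum_comm (f := fun l k => D.leftMul (D.incl (star (x k l)))
      (D.rightMul (D.d (D.incl (x k j))) (s (star (u l i))))), add_sub_cancel_right]
    exact Submodule.sum_mem _ fun l _ => Submodule.sum_mem _ fun k _ =>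
      D.leftMul_mem_horizontalPart _
        (D.rightMul_translation_mem hG hs (D.incl_mem_horizontal _) _)
  · have h1 : ∀ k, D.coact (D.incl (star (x k i)) * D.d (D.incl (x k j))) =
        ∑ a, ∑ l, ((D.incl (star (x k l)) * D.d (D.incl (x k a))) ⊗ₜ of0 c (star (u l i) * u a j) +
          D.incl (star (x k l) * x k a) ⊗ₜ (of0 c (star (u l i)) * d0 c (u a j))) := by
      intro k
      rw [coact_mul_d_incl, coact_incl, hx.coact, hx.coact_star]
      simp only [map_sum, TensorProduct.map_tmul, LinearMap.sum_apply, mulOne_tmul,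
        AlgHom.toLinearMap_apply, LinearMap.comp_apply, map_mul,
        parity_of_mem_zero (grading c) (of0_mem c _)]
    have h2 : ∑ k, ∑ a, ∑ l, D.incl (star (x k l) * x k a) ⊗ₜ[ℂ]
        (of0 c (star (u l i)) * d0 c (u a j)) = 1 ⊗ₜ maurerCartan (of0 c) (d0 c) (u i j) := by
      rw [maurerCartan_apply, hu.comul, Finset.sum_comm]
      simp only [map_sum, TensorProduct.tmul_sum]
      refine Finset.sum_congr rfl fun a _ => ?_
      rw [Finset.sum_comm]
      simp only [← TensorProduct.sum_tmul, ← map_sum, hx.orthonormal]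
      simp [apply_ite, TensorProduct.ite_tmul, hu.antipode_apply]
    rw [map_sum]
    simp only [h1, Finset.sum_add_distrib]
    rw [h2, add_sub_cancel_right]
    exact Submodule.sum_mem _ fun k _ => Submodule.sum_mem _ fun a _ => Submodule.sum_mem _
      fun l _ => ⟨_, LinearMap.lTensor_tmul _ _ _ _⟩

theorem maurerCartan_eq_zero (g : G) (hg : maurerCartan (of0 c) (d0 c) g = 0) :
    maurerCartan (D.fiberHom hG hs) (D.fiberDer hG hs) g = 0 := by
  refine D.eq_zero_of_mem_oddOperators (D.maurerCartan_mem_oddOperators hG hs g) ?_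
  obtain ⟨A, h1, h2⟩ := D.exists_maurerCartan_representative hG hs g
  rw [hg, TensorProduct.tmul_zero, sub_zero] at h2
  have h3 := add_mem h1 (D.bmk_mem_horizontalPart hG hs 1 (D.mem_horizontal_of_range h2))
  rw [sub_add_cancel] at h3
  refine D.eq_of_mem_horizontalPart h3 (zero_mem _) ?_
  apply (GradedTensorProduct.of ℂ 𝒜 (grading c)).injective
  rw [canonical_maurerCartan, hg, map_zero, zero_mul, map_zero, map_zero]

/-- The action of `Γ^∧` on `Ω ⊗_{Ω(M)} Ω`, which corresponds to left multiplication on the second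
factor of `Ω ⊗ Γ^∧`. -/
def envAct : c.Env →ₐ[ℂ] Module.End ℂ D.BalancedTensor :=
  lift c (D.fiberHom hG hs) (D.fiberDer hG hs) (D.fiberDer_mul hG hs)
    (mul'_map_eq_zero_of_maurerCartan h.out _ _ (D.maurerCartan_eq_zero hG hs))
    (fun x hx => by
      rw [mul'_fiberDer_fiberDer, mul'_map_eq_zero_of_maurerCartan h.out _ _
        (D.maurerCartan_eq_zero hG hs) x hx, mul_zero, zero_mul, add_zero])

theorem envAct_of0 (g : G) : D.envAct hG hs (of0 c g) = D.fiberHom hG hs g :=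
  lift_of0 c _ _ _ _ _ g

theorem envAct_d0 (g : G) : D.envAct hG hs (d0 c g) = D.fiberDer hG hs g :=
  lift_d0 c _ _ _ _ _ g

/-- Induction over products of the generators `a` and `da` of `Γ^∧`. -/
theorem _root_.QGauge.FODC.Env.induction_d0 {p : c.Env → Prop} (h0 : ∀ a, p (of0 c a))
    (h1 : ∀ a, p (d0 c a)) (hadd : ∀ x y, p x → p y → p (x + y))
    (hmul : ∀ x y, p x → p y → p (x * y)) (w : c.Env) : p w := by
  induction w using FODC.Env.induction with
  | h0 a => exact h0 a
  | h1 ξ =>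
    obtain ⟨x, rfl⟩ := c.form_surjective ξ
    rw [← mul_of0_d0]
    induction x using TensorProduct.induction_on with
    | zero => simpa using h0 0
    | tmul a b => exact hmul _ _ (h0 a) (h1 b)
    | add x y hx hy => rw [map_add, map_add]; exact hadd _ _ hx hy
  | hadd x y hx hy => exact hadd x y hx hy
  | hmul x y hx hy => exact hmul x y hx hy

theorem canonical_envAct (ϑ : c.Env) : ∀ t : D.BalancedTensor,
    GradedTensorProduct.of ℂ 𝒜 (grading c) (D.canonical (D.envAct hG hs ϑ t)) =
      inR c 𝒜 ϑ * GradedTensorProduct.of ℂ 𝒜 (grading c) (D.canonical t) := by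
  induction ϑ using FODC.Env.induction_d0 with
  | h0 a => intro t; rw [envAct_of0, fiberHom_apply, canonical_fiberAct]
  | h1 a => intro t; rw [envAct_d0, canonical_fiberDer]
  | hadd x y hx hy => intro t; simp only [map_add, LinearMap.add_apply, add_mul, hx, hy]
  | hmul x y hx hy => intro t; rw [map_mul, Module.End.mul_apply, hx, hy, map_mul, mul_assoc]

theorem envAct_rightMul (ϑ : c.Env) (z : Ω) : ∀ t : D.BalancedTensor,
    D.envAct hG hs ϑ (D.rightMul z t) = D.rightMul z (D.envAct hG hs ϑ t) := by
  induction ϑ using FODC.Env.induction_d0 with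
  | h0 a => intro t; rw [envAct_of0, fiberHom_rightMul]
  | h1 a => intro t; rw [envAct_d0, fiberDer_rightMul]
  | hadd x y hx hy => intro t; simp only [map_add, LinearMap.add_apply, hx, hy]
  | hmul x y hx hy => intro t; rw [map_mul, Module.End.mul_apply, Module.End.mul_apply, hy, hx]

theorem envAct_leftMul_zero (ϑ : c.Env) {w : Ω} (hw : w ∈ 𝒜 0) : ∀ t : D.BalancedTensor,
    D.envAct hG hs ϑ (D.leftMul w t) = D.leftMul w (D.envAct hG hs ϑ t) := by
  induction ϑ using FODC.Env.induction_d0 with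
  | h0 a => intro t; rw [envAct_of0, fiberHom_leftMul]
  | h1 a => intro t; rw [envAct_d0, fiberDer_leftMul, parity_of_mem_zero 𝒜 hw]
  | hadd x y hx hy => intro t; simp only [map_add, LinearMap.add_apply, hx, hy]
  | hmul x y hx hy => intro t; rw [map_mul, Module.End.mul_apply, Module.End.mul_apply, hy, hx]

theorem envAct_leftMul_one (ϑ : c.Env) {w : Ω} (hw : w ∈ 𝒜 1) : ∀ t : D.BalancedTensor,
    D.envAct hG hs ϑ (D.leftMul w t) =
      D.leftMul w (D.envAct hG hs (parity (grading c) ϑ) t) := by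
  induction ϑ using FODC.Env.induction_d0 with
  | h0 a =>
    intro t
    rw [parity_of_mem_zero (grading c) (of0_mem c a), envAct_of0, fiberHom_leftMul]
  | h1 a =>
    intro t
    rw [parity_of_mem_one (grading c) (d0_mem c a), map_neg, envAct_d0, fiberDer_leftMul,
      parity_of_mem_one 𝒜 hw, ← leftMulₗ_apply, map_neg, LinearMap.neg_apply, LinearMap.neg_apply,
      map_neg, leftMulₗ_apply]
  | hadd x y hx hy => intro t; simp only [map_add, LinearMap.add_apply, hx, hy]
  | hmul x y hx hy =>
    intro t
    rw [map_mul, Module.End.mul_apply, hy, hx, parity_mul, map_mul, Module.End.mul_apply]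

/-- The inverse `w ⊗ ϑ ↦ w τ(ϑ)` of the canonical map. -/
def canonicalInv : Ω ⊗[ℂ] c.Env →ₗ[ℂ] D.BalancedTensor :=
  TensorProduct.lift (LinearMap.compl₂ D.leftMulₗ
    (LinearMap.applyₗ (D.bmk (1 ⊗ₜ 1)) ∘ₗ (D.envAct hG hs).toLinearMap))

theorem canonicalInv_tmul (w : Ω) (ϑ : c.Env) : D.canonicalInv hG hs (w ⊗ₜ ϑ) =
    D.leftMul w (D.envAct hG hs ϑ (D.bmk (1 ⊗ₜ 1))) := rfl

theorem canonical_canonicalInv (t : Ω ⊗[ℂ] c.Env) :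
    D.canonical (D.canonicalInv hG hs t) = t := by
  induction t using TensorProduct.induction_on with
  | zero => simp
  | add t t' ht ht' => simp only [map_add, ht, ht']
  | tmul w ϑ =>
    apply (GradedTensorProduct.of ℂ 𝒜 (grading c)).injective
    rw [canonicalInv_tmul, canonical_leftMul, ← inL_mul_of, canonical_envAct, canonical_bmk,
      coact_one, ← inL_mul_of, ← inL_mul_inR c 𝒜 1 1, map_one, map_one, mul_one, mul_one,
      mul_one, inL_mul_inR]

/-- On the elements of degree zero the inverse is known, because they are horizontal. -/
theorem canonicalInv_map_of0 (p : P) :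
    D.canonicalInv hG hs (TensorProduct.map D.incl.toLinearMap (of0 c).toLinearMap (B.coact p)) =
      D.bmk (1 ⊗ₜ D.incl p) := by
  rw [← D.extend_zeroCoaction hG hs (D.incl_mem_horizontal p), zeroCoaction_incl]
  generalize B.coact p = q
  induction q using TensorProduct.induction_on with
  | zero => simp
  | add t t' ht ht' => simp only [map_add, ht, ht']
  | tmul p g =>
    rw [TensorProduct.map_tmul, canonicalInv_tmul, LinearMap.rTensor_tmul, extend_tmul,
      AlgHom.toLinearMap_apply, AlgHom.toLinearMap_apply, envAct_of0, fiberHom_one]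

theorem canonicalInv_map_d0 (p : P) :
    D.canonicalInv hG hs
      (TensorProduct.map (D.d ∘ₗ D.incl.toLinearMap) (of0 c).toLinearMap (B.coact p) +
        TensorProduct.map D.incl.toLinearMap (d0 c) (B.coact p)) =
      D.bmk (1 ⊗ₜ D.d (D.incl p)) := by
  have h1 : D.dif (D.bmk (1 ⊗ₜ D.incl p)) = D.bmk (1 ⊗ₜ D.d (D.incl p)) := by
    rw [dif_bmk, D.isDifferential.map_one, parity_one]
    simp
  rw [← h1, ← D.canonicalInv_map_of0 hG hs]
  generalize B.coact p = q
  induction q using TensorProduct.induction_on with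
  | zero => simp
  | add t t' ht ht' =>
    simp only [map_add] at ht ht' ⊢
    rw [← ht, ← ht']
    abel
  | tmul p g =>
    simp only [TensorProduct.map_tmul, map_add, canonicalInv_tmul, LinearMap.comp_apply,
      AlgHom.toLinearMap_apply, envAct_of0, envAct_d0, dif_leftMul, parity_incl]
    rw [fiberDer_apply, dif_one, map_zero, sub_zero]

/-- The inverse of the canonical map is right linear along `Ψ`, checked on generators. -/
theorem canonicalInv_coact (z : Ω) :
    D.canonicalInv hG hs (D.coact z) = D.bmk (1 ⊗ₜ z) := by
  have hz := D.isDiffCoaction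
  have zero : ∀ t q, D.canonicalInv hG hs (mulZero c D.incl.toLinearMap t q) =
      TensorProduct.lift (LinearMap.compl₂ D.leftMulₗ (LinearMap.flip
        (D.envAct hG hs).toLinearMap (D.canonicalInv hG hs
          (TensorProduct.map D.incl.toLinearMap (of0 c).toLinearMap q)))) t := by
    intro t q
    induction t using TensorProduct.induction_on with
    | zero => simp
    | add t t' ht ht' => simp only [map_add, LinearMap.add_apply, ht, ht']
    | tmul x ϑ =>
      rw [TensorProduct.lift.tmul, LinearMap.compl₂_apply, LinearMap.flip_apply,
        AlgHom.toLinearMap_apply, leftMulₗ_apply]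
      induction q using TensorProduct.induction_on with
      | zero => simp
      | add q q' hq hq' => simp only [map_add, hq, hq']
      | tmul p g =>
        rw [mulZero_tmul, canonicalInv_tmul, TensorProduct.map_tmul, canonicalInv_tmul,
          envAct_leftMul_zero _ _ _ _ (hz.mem_zero p), map_mul, Module.End.mul_apply, leftMul_mul]
        rfl
  have one : ∀ t q, D.canonicalInv hG hs
      (mulOne c D.incl.toLinearMap (D.d ∘ₗ D.incl.toLinearMap) t q) =
      TensorProduct.lift (LinearMap.compl₂ D.leftMulₗ (LinearMap.flip
        (D.envAct hG hs).toLinearMap (D.canonicalInv hG hs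
          (TensorProduct.map (D.d ∘ₗ D.incl.toLinearMap) (of0 c).toLinearMap q +
            TensorProduct.map D.incl.toLinearMap (d0 c) q)))) t := by
    intro t q
    induction t using TensorProduct.induction_on with
    | zero => simp
    | add t t' ht ht' => simp only [map_add, LinearMap.add_apply] at ht ht' ⊢; rw [ht, ht']
    | tmul x ϑ =>
      rw [TensorProduct.lift.tmul, LinearMap.compl₂_apply, LinearMap.flip_apply,
        AlgHom.toLinearMap_apply, leftMulₗ_apply]
      induction q using TensorProduct.induction_on with
      | zero => simp
      | add q q' hq hq' =>
        simp only [map_add] at hq hq' ⊢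
        rw [hq, hq']
        abel
      | tmul p g =>
        rw [mulOne_tmul, map_add, canonicalInv_tmul, canonicalInv_tmul, TensorProduct.map_tmul,
          TensorProduct.map_tmul, map_add, canonicalInv_tmul, canonicalInv_tmul, map_add,
          envAct_leftMul_zero _ _ _ _ (hz.mem_zero p), envAct_leftMul_one _ _ _ _ (hz.mem_one p),
          map_mul, map_mul, Module.End.mul_apply, Module.End.mul_apply, map_add, leftMul_mul,
          leftMul_mul]
        rfl
  have right : ∀ (t : Ω ⊗[ℂ] c.Env) (y : Ω), TensorProduct.lift (LinearMap.compl₂ D.leftMulₗ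
      (LinearMap.flip (D.envAct hG hs).toLinearMap (D.bmk (1 ⊗ₜ y)))) t =
      D.rightMul y (D.canonicalInv hG hs t) := by
    intro t y
    induction t using TensorProduct.induction_on with
    | zero => simp
    | add t t' ht ht' => simp only [map_add, ht, ht']
    | tmul x ϑ =>
      rw [TensorProduct.lift.tmul, LinearMap.compl₂_apply, LinearMap.flip_apply,
        AlgHom.toLinearMap_apply, leftMulₗ_apply, canonicalInv_tmul, ← leftMul_rightMul,
        ← envAct_rightMul, rightMul_bmk, one_mul]
  refine hz.induction (LinearMap.eqLocus (D.canonicalInv hG hs ∘ₗ D.coact)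
    (D.bmk ∘ₗ TensorProduct.mk ℂ Ω Ω 1)) ?_ (fun x hx p => ?_) (fun x hx p => ?_) z
  · change D.canonicalInv hG hs (D.coact 1) = D.bmk (1 ⊗ₜ 1)
    rw [coact_one, canonicalInv_tmul, map_one, leftMul_one]
    rfl
  · have hx' : D.canonicalInv hG hs (D.coact x) = D.bmk (1 ⊗ₜ x) := hx
    change D.canonicalInv hG hs (D.coact (x * D.incl p)) = D.bmk (1 ⊗ₜ (x * D.incl p))
    rw [coact_mul_incl, zero, canonicalInv_map_of0, right, hx', rightMul_bmk]
  · have hx' : D.canonicalInv hG hs (D.coact x) = D.bmk (1 ⊗ₜ x) := hx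
    change D.canonicalInv hG hs (D.coact (x * D.d (D.incl p))) =
      D.bmk (1 ⊗ₜ (x * D.d (D.incl p)))
    rw [coact_mul_d_incl, one, canonicalInv_map_d0, right, hx', rightMul_bmk]

theorem canonicalInv_mulLeft (w : Ω) (t : Ω ⊗[ℂ] c.Env) :
    D.canonicalInv hG hs ((LinearMap.mulLeft ℂ w).rTensor c.Env t) =
      D.leftMul w (D.canonicalInv hG hs t) := by
  induction t using TensorProduct.induction_on with
  | zero => simp
  | add t t' ht ht' => simp only [map_add, ht, ht']
  | tmul x ϑ =>
    rw [LinearMap.rTensor_tmul, canonicalInv_tmul, canonicalInv_tmul, LinearMap.mulLeft_apply,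
      leftMul_mul]

theorem canonicalInv_canonical (t : D.BalancedTensor) :
    D.canonicalInv hG hs (D.canonical t) = t := by
  induction t using D.bmk_induction with
  | tmul w z =>
    rw [canonical_bmk, canonicalInv_mulLeft, canonicalInv_coact, leftMul_bmk, mul_one]
  | add t t' ht ht' => simp only [map_add, ht, ht']

include hG hs in
theorem canonical_bijective : Function.Bijective D.canonical :=
  ⟨Function.LeftInverse.injective (D.canonicalInv_canonical hG hs),
    Function.RightInverse.surjective (D.canonical_canonicalInv hG hs)⟩

theorem qtrs_eq_envAct (hβ : Function.Bijective D.canonical) (ϑ : c.Env) :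
    D.qtrs hβ ϑ = D.envAct hG hs ϑ (D.bmk (1 ⊗ₜ 1)) := by
  apply hβ.injective
  rw [canonical_qtrs, ← D.canonical_canonicalInv hG hs (1 ⊗ₜ ϑ), canonicalInv_tmul, leftMul_one]

end Envelope

section Degree

variable (hG : IsCompactMatrixQuantumGroup G)
  {s : G →ₗ[ℂ] D.BalancedTensor} (hs : D.IsGroupTranslation s)

/-- The elements of total degree `n` of `Ω ⊗_{Ω(M)} Ω`. -/
abbrev balancedDegree (n : ℕ) : Submodule ℂ D.BalancedTensor := (totalDegree 𝒜 𝒜 n).map D.bmk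

theorem bmk_mem_balancedDegree {i j n : ℕ} (e : i + j = n) {w z : Ω} (hw : w ∈ 𝒜 i)
    (hz : z ∈ 𝒜 j) : D.bmk (w ⊗ₜ z) ∈ D.balancedDegree n :=
  Submodule.mem_map_of_mem (tmul_mem_totalDegree e hw hz)

theorem balancedDegree_le {n : ℕ} {S : Submodule ℂ D.BalancedTensor}
    (hS : ∀ i j, i + j = n → ∀ w ∈ 𝒜 i, ∀ z ∈ 𝒜 j, D.bmk (w ⊗ₜ z) ∈ S) :
    D.balancedDegree n ≤ S :=
  Submodule.map_le_iff_le_comap.mpr (totalDegree_le hS)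

theorem dif_mem_balancedDegree {n : ℕ} {t : D.BalancedTensor} (ht : t ∈ D.balancedDegree n) :
    D.dif t ∈ D.balancedDegree (n + 1) := by
  refine D.balancedDegree_le (S := (D.balancedDegree (n + 1)).comap D.dif)
    (fun i j e w hw z hz => ?_) ht
  rw [Submodule.mem_comap, dif_bmk]
  exact add_mem (D.bmk_mem_balancedDegree (by omega) (D.isDifferential.mem i w hw) hz)
    (D.bmk_mem_balancedDegree (by omega) (parity_mem 𝒜 hw) (D.isDifferential.mem j z hz))

variable [h : Fact c.IsBicovariant]

theorem fiberHom_mem_balancedDegree {n : ℕ} {t : D.BalancedTensor} (ht : t ∈ D.balancedDegree n)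
    (g : G) : D.fiberHom hG hs g t ∈ D.balancedDegree n := by
  refine D.balancedDegree_le (S := (D.balancedDegree n).comap (D.fiberHom hG hs g))
    (fun i j e w hw z hz => ?_) ht
  rw [Submodule.mem_comap, fiberHom_apply, fiberAct_bmk]
  refine mem_of_coeff hG ((D.balancedDegree n).comap (D.leftMul w ∘ₗ D.rightMul z ∘ₗ s))
    (fun k u hu hirr a b => ?_) g
  obtain ⟨m, x, hx, e'⟩ := hs k u hu hirr
  rw [Submodule.mem_comap, LinearMap.comp_apply, LinearMap.comp_apply, e', map_sum, map_sum]
  refine Submodule.sum_mem _ fun q _ => D.bmk_mem_balancedDegree e ?_ ?_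
  · have := SetLike.mul_mem_graded hw (D.isDiffCoaction.mem_zero (star (x q a)))
    rwa [add_zero] at this
  · have := SetLike.mul_mem_graded (D.isDiffCoaction.mem_zero (x q b)) hz
    rwa [zero_add] at this

theorem envAct_mem_balancedDegree {m n : ℕ} {ϑ : c.Env} (hϑ : ϑ ∈ grading c m)
    {t : D.BalancedTensor} (ht : t ∈ D.balancedDegree n) :
    D.envAct hG hs ϑ t ∈ D.balancedDegree (n + m) := by
  refine grading_induction c (p := fun m ϑ => ∀ n t, t ∈ D.balancedDegree n →
    D.envAct hG hs ϑ t ∈ D.balancedDegree (n + m)) (fun a n t ht => ?_)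
    (fun m x y hx hy n t ht => ?_) (fun m x ξ _ hx n t ht => ?_) hϑ n t ht
  · rw [envAct_of0, add_zero]
    exact D.fiberHom_mem_balancedDegree hG hs ht a
  · rw [map_add, LinearMap.add_apply]
    exact add_mem (hx n t ht) (hy n t ht)
  · rw [map_mul, Module.End.mul_apply, show n + (m + 1) = (n + 1) + m by omega]
    refine hx (n + 1) _ ?_
    obtain ⟨y, rfl⟩ := c.form_surjective ξ
    rw [← mul_of0_d0]
    induction y using TensorProduct.induction_on with
    | zero => simp
    | add y y' hy hy' => simp only [map_add, LinearMap.add_apply]; exact add_mem hy hy'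
    | tmul a b =>
      simp only [TensorProduct.map_tmul, LinearMap.mul'_apply, AlgHom.toLinearMap_apply, map_mul,
        Module.End.mul_apply, envAct_of0, envAct_d0]
      refine D.fiberHom_mem_balancedDegree hG hs ?_ a
      rw [fiberDer_apply]
      exact sub_mem (D.dif_mem_balancedDegree (D.fiberHom_mem_balancedDegree hG hs ht b))
        (D.fiberHom_mem_balancedDegree hG hs (D.dif_mem_balancedDegree ht) b)

include hG hs in
/-- The quantum translation map preserves degrees. -/
theorem qtrs_mem (hβ : Function.Bijective D.canonical) (n : ℕ) (ϑ : c.Env)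
    (hϑ : ϑ ∈ grading c n) : D.qtrs hβ ϑ ∈ (totalDegree 𝒜 𝒜 n).map D.bmk := by
  have one0 : (1 : Ω) ∈ 𝒜 0 := SetLike.GradedOne.one_mem
  have := D.envAct_mem_balancedDegree hG hs hϑ (D.bmk_mem_balancedDegree (n := 0) rfl one0 one0)
  rwa [zero_add, ← D.qtrs_eq_envAct hG hs hβ] at this

end Degree

end BundleCalculus

end QGauge

end

theorem proposition4p1 {G Γ P Ω : Type*}
    [Ring G] [HopfAlgebra ℂ G] [StarRing G] [StarModule ℂ G]
    [AddCommGroup Γ] [Module ℂ Γ] [Module G Γ] [Module Gᵐᵒᵖ Γ]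
    [IsScalarTower ℂ G Γ] [IsScalarTower ℂ Gᵐᵒᵖ Γ] [SMulCommClass G Gᵐᵒᵖ Γ]
    [Ring P] [Algebra ℂ P] [StarRing P] [StarModule ℂ P]
    [Ring Ω] [Algebra ℂ Ω]
    (hG : QGauge.IsCompactMatrixQuantumGroup G)
    (c : QGauge.FODC G Γ) (hc : c.IsBicovariant) (hs : c.IsStarCalculus)
    (B : QGauge.QuantumPrincipalBundle G P) (hB : B.HasFrames)
    (𝒜 : ℕ → Submodule ℂ Ω) [GradedAlgebra 𝒜] (D : QGauge.BundleCalculus B c 𝒜) :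
    ∃ (hβ : Function.Bijective D.canonical) (_ : Group (D.GaugeMap hc)),
      (∀ f g : D.GaugeMap hc, (f * g).1 = D.conv hc f.1 g.1) ∧
      (1 : D.GaugeMap hc).1 = D.convUnit ∧
      ∃ e : (D.gaugeAut)ᵐᵒᵖ ≃* D.GaugeMap hc,
        (∀ F : D.gaugeAut, (e (MulOpposite.op F)).1 =
          D.mulMap F.1.toLinearMap F.2.map_base_mul ∘ₗ D.qtrs hβ) ∧
        ∀ f : D.GaugeMap hc, ((e.symm f).unop.1 : Ω ≃ₗ[ℂ] Ω).toLinearMap =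
          LinearMap.mul' ℂ Ω ∘ₗ TensorProduct.map LinearMap.id f.1 ∘ₗ D.coact := by
  have : Fact c.IsBicovariant := ⟨hc⟩
  obtain ⟨s, hs'⟩ := D.exists_isGroupTranslation hG hB
  have hβ := D.canonical_bijective hG hs'
  let _ := D.gaugeMapGroup
  exact ⟨hβ, D.gaugeMapGroup, fun _ _ => rfl, rfl,
    { toEquiv := D.gaugeEquiv hβ (D.qtrs_mem hG hs' hβ)
      map_mul' := fun F F' => Subtype.ext (D.cotranslate_conv hβ F.unop F'.unop) },
    fun _ => rfl, fun _ => rfl⟩
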